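/- **Theorem 3.1.** Let $d\ge 1$, and let $r\in[2,\infty)$ and $q\in(d,\infty]$ satisfy $\frac2r+\frac dq<1$ (with $d/\infty=0$). Let $u_0\in L^1(\mathbb R^d)\cap L^\infty(\mathbb R^d)$ be real-valued and let $b=b(t,x)$ be a (measurable) vector field in $L^r([0,1];L^q(\mathbb R^d))$ with values in $\mathbb R^d$. Let $u$ be a solution in the parabolic class $$u\in L^2([0,1];H^1(\mathbb R^d)),\qquad u'\in L^2([0,1];H^{-1}(\mathbb R^d))$$ ($u'$ being the distributional time derivative) of the Cauchy problem $$\partial_t u+\operatorname{div}(bu)=\Delta u \ \text{ on } (0,1)\times\mathbb R^d,\qquad u(0,\cdot)=u_0,$$ in the sense that $$\int_0^1\!\!\int_{\mathbb R^d}u\,(\partial_t\varphi+b\cdot\nabla\varphi+\Delta\varphi)\,dx\,dt+\int_{\mathbb R^d}u_0\,\varphi(0,\cdot)\,dx=0\quad\text{for all }\varphi\in C_c^\infty((-\infty,1)\times\mathbb R^d).$$ Then $u$ has a representative in $C([0,1];L^2(\mathbb R^d))$, and this representative, still denoted by $u$, satisfies for every $p\in[1,\infty)$ and every $0\le t\le1$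 $$\|u(t,\cdot)\|_{L^p(\mathbb R^d)}\le C\,\|u_0\|_{L^\infty(\mathbb R^d)}^{\frac{p-1}{p}}\,\|u_0\|_{L^1(\mathbb R^d)}^{\frac1p},\qquad C=C\big(p,r,q,d,\|b\|_{L^r([0,1];L^q(\mathbb R^d))}\big),$$ and for every $0\le t\le1$ $$\|u(t,\cdot)\|_{L^\infty(\mathbb R^d)}\le C\,\|u_0\|_{L^\infty(\mathbb R^d)},\qquad C=C\big(r,q,d,\|b\|_{L^r([0,1];L^q(\mathbb R^d))}\big).$$ In both estimates the constant can be chosen to be the same for all $b$ whose norm does not exceed a given number. -/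

import Mathlib

open MeasureTheory Set
open scoped ENNReal NNReal ContDiff Laplacian

noncomputable section

namespace AdvDiff

/-- The space `ℝ^d` with its Euclidean norm and Lebesgue measure. -/
abbrev E (d : ℕ) : Type := EuclideanSpace ℝ (Fin d)

/-- The real Hilbert space `L²(ℝ^d)`. -/
abbrev L2 (d : ℕ) : Type := Lp ℝ 2 (volume : Measure (E d))

/-- The real Hilbert space `L²(ℝ^d; ℝ^d)`. -/
abbrev L2Vec (d : ℕ) : Type := Lp (E d) 2 (volume : Measure (E d))

/-- Lebesgue measure on the time interval `[0,1]`. -/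
abbrev timeMeasure : Measure ℝ := volume.restrict (Icc (0 : ℝ) 1)

/-- `g` is the weak gradient of `f`: `∫ f ∇φ = - ∫ φ g` for every `φ ∈ C_c^∞(ℝ^d)`. -/
def HasWeakGradient {d : ℕ} (f : E d → ℝ) (g : E d → E d) : Prop :=
  ∀ φ : E d → ℝ, ContDiff ℝ ∞ φ → HasCompactSupport φ →
    ∫ x, f x • gradient φ x = - ∫ x, φ x • g x

theorem integrable_smul_gradient {d : ℕ} (f : L2 d) {φ : E d → ℝ}
    (hφ : ContDiff ℝ ∞ φ) (hc : HasCompactSupport φ) :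
    Integrable (fun x => f x • gradient φ x) := by
  have h1 : Continuous (gradient φ) :=
    (InnerProductSpace.toDual ℝ (E d)).symm.continuous.comp (hφ.continuous_fderiv (by simp))
  have h2 : HasCompactSupport (gradient φ) :=
    (hc.fderiv (𝕜 := ℝ)).comp_left (g := (InnerProductSpace.toDual ℝ (E d)).symm) (map_zero _)
  exact ((Lp.memLp f).locallyIntegrable (by norm_num)).integrable_smul_right_of_hasCompactSupport
    h1 h2

theorem integrable_test_smul {d : ℕ} (g : L2Vec d) {φ : E d → ℝ}
    (hφ : ContDiff ℝ ∞ φ) (hc : HasCompactSupport φ) :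
    Integrable (fun x => φ x • g x) :=
  ((Lp.memLp g).locallyIntegrable (by norm_num)).integrable_smul_left_of_hasCompactSupport
    hφ.continuous hc

/-- The pairs `(f, ∇f)` of an `L²` function and its (unique) weak gradient in `L²`, as a subspace
of the Hilbert space `L² × L²`. -/
def sobolevSubmodule (d : ℕ) : Submodule ℝ (WithLp 2 (L2 d × L2Vec d)) where
  carrier := {v | HasWeakGradient (v.fst : E d → ℝ) (v.snd : E d → E d)}
  zero_mem' := by
    intro φ hφ hc
    have h1 : ∫ x, ((0 : L2 d) : E d → ℝ) x • gradient φ x = 0 := by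
      rw [← integral_zero (E d) (E d) (μ := volume)]
      refine integral_congr_ae ?_
      filter_upwards [Lp.coeFn_zero ℝ 2 (volume : Measure (E d))] with x hx
      simp only [hx, Pi.zero_apply, zero_smul]
    have h2 : ∫ x, φ x • ((0 : L2Vec d) : E d → E d) x = 0 := by
      rw [← integral_zero (E d) (E d) (μ := volume)]
      refine integral_congr_ae ?_
      filter_upwards [Lp.coeFn_zero (E d) 2 (volume : Measure (E d))] with x hx
      simp only [hx, Pi.zero_apply, smul_zero]
    change ∫ x, ((0 : L2 d) : E d → ℝ) x • gradient φ x =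
      - ∫ x, φ x • ((0 : L2Vec d) : E d → E d) x
    rw [h1, h2, neg_zero]
  add_mem' := by
    intro v w hv hw φ hφ hc
    have h1 : ∫ x, ((v.fst + w.fst : L2 d) : E d → ℝ) x • gradient φ x =
        (∫ x, v.fst x • gradient φ x) + ∫ x, w.fst x • gradient φ x := by
      rw [← integral_add (integrable_smul_gradient _ hφ hc) (integrable_smul_gradient _ hφ hc)]
      refine integral_congr_ae ?_
      filter_upwards [Lp.coeFn_add v.fst w.fst] with x hx
      simp only [hx, Pi.add_apply]
      exact add_smul _ _ _
    have h2 : ∫ x, φ x • ((v.snd + w.snd : L2Vec d) : E d → E d) x =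
        (∫ x, φ x • v.snd x) + ∫ x, φ x • w.snd x := by
      rw [← integral_add (integrable_test_smul _ hφ hc) (integrable_test_smul _ hφ hc)]
      refine integral_congr_ae ?_
      filter_upwards [Lp.coeFn_add v.snd w.snd] with x hx
      simp only [hx, Pi.add_apply]
      exact smul_add _ _ _
    change ∫ x, ((v.fst + w.fst : L2 d) : E d → ℝ) x • gradient φ x =
      - ∫ x, φ x • ((v.snd + w.snd : L2Vec d) : E d → E d) x
    rw [h1, h2, hv φ hφ hc, hw φ hφ hc, neg_add]
  smul_mem' := by
    intro c v hv φ hφ hc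
    have h1 : ∫ x, ((c • v.fst : L2 d) : E d → ℝ) x • gradient φ x =
        c • ∫ x, v.fst x • gradient φ x := by
      rw [← integral_smul]
      refine integral_congr_ae ?_
      filter_upwards [Lp.coeFn_smul c v.fst] with x hx
      simp [hx, smul_smul]
    have h2 : ∫ x, φ x • ((c • v.snd : L2Vec d) : E d → E d) x = c • ∫ x, φ x • v.snd x := by
      rw [← integral_smul]
      refine integral_congr_ae ?_
      filter_upwards [Lp.coeFn_smul c v.snd] with x hx
      simp only [hx, Pi.smul_apply]
      exact smul_comm _ _ _
    change ∫ x, ((c • v.fst : L2 d) : E d → ℝ) x • gradient φ x =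
      - ∫ x, φ x • ((c • v.snd : L2Vec d) : E d → E d) x
    rw [h1, h2, hv φ hφ hc, smul_neg]

/-- The Sobolev space `H¹(ℝ^d)`, with the Hilbert norm `(‖f‖² + ‖∇f‖²)^{1/2}` inherited from
`L² × L²`. -/
def H1 (d : ℕ) : Type := sobolevSubmodule d

instance (d : ℕ) : NormedAddCommGroup (H1 d) :=
  inferInstanceAs (NormedAddCommGroup (sobolevSubmodule d))

instance (d : ℕ) : InnerProductSpace ℝ (H1 d) :=
  inferInstanceAs (InnerProductSpace ℝ (sobolevSubmodule d))

/-- The inclusion `H¹(ℝ^d) → L²(ℝ^d)`. -/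
def H1.toL2 (d : ℕ) : H1 d →L[ℝ] L2 d :=
  (WithLp.fstL 2 ℝ (L2 d) (L2Vec d)).comp (sobolevSubmodule d).subtypeL

/-- `H^{-1}(ℝ^d)`, the topological dual of `H¹(ℝ^d)` with the dual norm. -/
abbrev Hneg1 (d : ℕ) : Type := StrongDual ℝ (H1 d)

/-- The embedding `L²(ℝ^d) → H^{-1}(ℝ^d)`, `f ↦ (g ↦ ∫ f g)`. -/
def L2.toHneg1 {d : ℕ} (f : L2 d) : Hneg1 d := (innerSL ℝ f).comp (H1.toL2 d)

/-- `v` is the weak derivative in time of `u` on `(0,1)`, as a function with values in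
`H^{-1}(ℝ^d)`: `∫ ψ' u dt = - ∫ ψ v dt` for every `ψ ∈ C_c^∞((0,1))`. -/
def HasWeakTimeDeriv {d : ℕ} (u : ℝ → H1 d) (v : ℝ → Hneg1 d) : Prop :=
  ∀ ψ : ℝ → ℝ, ContDiff ℝ ∞ ψ → HasCompactSupport ψ → tsupport ψ ⊆ Ioo 0 1 →
    ∫ t in Icc (0 : ℝ) 1, deriv ψ t • L2.toHneg1 (H1.toL2 d (u t)) =
      - ∫ t in Icc (0 : ℝ) 1, ψ t • v t

/-- The parabolic class: `u ∈ L²([0,1]; H¹(ℝ^d))` with `u' ∈ L²([0,1]; H^{-1}(ℝ^d))`. -/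
def ParabolicClass {d : ℕ} (u : ℝ → H1 d) : Prop :=
  MemLp u 2 timeMeasure ∧
    ∃ v : ℝ → Hneg1 d, MemLp v 2 timeMeasure ∧ HasWeakTimeDeriv u v

/-- `∂_t u + div (b u) = Δ u` on `(0,1) × ℝ^d` in the sense of distributions, with `u = u₀` at time
`0`: for every `φ ∈ C_c^∞((-∞,1) × ℝ^d)`,
`∫₀¹ ∫ u (∂_t φ + b · ∇φ + Δφ) dx dt + ∫ u₀ φ(0,·) dx = 0`. -/
def IsDistribSolution {d : ℕ} (b : ℝ → E d → E d) (u₀ : E d → ℝ) (u : ℝ → H1 d) : Prop :=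
  ∀ φ : ℝ × E d → ℝ, ContDiff ℝ ∞ φ → HasCompactSupport φ → tsupport φ ⊆ Iio 1 ×ˢ univ →
    (∫ t in Icc (0 : ℝ) 1, ∫ x, H1.toL2 d (u t) x *
        (deriv (fun s => φ (s, x)) t + inner ℝ (b t x) (gradient (fun y => φ (t, y)) x)
          + (Δ fun y => φ (t, y)) x))
      + ∫ x, u₀ x * φ (0, x) = 0

/-- `u` is a solution in the parabolic class of the Cauchy problem for
`∂_t u + div (b u) = Δ u` with initial datum `u₀`. -/
def IsParabolicSolution {d : ℕ} (b : ℝ → E d → E d) (u₀ : E d → ℝ) (u : ℝ → H1 d) : Prop :=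
  ParabolicClass u ∧ IsDistribSolution b u₀ u

/-- Joint measurability (up to null sets) of a field on `[0,1] × ℝ^d`. -/
def FieldMeasurable {d : ℕ} (b : ℝ → E d → E d) : Prop :=
  AEStronglyMeasurable (fun z : ℝ × E d => b z.1 z.2) (timeMeasure.prod volume)

/-- The norm of `L^r([0,1]; L^q(ℝ^d))`, possibly `∞`. -/
def mixedNorm {d : ℕ} (r q : ℝ≥0∞) (b : ℝ → E d → E d) : ℝ≥0∞ :=
  eLpNorm (fun t => eLpNorm (b t) q volume) r timeMeasure

/-- `w` is the representative in `C([0,1]; L²(ℝ^d))` of `u`. -/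
def IsContRep {d : ℕ} (u : ℝ → H1 d) (w : ℝ → L2 d) : Prop :=
  ContinuousOn w (Icc 0 1) ∧ ∀ᵐ t ∂timeMeasure, w t = H1.toL2 d (u t)

end AdvDiff

end

/-! Write the solution in mild form, `u(t) = e^{tΔ}u₀ - ∫₀ᵗ e^{(t-s)Δ} div(bu)(s) ds`. The
derivative of the heat kernel costs `τ^{-1/2}` and multiplication by `b(s) ∈ L^q` costs a further
`τ^{-d/(2q)}`. On `L^p` with `p ≥ q'` the Duhamel operator is therefore dominated by a scalar
Volterra operator with kernel `τ^{-a} ‖b(t-τ)‖_q`, where `a = 1/2 + d/(2q)`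
(`eLpNorm_duhamelMaj_le`). The condition `2/r + d/q < 1` says exactly that `a r' < 1`, so `τ^{-a}`
lies in `L^{r'}(0,1)` and Hölder in time pairs it with `b`. In norms weighted by `e^{-lt}` the
Volterra operator becomes a contraction once `l` is large in terms of the exponents and a bound for
`b`; no smallness of `b` is needed (`exists_expKerNorm_le`, `lintegral_expKer_mul_weight_le`).

The Picard iterates then satisfy a sup bound `2 ‖u₀‖_∞ e^{lt}` and, through the smoothing of the
heat flow, an `L^{q'}` bound of order `t^{-d/(2q)} ‖u₀‖₁`. The exponent `1` is in general below
`q'`, but the `L^{q'}` bound puts `bu` in `L¹` with an admissible singularity at time zero, and one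
more application of Duhamel's formula gives the `L¹` bound. Interpolation between `L¹` and `L^∞`
gives all other exponents.

To reach the given solution, the weak equation is tested with backward heat potentials, which yields
the mild equation almost everywhere (`eq_heatFlow_add_duhamel`). The solution is square integrable
in time with values in some `L^{p₀}`, `p₀ ≥ q'`: `p₀ = 2` if `q ≥ 2`, and otherwise `d = 1` and
`H¹(ℝ) ⊂ L^∞`. The contraction in this space shows that the Picard iterates converge to `u`, and
Fatou transfers their bounds (`eLpNorm_le_of_picard_le`).

The continuous representative is the right-hand side of the mild equation, `mildRhs`. It is
continuous in `L¹` by continuity of translations and bounded in `L^∞`, hence continuous in `L²`. -/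

noncomputable section

namespace AdvDiff

/-! ### Minkowski and Hölder inequalities for functions with values in `[0, ∞]`. -/

section Minkowski

variable {α β : Type*} [MeasurableSpace α] [MeasurableSpace β] {μ : Measure α} {ν : Measure β}

theorem eLpNorm_ennreal_top (f : α → ℝ≥0∞) : eLpNorm f ⊤ μ = essSup f μ := rfl

theorem eLpNorm_ennreal_of_ne_top {p : ℝ≥0∞} (h0 : p ≠ 0) (ht : p ≠ ⊤) (f : α → ℝ≥0∞) :
    eLpNorm f p μ = (∫⁻ x, f x ^ p.toReal ∂μ) ^ (1 / p.toReal) := by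
  rw [eLpNorm_eq_lintegral_rpow_enorm_toReal h0 ht]; rfl

theorem eLpNorm_ennreal_const_mul (k : ℝ≥0∞) {f : α → ℝ≥0∞} (hf : Measurable f) (p : ℝ≥0∞) :
    eLpNorm (fun x => k * f x) p μ = k * eLpNorm f p μ := by
  rcases eq_or_ne p 0 with rfl | h0
  · simp
  rcases eq_or_ne p ⊤ with rfl | ht
  · rw [eLpNorm_ennreal_top, eLpNorm_ennreal_top, ENNReal.essSup_const_mul]
  · have hp := ENNReal.toReal_pos h0 ht
    rw [eLpNorm_ennreal_of_ne_top h0 ht, eLpNorm_ennreal_of_ne_top h0 ht]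
    simp_rw [ENNReal.mul_rpow_of_nonneg _ _ hp.le]
    rw [lintegral_const_mul _ (hf.pow_const _), ENNReal.mul_rpow_of_nonneg _ _ (by positivity),
      ← ENNReal.rpow_mul, mul_one_div_cancel hp.ne', ENNReal.rpow_one]

/-- An essential supremum is at most `c` exactly when the slice of `{c < f}` is null, and the
measure of slices depends measurably on the parameter. -/
theorem measurable_essSup_right [SFinite ν] {f : α × β → ℝ≥0∞} (hf : Measurable f) :
    Measurable fun x => essSup (fun y => f (x, y)) ν := by
  refine measurable_of_Iic fun c => ?_
  have : (fun x => essSup (fun y => f (x, y)) ν) ⁻¹' Iic c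
      = (fun x => ν (Prod.mk x ⁻¹' {z | c < f z})) ⁻¹' {0} := by
    ext x
    simp only [mem_preimage, mem_Iic, mem_singleton_iff]
    constructor
    · intro h
      have : ∀ᵐ y ∂ν, f (x, y) ≤ c := (ENNReal.ae_le_essSup _).mono fun y hy => hy.trans h
      rw [ae_iff] at this
      convert this using 3
      simp
    · intro h
      refine essSup_le_of_ae_le c ?_
      rw [Filter.EventuallyLE, ae_iff]
      convert h using 3
      simp
  rw [this]
  exact measurable_measure_prodMk_left (measurableSet_lt measurable_const hf)
    (measurableSet_singleton 0)

theorem measurable_eLpNorm_right [SFinite ν] {ε : Type*} [TopologicalSpace ε] [ContinuousENorm ε]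
    {f : α × β → ε} (hf : StronglyMeasurable f) (p : ℝ≥0∞) :
    Measurable fun x => eLpNorm (fun y => f (x, y)) p ν := by
  rcases eq_or_ne p 0 with rfl | h0
  · simp
  rcases eq_or_ne p ⊤ with rfl | ht
  · exact measurable_essSup_right (f := fun z => ‖f z‖ₑ) hf.enorm
  · simp_rw [eLpNorm_eq_lintegral_rpow_enorm_toReal h0 ht]
    exact (Measurable.lintegral_prod_right' (hf.enorm.pow_const p.toReal)).pow_const _

/-- Minkowski's integral inequality. -/
theorem eLpNorm_lintegral_le [SFinite μ] [SFinite ν] {p : ℝ≥0∞} (hp : 1 ≤ p)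
    {f : α → β → ℝ≥0∞} (hf : Measurable (Function.uncurry f)) :
    eLpNorm (fun x => ∫⁻ s, f x s ∂ν) p μ ≤ ∫⁻ s, eLpNorm (fun x => f x s) p μ ∂ν := by
  have hsw : Measurable fun z : β × α => f z.2 z.1 := hf.comp measurable_swap
  set n : β → ℝ≥0∞ := fun s => eLpNorm (fun x => f x s) p μ with hn
  have hfm : ∀ s, Measurable fun x => f x s := fun s => hf.comp measurable_prodMk_right
  have hnm : Measurable n :=
    measurable_eLpNorm_right (f := fun z : β × α => f z.2 z.1) hsw.stronglyMeasurable p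
  rcases eq_or_ne p ⊤ with rfl | ht
  · have h1 : ∀ᵐ s ∂ν, ∀ᵐ x ∂μ, f x s ≤ n s :=
      Filter.Eventually.of_forall fun s => ENNReal.ae_le_essSup (fun x => f x s)
    have h2 : ∀ᵐ x ∂μ, ∀ᵐ s ∂ν, f x s ≤ n s :=
      (Measure.ae_ae_comm (p := fun s x => f x s ≤ n s)
        (measurableSet_le hsw (hnm.comp measurable_fst))).1 h1
    exact essSup_le_of_ae_le _ (h2.mono fun x hx => lintegral_mono_ae hx)
  have h0 : p ≠ 0 := (zero_lt_one.trans_le hp).ne'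
  set P := p.toReal with hP
  have hP1 : 1 ≤ P := by
    rw [hP, ← ENNReal.toReal_one]
    exact ENNReal.toReal_mono ht hp
  have hP0 : 0 < P := by linarith
  have hnP : ∀ s, n s ^ P = ∫⁻ x, f x s ^ P ∂μ := fun s => by
    rw [hn]
    simp only
    rw [eLpNorm_ennreal_of_ne_top h0 ht, ← ENNReal.rpow_mul, one_div, inv_mul_cancel₀ hP0.ne',
      ENNReal.rpow_one]
  rcases eq_or_ne (∫⁻ s, n s ∂ν) ⊤ with hN | hN
  · rw [hN]; exact le_top
  have hfin : ∀ᵐ s ∂ν, n s < ⊤ := ae_lt_top hnm hN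
  -- The negative power of `n s` used below is harmless only where `n s` is finite and where `f x s`
  -- vanishes together with `n s`. Both hold for almost every pair.
  have h1 : ∀ᵐ s ∂ν, ∀ᵐ x ∂μ, n s < ⊤ ∧ (n s = 0 → f x s = 0) := by
    filter_upwards [hfin] with s hs
    by_cases h : n s = 0
    · have : ∫⁻ x, f x s ^ P ∂μ = 0 := by rw [← hnP, h, ENNReal.zero_rpow_of_pos hP0]
      rw [lintegral_eq_zero_iff ((hfm s).pow_const P)] at this
      filter_upwards [this] with x hx
      refine ⟨hs, fun _ => ?_⟩
      simpa [hP0, hP0.le.not_gt] using hx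
    · exact Filter.Eventually.of_forall fun x => ⟨hs, fun h' => absurd h' h⟩
  have h2 : ∀ᵐ x ∂μ, ∀ᵐ s ∂ν, n s < ⊤ ∧ (n s = 0 → f x s = 0) := by
    refine (Measure.ae_ae_comm (p := fun s x => n s < ⊤ ∧ (n s = 0 → f x s = 0)) ?_).1 h1
    have e : {x : β × α | n x.1 < ⊤ ∧ (n x.1 = 0 → f x.2 x.1 = 0)} =
      {x | n x.1 < ⊤} ∩ ({x | n x.1 = 0}ᶜ ∪ {x | f x.2 x.1 = 0}) := by
        ext x; simp [imp_iff_not_or]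
    rw [e]
    have hn1 : Measurable fun z : β × α => n z.1 := hnm.comp measurable_fst
    exact (measurableSet_lt hn1 measurable_const).inter
      (((hn1 (measurableSet_singleton 0)).compl).union (hsw (measurableSet_singleton 0)))
  -- Hölder on `f = (f ^ P * n ^ (1 - P)) ^ (1 / P) * n ^ (1 - 1 / P)`; the weight `n ^ (1 - P)` is
  -- chosen so that integrating the first factor in `x` returns `n`.
  have hpt : ∀ᵐ x ∂μ, (∫⁻ s, f x s ∂ν) ^ P ≤
      (∫⁻ s, f x s ^ P * n s ^ (1 - P) ∂ν) * (∫⁻ s, n s ∂ν) ^ (P - 1) := by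
    filter_upwards [h2] with x hx
    have e : ∫⁻ s, f x s ∂ν =
        ∫⁻ s, (f x s ^ P * n s ^ (1 - P)) ^ (1 / P) * n s ^ (1 - 1 / P) ∂ν := by
      refine lintegral_congr_ae ?_
      filter_upwards [hx] with s hs
      by_cases h : n s = 0
      · rw [hs.2 h, ENNReal.zero_rpow_of_pos hP0, zero_mul,
          ENNReal.zero_rpow_of_pos (by positivity), zero_mul]
      · rw [ENNReal.mul_rpow_of_nonneg _ _ (by positivity), ← ENNReal.rpow_mul, ← ENNReal.rpow_mul,
          mul_one_div_cancel hP0.ne', ENNReal.rpow_one, mul_assoc,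
          ← ENNReal.rpow_add _ _ h hs.1.ne]
        have : (1 - P) * (1 / P) + (1 - 1 / P) = 0 := by field_simp; ring
        rw [this, ENNReal.rpow_zero, mul_one]
    have hX : Measurable fun s => f x s ^ P * n s ^ (1 - P) :=
      ((hf.comp measurable_prodMk_left).pow_const P).mul (hnm.pow_const _)
    have h1P : 1 / P ≤ 1 := by rw [div_le_one hP0]; exact hP1
    have hle := ENNReal.lintegral_mul_norm_pow_le (μ := ν) hX.aemeasurable hnm.aemeasurable
      (p := 1 / P) (q := 1 - 1 / P) (by positivity) (by linarith) (by ring)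
    rw [← e] at hle
    calc (∫⁻ s, f x s ∂ν) ^ P ≤ _ := ENNReal.rpow_le_rpow hle hP0.le
      _ = _ := by
        rw [ENNReal.mul_rpow_of_nonneg _ _ hP0.le, ← ENNReal.rpow_mul, ← ENNReal.rpow_mul,
          one_div_mul_cancel hP0.ne', ENNReal.rpow_one]
        congr 2
        field_simp
  rw [eLpNorm_ennreal_of_ne_top h0 ht]
  rw [one_div, ENNReal.rpow_inv_le_iff hP0]
  have hmeas : Measurable fun z : α × β => f z.1 z.2 ^ P * n z.2 ^ (1 - P) :=
    (hf.pow_const P).mul ((hnm.comp measurable_snd).pow_const _)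
  calc ∫⁻ x, (∫⁻ s, f x s ∂ν) ^ P ∂μ
      ≤ ∫⁻ x, (∫⁻ s, f x s ^ P * n s ^ (1 - P) ∂ν) * (∫⁻ s, n s ∂ν) ^ (P - 1) ∂μ :=
        lintegral_mono_ae hpt
    _ = (∫⁻ x, ∫⁻ s, f x s ^ P * n s ^ (1 - P) ∂ν ∂μ) * (∫⁻ s, n s ∂ν) ^ (P - 1) :=
        lintegral_mul_const _ hmeas.lintegral_prod_right'
    _ = (∫⁻ s, ∫⁻ x, f x s ^ P * n s ^ (1 - P) ∂μ ∂ν) * (∫⁻ s, n s ∂ν) ^ (P - 1) := by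
        rw [lintegral_lintegral_swap hmeas.aemeasurable]
    _ = (∫⁻ s, n s ^ P * n s ^ (1 - P) ∂ν) * (∫⁻ s, n s ∂ν) ^ (P - 1) := by
        congr 1
        refine lintegral_congr fun s => ?_
        rw [lintegral_mul_const _ ((hfm s).pow_const P), hnP]
    _ ≤ (∫⁻ s, n s ∂ν) * (∫⁻ s, n s ∂ν) ^ (P - 1) := by
        gcongr with s
        by_cases h : n s = 0
        · simp [h, hP0]
        by_cases h' : n s = ⊤
        · simp [h']
        · rw [← ENNReal.rpow_add _ _ h h']; simp
    _ ≤ (∫⁻ s, n s ∂ν) ^ P := by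
        by_cases h : ∫⁻ s, n s ∂ν = 0
        · rw [h, zero_mul]; exact zero_le
        · conv_lhs => rw [← ENNReal.rpow_one (∫⁻ s, n s ∂ν)]
          rw [← ENNReal.rpow_mul, one_mul, ← ENNReal.rpow_add _ _ h hN]
          simp

/-- Hölder's inequality for functions with values in `[0, ∞]`. -/
theorem lintegral_mul_le_eLpNorm_mul_eLpNorm (p q : ℝ≥0∞) [hpq : ENNReal.HolderConjugate p q]
    {f g : α → ℝ≥0∞} (hf : AEMeasurable f μ) (hg : AEMeasurable g μ) :
    ∫⁻ x, f x * g x ∂μ ≤ eLpNorm f p μ * eLpNorm g q μ := by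
  have key : ∀ {f g : α → ℝ≥0∞}, AEMeasurable f μ →
      ∫⁻ x, f x * g x ∂μ ≤ eLpNorm f 1 μ * eLpNorm g ⊤ μ := by
    intro f g hf
    rw [eLpNorm_ennreal_of_ne_top one_ne_zero ENNReal.one_ne_top, eLpNorm_ennreal_top]
    simp only [ENNReal.toReal_one, ENNReal.rpow_one, div_one]
    rw [← lintegral_mul_const'' _ hf]
    refine lintegral_mono_ae ?_
    filter_upwards [ENNReal.ae_le_essSup g] with x hx
    gcongr
  have hp1 : 1 ≤ p := ENNReal.HolderConjugate.one_le p q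
  have hq1 : 1 ≤ q := ENNReal.HolderConjugate.one_le q p
  rcases eq_or_ne p ⊤ with rfl | hp
  · have : q = 1 := by
      have := ENNReal.HolderConjugate.inv_add_inv_eq_one (p := ⊤) (q := q)
      simpa using this
    subst this
    simp_rw [mul_comm (f _)]
    rw [mul_comm (eLpNorm f _ _)]
    exact key hg
  rcases eq_or_ne q ⊤ with rfl | hq
  · have : p = 1 := by
      have := ENNReal.HolderConjugate.inv_add_inv_eq_one (p := p) (q := ⊤)
      simpa using this
    subst this
    exact key hf
  · have hr : p.toReal.HolderConjugate q.toReal := ENNReal.HolderConjugate.toReal_of_ne_top hp hq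
    rw [eLpNorm_ennreal_of_ne_top (by positivity) hp, eLpNorm_ennreal_of_ne_top (by positivity) hq]
    exact ENNReal.lintegral_mul_le_Lp_mul_Lq μ hr hf hg

end Minkowski

/-! ### Scaling of Lebesgue norms and a Young inequality in self-similar variables. -/

section Scaling

variable {d : ℕ}

theorem map_add_smul_volume (x : E d) {c : ℝ} (hc : 0 < c) :
    Measure.map (fun z : E d => x + c • z) volume
      = ENNReal.ofReal (c ^ (-(d : ℝ))) • (volume : Measure (E d)) := by
  have h1 : (fun z : E d => x + c • z) = (fun z => x + z) ∘ fun z => c • z := rfl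
  rw [h1, ← Measure.map_map (measurable_const_add x) (measurable_const_smul c),
    Measure.map_addHaar_smul volume hc.ne', Measure.map_smul]
  · rw [(measurePreserving_add_left volume x).map_eq]
    congr 2
    rw [finrank_euclideanSpace_fin, abs_of_pos (by positivity), Real.rpow_neg hc.le,
      Real.rpow_natCast]

theorem eLpNorm_comp_add_smul (x : E d) {c : ℝ} (hc : 0 < c) {f : E d → ℝ≥0∞} (hf : Measurable f)
    (q : ℝ≥0∞) :
    eLpNorm (fun z => f (x + c • z)) q volume
      = ENNReal.ofReal (c ^ (-(d : ℝ) * q⁻¹.toReal)) * eLpNorm f q volume := by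
  have hm : Measurable fun z : E d => x + c • z := by fun_prop
  have h1 : eLpNorm (fun z => f (x + c • z)) q volume
      = eLpNorm f q (Measure.map (fun z : E d => x + c • z) volume) :=
    (eLpNorm_map_measure hf.aestronglyMeasurable hm.aemeasurable).symm
  rw [h1, map_add_smul_volume x hc]
  rcases eq_or_ne q ⊤ with rfl | hq
  · have h0 : ENNReal.ofReal (c ^ (-(d : ℝ))) ≠ 0 := by
      rw [Ne, ENNReal.ofReal_eq_zero, not_le]
      exact Real.rpow_pos_of_pos hc _
    rw [eLpNorm_ennreal_top, eLpNorm_ennreal_top, essSup, essSup, Measure.ae_ennreal_smul_measure_eq h0]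
    simp
  · rw [eLpNorm_smul_measure_of_ne_top hq, smul_eq_mul, ENNReal.ofReal_rpow_of_nonneg (by positivity)
      (by positivity), ← Real.rpow_mul hc.le, one_div]

theorem eLpNorm_comp_add_right (y : E d) {f : E d → ℝ≥0∞} (hf : Measurable f) (q : ℝ≥0∞) :
    eLpNorm (fun x => f (x + y)) q volume = eLpNorm f q volume :=
  eLpNorm_comp_measurePreserving hf.aestronglyMeasurable (measurePreserving_add_right volume y)

/-- A weighted form of Young's convolution inequality. -/
theorem eLpNorm_lintegral_smul_le (q q' p : ℝ≥0∞) [hqq : ENNReal.HolderConjugate q' q]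
    (hq' : q' ≠ ⊤) (hp : q' ≤ p) {c : ℝ} (hc : 0 < c) {a f v : E d → ℝ≥0∞} (ha : Measurable a)
    (hf : Measurable f) (hv : Measurable v) :
    eLpNorm (fun x => ∫⁻ z, a z * f (x + c • z) * v (x + c • z)) p volume
      ≤ eLpNorm a q' volume * ENNReal.ofReal (c ^ (-(d : ℝ) * q⁻¹.toReal)) * eLpNorm f q volume
        * eLpNorm v p volume := by
  have hq1 : 1 ≤ q' := ENNReal.HolderConjugate.one_le q' q
  have hq0 : q' ≠ 0 := (zero_lt_one.trans_le hq1).ne'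
  set m := q'.toReal with hm
  have hm0 : 0 < m := ENNReal.toReal_pos hq0 hq'
  have hmo : ENNReal.ofReal m = q' := ENNReal.ofReal_toReal hq'
  have hsh : ∀ x : E d, Measurable fun z : E d => x + c • z := fun x => by fun_prop
  set X : E d → ℝ≥0∞ := fun x => ∫⁻ z, a z ^ m * v (x + c • z) ^ m with hX
  have hmeasX : Measurable (Function.uncurry fun x z : E d => a z ^ m * v (x + c • z) ^ m) := by
    have : Measurable fun w : E d × E d => w.1 + c • w.2 := by fun_prop
    exact ((ha.comp measurable_snd).pow_const m).mul ((hv.comp this).pow_const m)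
  -- Hölder in `z` with `a * v` in `L^{q'}` and `f` in `L^q`; rescaling the second factor produces
  -- the power of `c`.
  have h1 : ∀ x, ∫⁻ z, a z * f (x + c • z) * v (x + c • z) ≤
      X x ^ (1 / m) * (ENNReal.ofReal (c ^ (-(d : ℝ) * q⁻¹.toReal)) * eLpNorm f q volume) := by
    intro x
    rw [← eLpNorm_comp_add_smul x hc hf q]
    have := lintegral_mul_le_eLpNorm_mul_eLpNorm q' q
      (f := fun z => a z * v (x + c • z)) (g := fun z => f (x + c • z)) (μ := volume)
      (ha.mul (hv.comp (hsh x))).aemeasurable (hf.comp (hsh x)).aemeasurable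
    rw [eLpNorm_ennreal_of_ne_top hq0 hq'] at this
    simp only [← hm, ENNReal.mul_rpow_of_nonneg _ _ hm0.le] at this
    refine le_trans (le_of_eq ?_) this
    refine lintegral_congr fun z => ?_
    ring
  -- Minkowski in `L^{p/m}` for the `m`-th powers, `m = q'`; this is where `q' ≤ p` is needed.
  have h2 : eLpNorm (fun x => X x ^ (1 / m)) p volume
      ≤ eLpNorm a q' volume * eLpNorm v p volume := by
    have e1 : eLpNorm (fun x => X x ^ (1 / m)) p volume
        = eLpNorm X (p * ENNReal.ofReal (1 / m)) volume ^ (1 / m) :=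
      eLpNorm_enorm_rpow X (one_div_pos.2 hm0)
    have hpm : 1 ≤ p * ENNReal.ofReal (1 / m) := by
      rw [one_div, ENNReal.ofReal_inv_of_pos hm0, hmo, ← ENNReal.mul_inv_cancel hq0 hq']
      gcongr
    have e2 : ∀ z, eLpNorm (fun x => a z ^ m * v (x + c • z) ^ m) (p * ENNReal.ofReal (1 / m)) volume
        = a z ^ m * eLpNorm v p volume ^ m := by
      intro z
      rw [eLpNorm_ennreal_const_mul (a z ^ m) (f := fun x => v (x + c • z) ^ m)
        ((hv.comp (measurable_add_const _)).pow_const m)]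
      congr 1
      have e3 := eLpNorm_enorm_rpow (μ := (volume : Measure (E d))) (p := p * ENNReal.ofReal (1 / m))
        (fun x => v (x + c • z)) hm0
      simp only [enorm_eq_self] at e3
      rw [e3, mul_assoc, ← ENNReal.ofReal_mul (by positivity), one_div_mul_cancel hm0.ne',
        ENNReal.ofReal_one, mul_one, eLpNorm_comp_add_right _ hv]
    rw [e1]
    calc _ ≤ (∫⁻ z, a z ^ m * eLpNorm v p volume ^ m) ^ (1 / m) := by
          refine ENNReal.rpow_le_rpow ?_ (by positivity)
          refine (eLpNorm_lintegral_le hpm hmeasX).trans (le_of_eq ?_)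
          exact lintegral_congr e2
      _ = _ := by
          rw [lintegral_mul_const _ (ha.pow_const m), ENNReal.mul_rpow_of_nonneg _ _ (by positivity),
            ← ENNReal.rpow_mul, mul_one_div_cancel hm0.ne', ENNReal.rpow_one,
            eLpNorm_ennreal_of_ne_top hq0 hq']
  set D := ENNReal.ofReal (c ^ (-(d : ℝ) * q⁻¹.toReal)) * eLpNorm f q volume with hD
  have hXm : Measurable X := hmeasX.lintegral_prod_right'
  have h3 : eLpNorm (fun x => X x ^ (1 / m) * D) p volume
      = eLpNorm (fun x => X x ^ (1 / m)) p volume * D := by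
    simp_rw [mul_comm _ D]
    exact eLpNorm_ennreal_const_mul D (hXm.pow_const _) p
  calc _ ≤ eLpNorm (fun x => X x ^ (1 / m) * D) p volume :=
        eLpNorm_mono_enorm fun x => by simpa only [enorm_eq_self] using h1 x
    _ = _ := h3
    _ ≤ eLpNorm a q' volume * eLpNorm v p volume * D := by gcongr
    _ = _ := by rw [hD]; ring

end Scaling

/-! ### Singular time kernels and Volterra estimates. -/

section TimeKernel

/-- The kernel `τ^{-a} e^{-lτ}` on `(0,1)`. -/
def expKer (a l τ : ℝ) : ℝ≥0∞ :=
  (Ioo (0 : ℝ) 1).indicator (fun τ => ENNReal.ofReal (τ ^ (-a) * Real.exp (-(l * τ)))) τ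

theorem measurable_expKer (a l : ℝ) : Measurable (expKer a l) := by
  unfold expKer
  refine Measurable.indicator ?_ measurableSet_Ioo
  fun_prop

theorem expKer_of_mem {a l τ : ℝ} (h : τ ∈ Ioo (0 : ℝ) 1) :
    expKer a l τ = ENNReal.ofReal (τ ^ (-a) * Real.exp (-(l * τ))) := by
  rw [expKer, indicator_of_mem h]

theorem expKer_of_notMem {a l τ : ℝ} (h : τ ∉ Ioo (0 : ℝ) 1) : expKer a l τ = 0 := by
  rw [expKer, indicator_of_notMem h]

/-- The `L^ρ` norm of `expKer a l`. -/
def expKerNorm (ρ a l : ℝ) : ℝ≥0∞ := (∫⁻ τ, expKer a l τ ^ ρ) ^ (1 / ρ)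

variable {r ρ a l : ℝ}

/-- Integrability of the singularity at zero; in the application `a * ρ < 1` is the condition `2 / r
+ d / q < 1`. -/
theorem lintegral_expKer_zero_rpow_lt_top (hρ : 0 < ρ) (haρ : a * ρ < 1) :
    ∫⁻ τ, expKer a 0 τ ^ ρ < ⊤ := by
  have h1 : ∀ τ, expKer a 0 τ ^ ρ =
      (Ioo (0 : ℝ) 1).indicator (fun τ => ENNReal.ofReal (τ ^ (-(a * ρ)))) τ := by
    intro τ
    by_cases h : τ ∈ Ioo (0 : ℝ) 1
    · rw [expKer_of_mem h, indicator_of_mem h]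
      simp only [zero_mul, neg_zero, Real.exp_zero, mul_one]
      rw [ENNReal.ofReal_rpow_of_nonneg (Real.rpow_nonneg h.1.le _) hρ.le, ← Real.rpow_mul h.1.le,
        neg_mul]
    · rw [expKer_of_notMem h, indicator_of_notMem h, ENNReal.zero_rpow_of_pos hρ]
  simp_rw [h1]
  rw [lintegral_indicator measurableSet_Ioo]
  have h2 : IntegrableOn (fun τ : ℝ => τ ^ (-(a * ρ))) (Ioo 0 1) volume :=
    (intervalIntegral.integrableOn_Ioo_rpow_iff one_pos).2 (by linarith)
  exact h2.lintegral_lt_top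

theorem expKer_le_expKer_zero (hl : 0 ≤ l) (τ : ℝ) : expKer a l τ ≤ expKer a 0 τ := by
  by_cases h : τ ∈ Ioo (0 : ℝ) 1
  · rw [expKer_of_mem h, expKer_of_mem h]
    refine ENNReal.ofReal_le_ofReal ?_
    have h1 : 0 ≤ τ ^ (-a) := Real.rpow_nonneg h.1.le _
    refine mul_le_mul_of_nonneg_left (Real.exp_le_exp.2 ?_) h1
    nlinarith [mul_nonneg hl h.1.le]
  · rw [expKer_of_notMem h, expKer_of_notMem h]

theorem expKerNorm_lt_top (hρ : 0 < ρ) (haρ : a * ρ < 1) (hl : 0 ≤ l) : expKerNorm ρ a l < ⊤ := by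
  refine ENNReal.rpow_lt_top_of_nonneg (by positivity) (ne_of_lt ?_)
  refine lt_of_le_of_lt (lintegral_mono fun τ => ?_) (lintegral_expKer_zero_rpow_lt_top hρ haρ)
  exact ENNReal.rpow_le_rpow (expKer_le_expKer_zero hl τ) hρ.le

/-- As `l` grows the kernels tend to zero pointwise and stay below the one with `l = 0`, so
dominated convergence applies. This takes the place of a subdivision of the time interval and makes
the Volterra operator small for a drift of any size. -/
theorem exists_expKerNorm_le (hρ : 0 < ρ) (haρ : a * ρ < 1) {δ : ℝ≥0∞} (hδ : 0 < δ) :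
    ∃ l : ℝ, 0 ≤ l ∧ expKerNorm ρ a l ≤ δ := by
  have h1 : Filter.Tendsto (fun n : ℕ => ∫⁻ τ, expKer a n τ ^ ρ) Filter.atTop
      (nhds (∫⁻ _ : ℝ, (0 : ℝ≥0∞))) := by
    refine tendsto_lintegral_of_dominated_convergence (fun τ => expKer a 0 τ ^ ρ)
      (fun n => (measurable_expKer a n).pow_const ρ) (fun n => ?_)
      (lintegral_expKer_zero_rpow_lt_top hρ haρ).ne ?_
    · exact Filter.Eventually.of_forall fun τ =>
        ENNReal.rpow_le_rpow (expKer_le_expKer_zero (Nat.cast_nonneg n) τ) hρ.le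
    · refine Filter.Eventually.of_forall fun τ => ?_
      by_cases h : τ ∈ Ioo (0 : ℝ) 1
      · simp_rw [expKer_of_mem h]
        have h2 : Filter.Tendsto (fun n : ℕ => τ ^ (-a) * Real.exp (-((n : ℝ) * τ))) Filter.atTop
            (nhds (τ ^ (-a) * 0)) := by
          refine Filter.Tendsto.const_mul _ ?_
          refine Real.tendsto_exp_neg_atTop_nhds_zero.comp ?_
          exact tendsto_natCast_atTop_atTop.atTop_mul_const h.1
        rw [mul_zero] at h2
        have h3 := (ENNReal.tendsto_ofReal h2)
        rw [ENNReal.ofReal_zero] at h3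
        have h4 := (ENNReal.continuous_rpow_const (y := ρ)).tendsto 0
        rw [ENNReal.zero_rpow_of_pos hρ] at h4
        exact h4.comp h3
      · simp_rw [expKer_of_notMem h, ENNReal.zero_rpow_of_pos hρ]
        exact tendsto_const_nhds
  rw [lintegral_zero] at h1
  have h5 : Filter.Tendsto (fun n : ℕ => expKerNorm ρ a n) Filter.atTop (nhds 0) := by
    have h4 := (ENNReal.continuous_rpow_const (y := 1 / ρ)).tendsto 0
    rw [ENNReal.zero_rpow_of_pos (by positivity)] at h4
    exact h4.comp h1
  obtain ⟨n, hn⟩ := (h5.eventually (gt_mem_nhds hδ)).exists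
  exact ⟨n, Nat.cast_nonneg n, hn.le⟩

theorem lintegral_mul_comp_sub_le (hr : ρ.HolderConjugate r) {k β : ℝ → ℝ≥0∞} (hk : Measurable k)
    (hβ : Measurable β) (t : ℝ) :
    ∫⁻ τ, k τ * β (t - τ) ≤ (∫⁻ τ, k τ ^ ρ) ^ (1 / ρ) * (∫⁻ s, β s ^ r) ^ (1 / r) := by
  have := ENNReal.lintegral_mul_le_Lp_mul_Lq volume hr hk.aemeasurable
    (g := fun τ => β (t - τ)) (hβ.comp (measurable_const.sub measurable_id)).aemeasurable
  rwa [lintegral_sub_left_eq_self (fun s => β s ^ r) t] at this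

theorem lintegral_expKer_mul_le (hr : ρ.HolderConjugate r) {β : ℝ → ℝ≥0∞} (hβ : Measurable β)
    (t : ℝ) :
    ∫⁻ τ, expKer a l τ * β (t - τ) ≤ expKerNorm ρ a l * (∫⁻ s, β s ^ r) ^ (1 / r) :=
  lintegral_mul_comp_sub_le hr (measurable_expKer a l) hβ t

theorem lintegral_expKer_sub_mul_le (hr : ρ.HolderConjugate r) {β : ℝ → ℝ≥0∞} (hβ : Measurable β)
    (t : ℝ) :
    ∫⁻ τ, expKer a l (t - τ) * β (t - τ) ≤ expKerNorm ρ a l * (∫⁻ s, β s ^ r) ^ (1 / r) := by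
  rw [lintegral_sub_left_eq_self (fun s => expKer a l s * β s) t]
  exact ENNReal.lintegral_mul_le_Lp_mul_Lq volume hr (measurable_expKer a l).aemeasurable
    hβ.aemeasurable

/-- The smaller of `u` and `v`, raised to the total exponent, already dominates the product. -/
theorem rpow_neg_mul_rpow_neg_le {x y u v : ℝ} (hx : 0 ≤ x) (hy : 0 ≤ y) (hu : 0 < u)
    (hv : 0 < v) : u ^ (-x) * v ^ (-y) ≤ u ^ (-(x + y)) + v ^ (-(x + y)) := by
  have hu' := Real.rpow_nonneg hu.le (-(x + y))
  have hv' := Real.rpow_nonneg hv.le (-(x + y))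
  rcases le_total u v with h | h
  · have : u ^ (-x) * v ^ (-y) ≤ u ^ (-x) * u ^ (-y) :=
      mul_le_mul_of_nonneg_left (Real.rpow_le_rpow_of_nonpos hu h (by linarith))
        (Real.rpow_nonneg hu.le _)
    rw [← Real.rpow_add hu] at this
    rw [neg_add] at *
    linarith
  · have : u ^ (-x) * v ^ (-y) ≤ v ^ (-x) * v ^ (-y) :=
      mul_le_mul_of_nonneg_right (Real.rpow_le_rpow_of_nonpos hv h (by linarith))
        (Real.rpow_nonneg hv.le _)
    rw [← Real.rpow_add hv] at this
    rw [neg_add] at *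
    linarith

/-- The larger of `τ` and `s` is at least half of their sum, which extracts the weight of the sum at
the price `2 ^ y ≤ 2`. When `s ≤ τ`, the condition `y ≤ a` allows the leftover power of `τ` to be
replaced by one of `s`. -/
theorem rpow_neg_mul_rpow_neg_le_add {y τ s : ℝ} (hy : 0 ≤ y) (hya : y ≤ a) (hy1 : y ≤ 1)
    (hτ : 0 < τ) (hs : 0 < s) :
    τ ^ (-a) * s ^ (-y) ≤ (τ + s) ^ (-y) * (2 * (τ ^ (-a) + s ^ (-a))) := by
  have hts : 0 < τ + s := by positivity
  have key : τ ^ (-a) * s ^ (-y) * (τ + s) ^ y ≤ 2 * (τ ^ (-a) + s ^ (-a)) := by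
    have hτa := Real.rpow_nonneg hτ.le (-a)
    have hsa := Real.rpow_nonneg hs.le (-a)
    have h2 : (2 : ℝ) ^ y ≤ 2 := by
      calc (2 : ℝ) ^ y ≤ 2 ^ (1 : ℝ) := Real.rpow_le_rpow_of_exponent_le (by norm_num) hy1
        _ = 2 := Real.rpow_one 2
    rcases le_total τ s with h | h
    · have h3 : (τ + s) ^ y ≤ 2 * s ^ y := by
        calc (τ + s) ^ y ≤ (2 * s) ^ y := Real.rpow_le_rpow hts.le (by linarith) hy
          _ = 2 ^ y * s ^ y := Real.mul_rpow (by norm_num) hs.le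
          _ ≤ 2 * s ^ y := mul_le_mul_of_nonneg_right h2 (Real.rpow_nonneg hs.le _)
      calc τ ^ (-a) * s ^ (-y) * (τ + s) ^ y ≤ τ ^ (-a) * s ^ (-y) * (2 * s ^ y) :=
            mul_le_mul_of_nonneg_left h3 (mul_nonneg hτa (Real.rpow_nonneg hs.le _))
        _ = 2 * τ ^ (-a) * (s ^ (-y) * s ^ y) := by ring
        _ = 2 * τ ^ (-a) := by rw [← Real.rpow_add hs]; simp
        _ ≤ _ := by linarith
    · have h3 : (τ + s) ^ y ≤ 2 * τ ^ y := by
        calc (τ + s) ^ y ≤ (2 * τ) ^ y := Real.rpow_le_rpow hts.le (by linarith) hy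
          _ = 2 ^ y * τ ^ y := Real.mul_rpow (by norm_num) hτ.le
          _ ≤ 2 * τ ^ y := mul_le_mul_of_nonneg_right h2 (Real.rpow_nonneg hτ.le _)
      calc τ ^ (-a) * s ^ (-y) * (τ + s) ^ y ≤ τ ^ (-a) * s ^ (-y) * (2 * τ ^ y) :=
            mul_le_mul_of_nonneg_left h3 (mul_nonneg hτa (Real.rpow_nonneg hs.le _))
        _ = 2 * (τ ^ (-a) * τ ^ y) * s ^ (-y) := by ring
        _ = 2 * τ ^ (-a + y) * s ^ (-y) := by rw [← Real.rpow_add hτ]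
        _ ≤ 2 * s ^ (-a + y) * s ^ (-y) := by
            refine mul_le_mul_of_nonneg_right ?_ (Real.rpow_nonneg hs.le _)
            refine mul_le_mul_of_nonneg_left ?_ (by norm_num)
            exact Real.rpow_le_rpow_of_nonpos hs h (by linarith)
        _ = 2 * s ^ (-a) := by rw [mul_assoc, ← Real.rpow_add hs]; ring_nf
        _ ≤ _ := by linarith
  have hp : 0 < (τ + s) ^ (-y) := Real.rpow_pos_of_pos hts _
  calc τ ^ (-a) * s ^ (-y)
      = (τ + s) ^ (-y) * (τ ^ (-a) * s ^ (-y) * (τ + s) ^ y) := by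
        have : (τ + s) ^ (-y) * (τ + s) ^ y = 1 := by rw [← Real.rpow_add hts]; simp
        linear_combination -(τ ^ (-a) * s ^ (-y)) * this
    _ ≤ _ := mul_le_mul_of_nonneg_left key hp.le

/-- Decouples the mixed term, so that singularity and decay are evaluated at the same point and the
single kernel `expKer a l` suffices. -/
theorem rpow_neg_mul_exp_le {τ s : ℝ} (ha : 0 ≤ a) (hl : 0 ≤ l) (hτ : 0 < τ) (hs : 0 < s) :
    s ^ (-a) * Real.exp (-(l * τ)) ≤
      τ ^ (-a) * Real.exp (-(l * τ)) + s ^ (-a) * Real.exp (-(l * s)) := by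
  have h1 := mul_nonneg (Real.rpow_nonneg hτ.le (-a)) (Real.exp_pos (-(l * τ))).le
  have h2 := mul_nonneg (Real.rpow_nonneg hs.le (-a)) (Real.exp_pos (-(l * s))).le
  rcases le_total τ s with h | h
  · have : s ^ (-a) * Real.exp (-(l * τ)) ≤ τ ^ (-a) * Real.exp (-(l * τ)) :=
      mul_le_mul_of_nonneg_right (Real.rpow_le_rpow_of_nonpos hτ h (by linarith))
        (Real.exp_pos _).le
    linarith
  · have : s ^ (-a) * Real.exp (-(l * τ)) ≤ s ^ (-a) * Real.exp (-(l * s)) := by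
      refine mul_le_mul_of_nonneg_left (Real.exp_le_exp.2 ?_) (Real.rpow_nonneg hs.le _)
      nlinarith
    linarith

/-- The weighted Volterra estimate behind all bounds on the Picard iterates. -/
theorem lintegral_expKer_mul_weight_le (hr : ρ.HolderConjugate r) {y : ℝ} (hy : 0 ≤ y)
    (hya : y ≤ a) (hy1 : y ≤ 1) (hl : 0 ≤ l) {β : ℝ → ℝ≥0∞} (hβ : Measurable β)
    (hβ0 : ∀ s ∉ Ioc (0 : ℝ) 1, β s = 0) {t : ℝ} (ht : t ≤ 1) :
    ∫⁻ τ, expKer a 0 τ * β (t - τ) * ENNReal.ofReal ((t - τ) ^ (-y) * Real.exp (l * (t - τ))) ≤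
      6 * (expKerNorm ρ a l * (∫⁻ s, β s ^ r) ^ (1 / r)) *
        ENNReal.ofReal (t ^ (-y) * Real.exp (l * t)) := by
  set T := ENNReal.ofReal (t ^ (-y) * Real.exp (l * t)) with hT
  -- The weight at time `t` is factored out, leaving the damped kernel at `τ` and at `t - τ`. The
  -- mixed term with coefficient `2` is split between the two, whence `4` and `2`, and in the end
  -- the constant `6`.
  have hpt : ∀ τ, expKer a 0 τ * β (t - τ) *
      ENNReal.ofReal ((t - τ) ^ (-y) * Real.exp (l * (t - τ))) ≤
      (4 * (expKer a l τ * β (t - τ)) + 2 * (expKer a l (t - τ) * β (t - τ))) * T := by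
    intro τ
    by_cases h : τ ∈ Ioo (0 : ℝ) 1
    swap
    · rw [expKer_of_notMem h]; simp
    by_cases h' : t - τ ∈ Ioc (0 : ℝ) 1
    swap
    · rw [hβ0 _ h']; simp
    have hs : t - τ ∈ Ioo (0 : ℝ) 1 := ⟨h'.1, by linarith [h.1]⟩
    have ht0 : 0 < t := by linarith [h.1, h'.1]
    rw [expKer_of_mem h, expKer_of_mem h, expKer_of_mem hs]
    set s := t - τ with hsdef
    have hst : τ + s = t := by rw [hsdef]; ring
    have e1 := rpow_neg_mul_rpow_neg_le_add hy hya hy1 h.1 hs.1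
    rw [hst] at e1
    have e2 := rpow_neg_mul_exp_le (hy.trans hya) hl h.1 hs.1
    have hTnn : 0 ≤ t ^ (-y) * Real.exp (l * t) :=
      mul_nonneg (Real.rpow_nonneg ht0.le _) (Real.exp_pos _).le
    have e3 : τ ^ (-a) * (s ^ (-y) * Real.exp (l * s)) ≤
        (4 * (τ ^ (-a) * Real.exp (-(l * τ))) + 2 * (s ^ (-a) * Real.exp (-(l * s)))) *
          (t ^ (-y) * Real.exp (l * t)) := by
      have e4 : Real.exp (l * s) = Real.exp (-(l * τ)) * Real.exp (l * t) := by
        rw [← Real.exp_add, ← hst]; ring_nf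
      calc τ ^ (-a) * (s ^ (-y) * Real.exp (l * s))
          = τ ^ (-a) * s ^ (-y) * Real.exp (l * s) := by ring
        _ ≤ t ^ (-y) * (2 * (τ ^ (-a) + s ^ (-a))) * Real.exp (l * s) :=
            mul_le_mul_of_nonneg_right e1 (Real.exp_pos _).le
        _ = (2 * (τ ^ (-a) * Real.exp (-(l * τ))) + 2 * (s ^ (-a) * Real.exp (-(l * τ)))) *
            (t ^ (-y) * Real.exp (l * t)) := by rw [e4]; ring
        _ ≤ _ := by
            refine mul_le_mul_of_nonneg_right ?_ hTnn
            linarith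
    have n0 : 0 ≤ τ ^ (-a) := Real.rpow_nonneg h.1.le _
    have n1 : 0 ≤ τ ^ (-a) * Real.exp (-(l * τ)) :=
      mul_nonneg (Real.rpow_nonneg h.1.le _) (Real.exp_pos _).le
    have n2 : 0 ≤ s ^ (-a) * Real.exp (-(l * s)) :=
      mul_nonneg (Real.rpow_nonneg hs.1.le _) (Real.exp_pos _).le
    have e5 : ENNReal.ofReal (τ ^ (-a)) * ENNReal.ofReal (s ^ (-y) * Real.exp (l * s)) ≤
        (4 * ENNReal.ofReal (τ ^ (-a) * Real.exp (-(l * τ))) +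
          2 * ENNReal.ofReal (s ^ (-a) * Real.exp (-(l * s)))) * T := by
      rw [← ENNReal.ofReal_mul (Real.rpow_nonneg h.1.le _)]
      refine (ENNReal.ofReal_le_ofReal e3).trans (le_of_eq ?_)
      rw [ENNReal.ofReal_mul (by linarith), ENNReal.ofReal_add (by linarith) (by linarith),
        ENNReal.ofReal_mul (p := 4) (by norm_num), ENNReal.ofReal_mul (p := 2) (by norm_num),
        ENNReal.ofReal_ofNat, ENNReal.ofReal_ofNat]
    simp only [zero_mul, neg_zero, Real.exp_zero, mul_one]
    calc _ = ENNReal.ofReal (τ ^ (-a)) * ENNReal.ofReal (s ^ (-y) * Real.exp (l * s)) * β s := by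
          ring
      _ ≤ _ := mul_le_mul_left e5 _
      _ = _ := by ring
  have hm1 : Measurable fun τ => expKer a l τ * β (t - τ) :=
    (measurable_expKer a l).mul (hβ.comp (measurable_const.sub measurable_id))
  have hm2 : Measurable fun τ => expKer a l (t - τ) * β (t - τ) :=
    ((measurable_expKer a l).mul hβ).comp (measurable_const.sub measurable_id)
  calc _ ≤ ∫⁻ τ, (4 * (expKer a l τ * β (t - τ)) + 2 * (expKer a l (t - τ) * β (t - τ))) * T :=
        lintegral_mono hpt
    _ = (4 * ∫⁻ τ, expKer a l τ * β (t - τ)) * T + (2 * ∫⁻ τ, expKer a l (t - τ) * β (t - τ)) * T := by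
        have hm3 : Measurable fun τ =>
            4 * (expKer a l τ * β (t - τ)) + 2 * (expKer a l (t - τ) * β (t - τ)) :=
          (hm1.const_mul 4).add (hm2.const_mul 2)
        rw [lintegral_mul_const _ hm3,
          lintegral_add_left (hm1.const_mul 4), lintegral_const_mul _ hm1,
          lintegral_const_mul _ hm2, add_mul]
    _ ≤ (4 * (expKerNorm ρ a l * (∫⁻ s, β s ^ r) ^ (1 / r))) * T +
        (2 * (expKerNorm ρ a l * (∫⁻ s, β s ^ r) ^ (1 / r))) * T := by
        gcongr
        · exact lintegral_expKer_mul_le hr hβ t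
        · exact lintegral_expKer_sub_mul_le hr hβ t
    _ = _ := by ring

/-- The singularities of the kernel and of the weight merge into one of exponent `x + y`. With `x =
1/2` and `y = d/(2q)` this is again the admissible exponent, as the `L¹` bound requires. -/
theorem lintegral_expKer_mul_rpow_le (hr : ρ.HolderConjugate r) {x y : ℝ} (hx : 0 ≤ x)
    (hy : 0 ≤ y) {β : ℝ → ℝ≥0∞} (hβ : Measurable β) (hβ0 : ∀ s ∉ Ioc (0 : ℝ) 1, β s = 0) {t : ℝ}
    (ht : t ≤ 1) :
    ∫⁻ τ, expKer x 0 τ * β (t - τ) * ENNReal.ofReal ((t - τ) ^ (-y)) ≤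
      2 * (expKerNorm ρ (x + y) 0 * (∫⁻ s, β s ^ r) ^ (1 / r)) := by
  have hpt : ∀ τ, expKer x 0 τ * β (t - τ) * ENNReal.ofReal ((t - τ) ^ (-y)) ≤
      expKer (x + y) 0 τ * β (t - τ) + expKer (x + y) 0 (t - τ) * β (t - τ) := by
    intro τ
    by_cases h : τ ∈ Ioo (0 : ℝ) 1
    swap
    · rw [expKer_of_notMem h]; simp
    by_cases h' : t - τ ∈ Ioc (0 : ℝ) 1
    swap
    · rw [hβ0 _ h']; simp
    have hs : t - τ ∈ Ioo (0 : ℝ) 1 := ⟨h'.1, by linarith [h.1]⟩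
    rw [expKer_of_mem h, expKer_of_mem h, expKer_of_mem hs]
    simp only [zero_mul, neg_zero, Real.exp_zero, mul_one]
    have e := ENNReal.ofReal_le_ofReal (rpow_neg_mul_rpow_neg_le hx hy h.1 hs.1)
    rw [ENNReal.ofReal_mul (Real.rpow_nonneg h.1.le _), ENNReal.ofReal_add
      (Real.rpow_nonneg h.1.le _) (Real.rpow_nonneg hs.1.le _)] at e
    rw [mul_right_comm, ← add_mul]
    exact mul_le_mul_left e _
  have hm1 : Measurable fun τ => expKer (x + y) 0 τ * β (t - τ) :=
    (measurable_expKer _ _).mul (hβ.comp (measurable_const.sub measurable_id))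
  calc _ ≤ ∫⁻ τ, (expKer (x + y) 0 τ * β (t - τ) + expKer (x + y) 0 (t - τ) * β (t - τ)) :=
        lintegral_mono hpt
    _ = _ := lintegral_add_left hm1 _
    _ ≤ _ := add_le_add (lintegral_expKer_mul_le hr hβ t) (lintegral_expKer_sub_mul_le hr hβ t)
    _ = _ := by ring

/-- Contraction of the Volterra operator in a weighted `L^ρ` space. -/
theorem ae_tendsto_zero_of_volterra (hr : ρ.HolderConjugate r) (hl : 0 ≤ l) {β : ℝ → ℝ≥0∞}
    (hβ : Measurable β) (hβ0 : ∀ s ∉ Ioc (0 : ℝ) 1, β s = 0) {κ : ℝ≥0∞}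
    (hκ : κ * (expKerNorm ρ a l * (∫⁻ s, β s ^ r) ^ (1 / r)) ≤ 1 / 2)
    {D : ℕ → ℝ → ℝ≥0∞} (hD : ∀ n, Measurable (D n))
    (hD0 : ∫⁻ t in Ioc (0 : ℝ) 1, D 0 t ^ ρ < ⊤)
    (hstep : ∀ n, ∀ᵐ t, t ∈ Ioc (0 : ℝ) 1 →
      D (n + 1) t ≤ κ * ∫⁻ τ, expKer a 0 τ * β (t - τ) * D n (t - τ)) :
    ∀ᵐ t, t ∈ Ioc (0 : ℝ) 1 → Filter.Tendsto (fun n => D n t) Filter.atTop (nhds 0) := by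
  have hρ0 : 0 < ρ := hr.pos
  have hρ1 : 1 < ρ := hr.lt
  set w : ℝ → ℝ≥0∞ := fun t => ENNReal.ofReal (Real.exp (-(l * t))) with hw
  have hwm : Measurable w := by rw [hw]; fun_prop
  set Dh : ℕ → ℝ → ℝ≥0∞ := fun n => (Ioc (0 : ℝ) 1).indicator fun t => w t * D n t with hDh
  have hDhm : ∀ n, Measurable (Dh n) := fun n => (hwm.mul (hD n)).indicator measurableSet_Ioc
  set N := (∫⁻ s, β s ^ r) ^ (1 / r) with hN
  -- The weight splits as `w t = w τ * w (t - τ)` and turns the kernel into the damped one. Hölder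
  -- keeps kernel and difference together in `L^ρ` and the drift in `L^r`.
  have h1 : ∀ n, ∀ᵐ t, Dh (n + 1) t ≤
      κ * ((∫⁻ τ, expKer a l τ ^ ρ * Dh n (t - τ) ^ ρ) ^ (1 / ρ) * N) := by
    intro n
    filter_upwards [hstep n] with t ht
    by_cases htm : t ∈ Ioc (0 : ℝ) 1
    swap
    · rw [hDh]; simp only [indicator_of_notMem htm]; exact zero_le
    have e0 : Dh (n + 1) t = w t * D (n + 1) t := by rw [hDh]; simp only [indicator_of_mem htm]
    rw [e0]
    have e1 : ∀ τ, w t * (expKer a 0 τ * β (t - τ) * D n (t - τ)) =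
        (expKer a l τ * Dh n (t - τ)) * β (t - τ) := by
      intro τ
      by_cases h' : t - τ ∈ Ioc (0 : ℝ) 1
      swap
      · rw [hβ0 _ h']; simp
      by_cases h : τ ∈ Ioo (0 : ℝ) 1
      swap
      · rw [expKer_of_notMem h, expKer_of_notMem h]; simp
      rw [expKer_of_mem h, expKer_of_mem h, hDh]
      simp only [indicator_of_mem h', zero_mul, neg_zero, Real.exp_zero, mul_one]
      have : w t = w τ * w (t - τ) := by
        rw [hw]
        simp only
        rw [← ENNReal.ofReal_mul (Real.exp_pos _).le, ← Real.exp_add]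
        ring_nf
      rw [this, ENNReal.ofReal_mul (Real.rpow_nonneg h.1.le _)]
      change _ = _ * w τ * _ * _
      ring
    have hsub : Measurable fun τ : ℝ => t - τ := measurable_const.sub measurable_id
    calc w t * D (n + 1) t ≤ w t * (κ * ∫⁻ τ, expKer a 0 τ * β (t - τ) * D n (t - τ)) := by
          gcongr; exact ht htm
      _ = κ * ∫⁻ τ, w t * (expKer a 0 τ * β (t - τ) * D n (t - τ)) := by
          rw [lintegral_const_mul]
          · ring
          · exact ((measurable_expKer a 0).mul (hβ.comp hsub)).mul ((hD n).comp hsub)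
      _ = κ * ∫⁻ τ, (expKer a l τ * Dh n (t - τ)) * β (t - τ) := by simp_rw [e1]
      _ ≤ _ := by
          gcongr
          refine (lintegral_mul_comp_sub_le hr
            ((measurable_expKer a l).mul ((hDhm n).comp hsub)) hβ t).trans (le_of_eq ?_)
          congr 2
          refine lintegral_congr fun τ => ?_
          exact ENNReal.mul_rpow_of_nonneg _ _ hρ0.le
  -- Integrating in `t`, the convolution of the `ρ`-th powers has the product of the masses as its
  -- mass, so smallness of the kernel gives a geometric rate.
  have h2 : ∀ n, ∫⁻ t, Dh (n + 1) t ^ ρ ≤ 2⁻¹ * ∫⁻ t, Dh n t ^ ρ := by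
    intro n
    have hprod : Measurable fun z : ℝ × ℝ => expKer a l z.2 ^ ρ * Dh n (z.1 - z.2) ^ ρ :=
      (((measurable_expKer a l).comp measurable_snd).pow_const ρ).mul
        (((hDhm n).comp (measurable_fst.sub measurable_snd)).pow_const ρ)
    have e1 : ∫⁻ t, ∫⁻ τ, expKer a l τ ^ ρ * Dh n (t - τ) ^ ρ =
        (∫⁻ τ, expKer a l τ ^ ρ) * ∫⁻ t, Dh n t ^ ρ := by
      rw [lintegral_lintegral_swap hprod.aemeasurable]
      rw [← lintegral_mul_const _ ((measurable_expKer a l).pow_const ρ)]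
      refine lintegral_congr fun τ => ?_
      have hm : Measurable fun t => Dh n (t - τ) ^ ρ :=
        ((hDhm n).comp (measurable_id.sub_const τ)).pow_const ρ
      rw [lintegral_const_mul _ hm,
        lintegral_sub_right_eq_self (fun t => Dh n t ^ ρ) τ]
    have e2 : ∫⁻ τ, expKer a l τ ^ ρ = expKerNorm ρ a l ^ ρ := by
      rw [expKerNorm, ← ENNReal.rpow_mul, one_div_mul_cancel hρ0.ne', ENNReal.rpow_one]
    calc ∫⁻ t, Dh (n + 1) t ^ ρ
        ≤ ∫⁻ t, (κ * N) ^ ρ * ∫⁻ τ, expKer a l τ ^ ρ * Dh n (t - τ) ^ ρ := by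
          refine lintegral_mono_ae ?_
          filter_upwards [h1 n] with t ht
          refine (ENNReal.rpow_le_rpow ht hρ0.le).trans (le_of_eq ?_)
          rw [mul_left_comm, mul_comm, ENNReal.mul_rpow_of_nonneg _ _ hρ0.le, ← ENNReal.rpow_mul,
            one_div_mul_cancel hρ0.ne', ENNReal.rpow_one]
      _ = (κ * N) ^ ρ * (expKerNorm ρ a l ^ ρ * ∫⁻ t, Dh n t ^ ρ) := by
          rw [lintegral_const_mul _ hprod.lintegral_prod_right', e1, e2]
      _ = (κ * (expKerNorm ρ a l * N)) ^ ρ * ∫⁻ t, Dh n t ^ ρ := by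
          rw [← mul_assoc, ← ENNReal.mul_rpow_of_nonneg _ _ hρ0.le]
          ring_nf
      _ ≤ _ := by
          gcongr
          calc (κ * (expKerNorm ρ a l * N)) ^ ρ ≤ (1 / 2) ^ ρ := ENNReal.rpow_le_rpow hκ hρ0.le
            _ ≤ (1 / 2) ^ (1 : ℝ) := ENNReal.rpow_le_rpow_of_exponent_ge (by simp) hρ1.le
            _ = 2⁻¹ := by simp
  have h3 : ∀ n, ∫⁻ t, Dh n t ^ ρ ≤ 2⁻¹ ^ n * ∫⁻ t, Dh 0 t ^ ρ := by
    intro n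
    induction n with
    | zero => simp
    | succ n ih =>
      calc _ ≤ 2⁻¹ * ∫⁻ t, Dh n t ^ ρ := h2 n
        _ ≤ 2⁻¹ * (2⁻¹ ^ n * ∫⁻ t, Dh 0 t ^ ρ) := by gcongr
        _ = _ := by rw [pow_succ]; ring
  have h4 : ∫⁻ t, Dh 0 t ^ ρ < ⊤ := by
    refine lt_of_le_of_lt ?_ hD0
    rw [← lintegral_indicator measurableSet_Ioc]
    refine lintegral_mono fun t => ?_
    by_cases htm : t ∈ Ioc (0 : ℝ) 1
    · rw [hDh]
      simp only [indicator_of_mem htm]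
      refine ENNReal.rpow_le_rpow ?_ hρ0.le
      have : w t ≤ 1 := by
        rw [hw, ← ENNReal.ofReal_one]
        refine ENNReal.ofReal_le_ofReal ?_
        rw [Real.exp_le_one_iff]
        nlinarith [mul_nonneg hl htm.1.le]
      calc w t * D 0 t ≤ 1 * D 0 t := by gcongr
        _ = D 0 t := one_mul _
    · rw [hDh]
      simp only [indicator_of_notMem htm, ENNReal.zero_rpow_of_pos hρ0, le_refl]
  -- Geometric decay makes the series integrable, hence finite almost everywhere; its terms then
  -- tend to zero along the whole sequence, not only a subsequence.
  have h5 : ∫⁻ t, ∑' n, Dh n t ^ ρ ≠ ⊤ := by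
    rw [lintegral_tsum fun n => ((hDhm n).pow_const ρ).aemeasurable]
    refine ne_top_of_le_ne_top ?_ (ENNReal.tsum_le_tsum h3)
    rw [ENNReal.tsum_mul_right, ENNReal.tsum_geometric]
    exact ENNReal.mul_ne_top (by simp) h4.ne
  have h6 := ae_lt_top (Measurable.tsum fun n => (hDhm n).pow_const ρ) h5
  filter_upwards [h6] with t ht htm
  have h7 := ENNReal.tendsto_atTop_zero_of_tsum_ne_top ht.ne
  have h8 : Filter.Tendsto (fun n => Dh n t) Filter.atTop (nhds 0) := by
    have h9 := (ENNReal.continuous_rpow_const (y := 1 / ρ)).tendsto 0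
    rw [ENNReal.zero_rpow_of_pos (by positivity)] at h9
    refine (h9.comp h7).congr fun n => ?_
    simp only [Function.comp]
    rw [← ENNReal.rpow_mul, mul_one_div_cancel hρ0.ne', ENNReal.rpow_one]
  have hw0 : w t ≠ 0 := by rw [hw]; simp [Real.exp_pos]
  have hwt : w t ≠ ⊤ := by rw [hw]; simp
  have h10 := ENNReal.Tendsto.const_mul (a := (w t)⁻¹) h8 (Or.inr (ENNReal.inv_ne_top.2 hw0))
  rw [mul_zero] at h10
  refine h10.congr fun n => ?_
  rw [hDh]
  simp only [indicator_of_mem htm]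
  rw [← mul_assoc, ENNReal.inv_mul_cancel hw0 hwt, one_mul]

end TimeKernel

/-! ### The Gaussian, its gradient and a dominating Gaussian. -/

section Gaussian

variable {d : ℕ}

/-- The heat kernel of `ℝ^d` at time one. -/
def gauss (z : E d) : ℝ := (4 * Real.pi) ^ (-(d : ℝ) / 2) * Real.exp (-(1 / 4) * ‖z‖ ^ 2)

/-- The modulus of the gradient of `gauss`. -/
def gaussGrad (z : E d) : ℝ := 1 / 2 * ‖z‖ * gauss z

/-- A Gaussian dominating `gauss` and its gradient, with exponential room. -/
def gaussDom (z : E d) : ℝ :=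
  (4 * Real.pi) ^ (-(d : ℝ) / 2) * Real.exp 8 * Real.exp (-(1 / 8) * ‖z‖ ^ 2)

theorem gauss_pos (z : E d) : 0 < gauss z := by unfold gauss; positivity

theorem gaussGrad_nonneg (z : E d) : 0 ≤ gaussGrad z := by
  have := (gauss_pos z).le
  unfold gaussGrad; positivity

theorem gaussDom_nonneg (z : E d) : 0 ≤ gaussDom z := by unfold gaussDom; positivity

@[fun_prop]
theorem continuous_gauss : Continuous (gauss : E d → ℝ) := by unfold gauss; fun_prop

@[fun_prop]
theorem continuous_gaussGrad : Continuous (gaussGrad : E d → ℝ) := by unfold gaussGrad; fun_prop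

@[fun_prop]
theorem continuous_gaussDom : Continuous (gaussDom : E d → ℝ) := by unfold gaussDom; fun_prop

/-- The factor `exp ‖z‖` is what it costs to move the weight `exp (-‖x‖)` along a displacement `√τ
z` with `τ ≤ 1`. -/
theorem one_add_norm_mul_gauss_mul_exp_le (z : E d) :
    (1 + ‖z‖) * gauss z * Real.exp ‖z‖ ≤ gaussDom z := by
  have h1 : 1 + ‖z‖ ≤ Real.exp ‖z‖ := by linarith [Real.add_one_le_exp ‖z‖]
  have h2 : (1 + ‖z‖) * Real.exp (-(1 / 4) * ‖z‖ ^ 2) * Real.exp ‖z‖ ≤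
      Real.exp 8 * Real.exp (-(1 / 8) * ‖z‖ ^ 2) := by
    calc _ ≤ Real.exp ‖z‖ * Real.exp (-(1 / 4) * ‖z‖ ^ 2) * Real.exp ‖z‖ := by gcongr
      _ = Real.exp (‖z‖ + -(1 / 4) * ‖z‖ ^ 2 + ‖z‖) := by rw [Real.exp_add, Real.exp_add]
      -- The difference of the exponents is `(‖z‖ - 8) ^ 2 / 8`, whence the constant `8`.
      _ ≤ Real.exp (8 + -(1 / 8) * ‖z‖ ^ 2) := by
          refine Real.exp_le_exp.2 ?_
          nlinarith [sq_nonneg (‖z‖ - 8)]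
      _ = _ := Real.exp_add _ _
  unfold gauss gaussDom
  have h3 : 0 ≤ (4 * Real.pi) ^ (-(d : ℝ) / 2) := by positivity
  calc _ = (4 * Real.pi) ^ (-(d : ℝ) / 2) *
        ((1 + ‖z‖) * Real.exp (-(1 / 4) * ‖z‖ ^ 2) * Real.exp ‖z‖) := by ring
    _ ≤ _ := mul_le_mul_of_nonneg_left h2 h3
    _ = _ := by ring

theorem gauss_mul_exp_le (z : E d) : gauss z * Real.exp ‖z‖ ≤ gaussDom z := by
  refine le_trans ?_ (one_add_norm_mul_gauss_mul_exp_le z)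
  have := (gauss_pos z).le
  gcongr
  nlinarith [norm_nonneg z]

theorem gaussGrad_mul_exp_le (z : E d) : gaussGrad z * Real.exp ‖z‖ ≤ gaussDom z := by
  refine le_trans ?_ (one_add_norm_mul_gauss_mul_exp_le z)
  have := (gauss_pos z).le
  unfold gaussGrad
  gcongr
  nlinarith [norm_nonneg z]

theorem gauss_le_gaussDom (z : E d) : gauss z ≤ gaussDom z := by
  refine le_trans ?_ (gauss_mul_exp_le z)
  exact le_mul_of_one_le_right (gauss_pos z).le (Real.one_le_exp (norm_nonneg z))

theorem gaussGrad_le_gaussDom (z : E d) : gaussGrad z ≤ gaussDom z := by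
  refine le_trans ?_ (gaussGrad_mul_exp_le z)
  exact le_mul_of_one_le_right (gaussGrad_nonneg z) (Real.one_le_exp (norm_nonneg z))

theorem integrable_exp_neg_mul_norm_sq {b : ℝ} (hb : 0 < b) :
    Integrable fun z : E d => Real.exp (-b * ‖z‖ ^ 2) := by
  -- A function that is not integrable has integral `0`, whereas the Gaussian integral formula gives
  -- a positive value.
  by_contra h
  have h1 := GaussianFourier.integral_rexp_neg_mul_sq_norm (V := E d) hb
  rw [integral_undef h] at h1
  have : 0 < (Real.pi / b) ^ ((Module.finrank ℝ (E d) : ℝ) / 2) := by positivity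
  linarith

theorem integrable_gaussDom : Integrable (gaussDom : E d → ℝ) := by
  unfold gaussDom
  exact (integrable_exp_neg_mul_norm_sq (by norm_num)).const_mul _

theorem integrable_gauss : Integrable (gauss : E d → ℝ) :=
  integrable_gaussDom.mono' continuous_gauss.aestronglyMeasurable
    (Filter.Eventually.of_forall fun z => by
      rw [Real.norm_of_nonneg (gauss_pos z).le]; exact gauss_le_gaussDom z)

theorem integrable_gaussGrad : Integrable (gaussGrad : E d → ℝ) :=
  integrable_gaussDom.mono' continuous_gaussGrad.aestronglyMeasurable
    (Filter.Eventually.of_forall fun z => by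
      rw [Real.norm_of_nonneg (gaussGrad_nonneg z)]; exact gaussGrad_le_gaussDom z)

theorem integral_gauss : ∫ z : E d, gauss z = 1 := by
  unfold gauss
  rw [integral_const_mul, GaussianFourier.integral_rexp_neg_mul_sq_norm (by norm_num),
    finrank_euclideanSpace_fin]
  have : Real.pi / (1 / 4) = 4 * Real.pi := by ring
  rw [this, ← Real.rpow_add (by positivity)]
  have : -(d : ℝ) / 2 + d / 2 = 0 := by ring
  rw [this, Real.rpow_zero]

theorem lintegral_gauss : ∫⁻ z : E d, ENNReal.ofReal (gauss z) = 1 := by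
  rw [← ofReal_integral_eq_lintegral_ofReal integrable_gauss
    (Filter.Eventually.of_forall fun z => (gauss_pos z).le), integral_gauss, ENNReal.ofReal_one]

theorem eLpNorm_lt_top_of_le_gaussDom {p : ℝ≥0∞} (hp1 : 1 ≤ p) (hp : p ≠ ⊤) {f : E d → ℝ}
    (hf : ∀ z, f z ≤ gaussDom z) : eLpNorm (fun z => ENNReal.ofReal (f z)) p volume < ⊤ := by
  have h0 : p ≠ 0 := (zero_lt_one.trans_le hp1).ne'
  have hp0 := ENNReal.toReal_pos h0 hp
  rw [eLpNorm_ennreal_of_ne_top h0 hp]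
  refine ENNReal.rpow_lt_top_of_nonneg (by positivity) (ne_of_lt ?_)
  have h1 : Integrable fun z : E d =>
      ((4 * Real.pi) ^ (-(d : ℝ) / 2) * Real.exp 8) ^ p.toReal *
        Real.exp (-(p.toReal / 8) * ‖z‖ ^ 2) :=
    (integrable_exp_neg_mul_norm_sq (by positivity)).const_mul _
  refine lt_of_le_of_lt (lintegral_mono fun z => ?_) h1.lintegral_lt_top
  calc ENNReal.ofReal (f z) ^ p.toReal ≤ ENNReal.ofReal (gaussDom z) ^ p.toReal :=
        ENNReal.rpow_le_rpow (ENNReal.ofReal_le_ofReal (hf z)) hp0.le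
    _ = _ := by
        rw [ENNReal.ofReal_rpow_of_nonneg (gaussDom_nonneg z) hp0.le]
        congr 1
        unfold gaussDom
        rw [Real.mul_rpow (by positivity) (by positivity), ← Real.exp_mul]
        ring_nf

theorem hasFDerivAt_gauss (z : E d) :
    HasFDerivAt (gauss : E d → ℝ) ((-(1 / 2) * gauss z) • innerSL ℝ z) z := by
  unfold gauss
  have h1 : HasFDerivAt (fun z : E d => ‖z‖ ^ 2) (2 • innerSL ℝ z) z :=
    (hasStrictFDerivAt_norm_sq z).hasFDerivAt
  have h2 := ((h1.const_mul (-(1 / 4 : ℝ))).exp).const_mul ((4 * Real.pi) ^ (-(d : ℝ) / 2))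
  refine h2.congr_fderiv ?_
  ext v
  simp
  ring

end Gaussian

/-! ### The heat flow and the Duhamel operator in self-similar variables. -/

section HeatOperators

variable {d : ℕ}

/-- The measure `dτ dz` on `(0,1) × ℝ^d`. -/
abbrev heatMeasure (d : ℕ) : Measure (ℝ × E d) := (volume.restrict (Ioo (0 : ℝ) 1)).prod volume

/-- The majorant of the Duhamel operator. -/
def duhamelMaj (B v : ℝ × E d → ℝ≥0∞) (p : ℝ × E d) : ℝ≥0∞ :=
  ∫⁻ w, ENNReal.ofReal (w.1 ^ (-(1 / 2) : ℝ) * gaussGrad w.2) *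
    B (p.1 - w.1, p.2 + √w.1 • w.2) * v (p.1 - w.1, p.2 + √w.1 • w.2) ∂heatMeasure d

/-- The Duhamel operator `v ↦ - ∫ e^{(t-s)Δ} div (b v)(s) ds`. -/
def duhamel (b : ℝ × E d → E d) (v : ℝ × E d → ℝ) (p : ℝ × E d) : ℝ :=
  ∫ w, w.1 ^ (-(1 / 2) : ℝ) * (-(1 / 2) * gauss w.2 *
    inner ℝ w.2 (b (p.1 - w.1, p.2 + √w.1 • w.2))) * v (p.1 - w.1, p.2 + √w.1 • w.2)
    ∂heatMeasure d

/-- The heat flow `e^{tΔ} u₀`. -/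
def heatFlow (u₀ : E d → ℝ) (p : ℝ × E d) : ℝ := ∫ z, gauss z * u₀ (p.2 + √p.1 • z)

theorem measurable_shift : Measurable fun y : (ℝ × E d) × (ℝ × E d) =>
    (y.1.1 - y.2.1, y.1.2 + √y.2.1 • y.2.2) := by fun_prop

theorem measurable_duhamelMaj_integrand {B v : ℝ × E d → ℝ≥0∞} (hB : Measurable B)
    (hv : Measurable v) : Measurable fun y : (ℝ × E d) × (ℝ × E d) =>
      ENNReal.ofReal (y.2.1 ^ (-(1 / 2) : ℝ) * gaussGrad y.2.2) *
        B (y.1.1 - y.2.1, y.1.2 + √y.2.1 • y.2.2) * v (y.1.1 - y.2.1, y.1.2 + √y.2.1 • y.2.2) := by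
  refine Measurable.mul (Measurable.mul ?_ (hB.comp measurable_shift)) (hv.comp measurable_shift)
  have := (continuous_gaussGrad (d := d)).measurable
  fun_prop

theorem measurable_duhamelMaj {B v : ℝ × E d → ℝ≥0∞} (hB : Measurable B) (hv : Measurable v) :
    Measurable (duhamelMaj B v) :=
  (measurable_duhamelMaj_integrand hB hv).lintegral_prod_right'

theorem measurable_duhamel_integrand {b : ℝ × E d → E d} {v : ℝ × E d → ℝ} (hb : Measurable b)
    (hv : Measurable v) : Measurable fun y : (ℝ × E d) × (ℝ × E d) =>
      y.2.1 ^ (-(1 / 2) : ℝ) * (-(1 / 2) * gauss y.2.2 *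
        inner ℝ y.2.2 (b (y.1.1 - y.2.1, y.1.2 + √y.2.1 • y.2.2))) *
          v (y.1.1 - y.2.1, y.1.2 + √y.2.1 • y.2.2) := by
  have h1 := hb.comp (measurable_shift (d := d))
  have h2 := hv.comp (measurable_shift (d := d))
  have h3 := (continuous_gauss (d := d)).measurable
  simp only [Function.comp_def] at h1 h2
  refine Measurable.mul (Measurable.mul (by fun_prop) (Measurable.mul ?_ ?_)) h2
  · exact (h3.comp (measurable_snd.comp measurable_snd)).const_mul _
  · exact Measurable.inner (measurable_snd.comp measurable_snd) h1

theorem measurable_duhamel {b : ℝ × E d → E d} {v : ℝ × E d → ℝ} (hb : Measurable b)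
    (hv : Measurable v) : Measurable (duhamel b v) :=
  (measurable_duhamel_integrand hb hv).stronglyMeasurable.integral_prod_right'.measurable

theorem measurable_heatFlow_integrand {u₀ : E d → ℝ} (hu : Measurable u₀) :
    Measurable fun y : (ℝ × E d) × E d => gauss y.2 * u₀ (y.1.2 + √y.1.1 • y.2) := by
  have h3 := (continuous_gauss (d := d)).measurable
  exact (h3.comp measurable_snd).mul (hu.comp (by fun_prop))

theorem measurable_heatFlow {u₀ : E d → ℝ} (hu : Measurable u₀) : Measurable (heatFlow u₀) :=
  (measurable_heatFlow_integrand hu).stronglyMeasurable.integral_prod_right'.measurable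

theorem enorm_duhamel_integrand_le (b : ℝ × E d → E d) (v : ℝ × E d → ℝ) (p w : ℝ × E d) 
    (hw : 0 ≤ w.1) :
    ‖w.1 ^ (-(1 / 2) : ℝ) * (-(1 / 2) * gauss w.2 *
      inner ℝ w.2 (b (p.1 - w.1, p.2 + √w.1 • w.2))) * v (p.1 - w.1, p.2 + √w.1 • w.2)‖ₑ ≤
    ENNReal.ofReal (w.1 ^ (-(1 / 2) : ℝ) * gaussGrad w.2) *
      ‖b (p.1 - w.1, p.2 + √w.1 • w.2)‖ₑ * ‖v (p.1 - w.1, p.2 + √w.1 • w.2)‖ₑ := by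
  rw [enorm_mul]
  gcongr
  rw [← ofReal_norm, ← ofReal_norm, ← ENNReal.ofReal_mul
    (mul_nonneg (Real.rpow_nonneg hw _) (gaussGrad_nonneg _))]
  refine ENNReal.ofReal_le_ofReal ?_
  have h1 : 0 ≤ w.1 ^ (-(1 / 2) : ℝ) := Real.rpow_nonneg hw _
  rw [norm_mul, Real.norm_of_nonneg h1, norm_mul, norm_mul, Real.norm_of_nonneg (gauss_pos _).le,
    gaussGrad]
  refine le_trans (mul_le_mul_of_nonneg_left ?_ h1) (le_of_eq (mul_assoc _ _ _).symm)
  have h2 := norm_inner_le_norm (𝕜 := ℝ) w.2 (b (p.1 - w.1, p.2 + √w.1 • w.2))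
  have h3 : ‖(-(1 / 2) : ℝ)‖ = 1 / 2 := by norm_num
  rw [h3]
  nlinarith [gauss_pos w.2]

theorem ae_heatMeasure_pos : ∀ᵐ w ∂heatMeasure d, 0 < w.1 ∧ w.1 < 1 := by
  have h : ∀ᵐ τ ∂(volume.restrict (Ioo (0 : ℝ) 1)), 0 < τ ∧ τ < 1 :=
    (ae_restrict_mem measurableSet_Ioo).mono fun _ h => h
  exact Measure.quasiMeasurePreserving_fst.ae h

theorem lintegral_enorm_duhamel_le (b : ℝ × E d → E d) (v : ℝ × E d → ℝ) (p : ℝ × E d) :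
    ∫⁻ w, ‖w.1 ^ (-(1 / 2) : ℝ) * (-(1 / 2) * gauss w.2 *
      inner ℝ w.2 (b (p.1 - w.1, p.2 + √w.1 • w.2))) * v (p.1 - w.1, p.2 + √w.1 • w.2)‖ₑ
      ∂heatMeasure d ≤
    duhamelMaj (fun y => ‖b y‖ₑ) (fun y => ‖v y‖ₑ) p := by
  refine lintegral_mono_ae ?_
  filter_upwards [ae_heatMeasure_pos] with w hw
  exact enorm_duhamel_integrand_le b v p w hw.1.le

theorem enorm_duhamel_le (b : ℝ × E d → E d) (v : ℝ × E d → ℝ) (p : ℝ × E d) :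
    ‖duhamel b v p‖ₑ ≤ duhamelMaj (fun y => ‖b y‖ₑ) (fun y => ‖v y‖ₑ) p :=
  (enorm_integral_le_lintegral_enorm _).trans (lintegral_enorm_duhamel_le b v p)

/-- If the majorant of the difference is infinite nothing is to be proved; otherwise the term with
`v'` is recovered from those with `v` and `v - v'`. No integrability of `v'`, later a Picard
iterate, is required. -/
theorem enorm_duhamel_sub_le {b : ℝ × E d → E d} {v v' : ℝ × E d → ℝ} (hb : Measurable b)
    (hv : Measurable v) (hv' : Measurable v') (p : ℝ × E d)
    (hp : duhamelMaj (fun y => ‖b y‖ₑ) (fun y => ‖v y‖ₑ) p < ⊤) :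
    ‖duhamel b v p - duhamel b v' p‖ₑ ≤
      duhamelMaj (fun y => ‖b y‖ₑ) (fun y => ‖v y - v' y‖ₑ) p := by
  rcases eq_or_ne (duhamelMaj (fun y => ‖b y‖ₑ) (fun y => ‖v y - v' y‖ₑ) p) ⊤ with h | h
  · rw [h]; exact le_top
  have hI : ∀ {f : ℝ × E d → ℝ}, Measurable f →
      duhamelMaj (fun y => ‖b y‖ₑ) (fun y => ‖f y‖ₑ) p < ⊤ →
      Integrable (fun w : ℝ × E d => w.1 ^ (-(1 / 2) : ℝ) * (-(1 / 2) * gauss w.2 *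
        inner ℝ w.2 (b (p.1 - w.1, p.2 + √w.1 • w.2))) * f (p.1 - w.1, p.2 + √w.1 • w.2))
        (heatMeasure d) := fun hf hfin =>
    ⟨((measurable_duhamel_integrand hb hf).comp measurable_prodMk_left).aestronglyMeasurable,
      (lintegral_enorm_duhamel_le b _ p).trans_lt hfin⟩
  have h1 := hI hv hp
  have h2 := hI (hv.sub hv') (lt_top_iff_ne_top.2 h)
  have h3 : duhamel b v p - duhamel b v' p = duhamel b (v - v') p := by
    rw [sub_eq_iff_eq_add, ← sub_eq_iff_eq_add']
    unfold duhamel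
    rw [← integral_sub h1 h2]
    refine integral_congr_ae (Filter.Eventually.of_forall fun w => ?_)
    simp only [Pi.sub_apply]
    ring
  rw [h3]
  exact enorm_duhamel_le b (v - v') p

theorem enorm_heatFlow_le (u₀ : E d → ℝ) (p : ℝ × E d) :
    ‖heatFlow u₀ p‖ₑ ≤ ∫⁻ z, ENNReal.ofReal (gauss z) * ‖u₀ (p.2 + √p.1 • z)‖ₑ := by
  refine (enorm_integral_le_lintegral_enorm _).trans (lintegral_mono fun z => ?_)
  rw [enorm_mul, ← ofReal_norm, Real.norm_of_nonneg (gauss_pos z).le]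

end HeatOperators

/-! ### Lebesgue norms of the heat flow and of the Duhamel term at a fixed time. -/

section Bounds

variable {d : ℕ}

/-- The exponent `d / (2q)`. -/
def halfExp (d : ℕ) (q : ℝ≥0∞) : ℝ := d / 2 * q⁻¹.toReal

theorem halfExp_nonneg (d : ℕ) (q : ℝ≥0∞) : 0 ≤ halfExp d q := by unfold halfExp; positivity

theorem sqrt_rpow_halfExp {τ : ℝ} (hτ : 0 < τ) (q : ℝ≥0∞) :
    √τ ^ (-(d : ℝ) * q⁻¹.toReal) = τ ^ (-halfExp d q) := by
  rw [Real.sqrt_eq_rpow, ← Real.rpow_mul hτ.le, halfExp]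
  congr 1
  ring

theorem duhamelMaj_eq {B v : ℝ × E d → ℝ≥0∞} (hB : Measurable B) (hv : Measurable v) (t : ℝ)
    (x : E d) :
    duhamelMaj B v (t, x) = ∫⁻ τ, expKer (1 / 2) 0 τ * ∫⁻ z, ENNReal.ofReal (gaussGrad z) *
      B (t - τ, x + √τ • z) * v (t - τ, x + √τ • z) := by
  have hm : Measurable fun w : ℝ × E d => ENNReal.ofReal (w.1 ^ (-(1 / 2) : ℝ) * gaussGrad w.2) *
      B (t - w.1, x + √w.1 • w.2) * v (t - w.1, x + √w.1 • w.2) := by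
    have h := (measurable_duhamelMaj_integrand hB hv).comp
      (measurable_prodMk_left (x := (t, x)) (β := ℝ × E d))
    simpa only [Function.comp_def] using h
  unfold duhamelMaj
  rw [lintegral_prod _ hm.aemeasurable, ← lintegral_indicator measurableSet_Ioo]
  refine lintegral_congr fun τ => ?_
  by_cases h : τ ∈ Ioo (0 : ℝ) 1
  · rw [indicator_of_mem h, expKer_of_mem h, ← lintegral_const_mul]
    · refine lintegral_congr fun z => ?_
      simp only [zero_mul, neg_zero, Real.exp_zero, mul_one]
      rw [ENNReal.ofReal_mul (Real.rpow_nonneg h.1.le _)]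
      ring
    · have h1 : Measurable fun z : E d => (t - τ, x + √τ • z) := by fun_prop
      exact (continuous_gaussGrad.measurable.ennreal_ofReal.mul (hB.comp h1)).mul (hv.comp h1)
  · rw [indicator_of_notMem h, expKer_of_notMem h, zero_mul]

theorem measurable_inner_duhamelMaj {B v : ℝ × E d → ℝ≥0∞} (hB : Measurable B) (hv : Measurable v)
    (t : ℝ) : Measurable fun y : E d × ℝ => ∫⁻ z, ENNReal.ofReal (gaussGrad z) *
      B (t - y.2, y.1 + √y.2 • z) * v (t - y.2, y.1 + √y.2 • z) := by
  have h1 : Measurable fun y : (E d × ℝ) × E d => (t - y.1.2, y.1.1 + √y.1.2 • y.2) := by fun_prop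
  exact (((continuous_gaussGrad.measurable.ennreal_ofReal.comp measurable_snd).mul
    (hB.comp h1)).mul (hv.comp h1)).lintegral_prod_right'

theorem eLpNorm_duhamelMaj_le_lintegral {B v : ℝ × E d → ℝ≥0∞} (hB : Measurable B)
    (hv : Measurable v) {p : ℝ≥0∞} (hp : 1 ≤ p) (t : ℝ) :
    eLpNorm (fun x => duhamelMaj B v (t, x)) p volume ≤
      ∫⁻ τ, expKer (1 / 2) 0 τ * eLpNorm (fun x => ∫⁻ z, ENNReal.ofReal (gaussGrad z) *
        B (t - τ, x + √τ • z) * v (t - τ, x + √τ • z)) p volume := by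
  simp_rw [duhamelMaj_eq hB hv]
  have hi := measurable_inner_duhamelMaj hB hv t
  refine (eLpNorm_lintegral_le hp ?_).trans (le_of_eq ?_)
  · exact ((measurable_expKer _ _).comp measurable_snd).mul hi
  · refine lintegral_congr fun τ => ?_
    exact eLpNorm_ennreal_const_mul _ (hi.comp measurable_prodMk_right) p

/-- The derivative of the kernel gives `τ ^ (-1/2)`, and the scaled Young inequality with `c = √τ`
adds `τ ^ (-d/(2q))`. The condition `q' ≤ p` says that the product of an `L^q` and an `L^p` function
still has a Lebesgue exponent at least one. -/
theorem eLpNorm_duhamelMaj_le (q q' p : ℝ≥0∞) [hqq : ENNReal.HolderConjugate q' q]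
    (hq' : q' ≠ ⊤) (hp : q' ≤ p) {B v : ℝ × E d → ℝ≥0∞} (hB : Measurable B) (hv : Measurable v)
    (t : ℝ) :
    eLpNorm (fun x => duhamelMaj B v (t, x)) p volume ≤
      eLpNorm (fun z : E d => ENNReal.ofReal (gaussGrad z)) q' volume *
        ∫⁻ τ, expKer (1 / 2 + halfExp d q) 0 τ * eLpNorm (fun x => B (t - τ, x)) q volume *
          eLpNorm (fun x => v (t - τ, x)) p volume := by
  have hq1 : 1 ≤ q' := ENNReal.HolderConjugate.one_le q' q
  refine (eLpNorm_duhamelMaj_le_lintegral hB hv (hq1.trans hp) t).trans ?_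
  have hs : Measurable fun τ : ℝ => t - τ := measurable_const.sub measurable_id
  rw [← lintegral_const_mul]
  swap
  · exact ((measurable_expKer _ _).mul
      ((measurable_eLpNorm_right hB.stronglyMeasurable q).comp hs)).mul
      ((measurable_eLpNorm_right hv.stronglyMeasurable p).comp hs)
  refine lintegral_mono fun τ => ?_
  by_cases h : τ ∈ Ioo (0 : ℝ) 1
  swap
  · simp only [expKer_of_notMem h, zero_mul, le_refl, mul_zero]
  have h1 := eLpNorm_lintegral_smul_le q q' p hq' hp (Real.sqrt_pos.2 h.1)
    (continuous_gaussGrad (d := d)).measurable.ennreal_ofReal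
    (hB.comp (measurable_prodMk_left (x := t - τ))) (hv.comp (measurable_prodMk_left (x := t - τ)))
  rw [sqrt_rpow_halfExp h.1] at h1
  refine (mul_le_mul_right h1 _).trans (le_of_eq ?_)
  rw [expKer_of_mem h, expKer_of_mem h]
  simp only [zero_mul, neg_zero, Real.exp_zero, mul_one]
  rw [neg_add, Real.rpow_add h.1, ENNReal.ofReal_mul (Real.rpow_nonneg h.1.le _)]
  simp only [Function.comp_def]
  ring

/-- The product is in `L¹` by Hölder, and convolution with an integrable kernel keeps it there; only
the singularity `τ ^ (-1/2)` remains. This is how `L¹` is reached, at the price of the `L^{q'}` norm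
of `v`. -/
theorem eLpNorm_one_duhamelMaj_le (q q' : ℝ≥0∞) [hqq : ENNReal.HolderConjugate q' q]
    {B v : ℝ × E d → ℝ≥0∞} (hB : Measurable B) (hv : Measurable v) (t : ℝ) :
    eLpNorm (fun x => duhamelMaj B v (t, x)) 1 volume ≤
      eLpNorm (fun z : E d => ENNReal.ofReal (gaussGrad z)) 1 volume *
        ∫⁻ τ, expKer (1 / 2) 0 τ * eLpNorm (fun x => B (t - τ, x)) q volume *
          eLpNorm (fun x => v (t - τ, x)) q' volume := by
  refine (eLpNorm_duhamelMaj_le_lintegral hB hv le_rfl t).trans ?_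
  have hs : Measurable fun τ : ℝ => t - τ := measurable_const.sub measurable_id
  rw [← lintegral_const_mul]
  swap
  · exact ((measurable_expKer _ _).mul
      ((measurable_eLpNorm_right hB.stronglyMeasurable q).comp hs)).mul
      ((measurable_eLpNorm_right hv.stronglyMeasurable q').comp hs)
  refine lintegral_mono fun τ => ?_
  have hG := (continuous_gaussGrad (d := d)).measurable.ennreal_ofReal
  have hBt : Measurable fun x => B (t - τ, x) := hB.comp measurable_prodMk_left
  have hvt : Measurable fun x => v (t - τ, x) := hv.comp measurable_prodMk_left
  have h1 : eLpNorm (fun x => ∫⁻ z, ENNReal.ofReal (gaussGrad z) *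
      B (t - τ, x + √τ • z) * v (t - τ, x + √τ • z)) 1 volume ≤
      ∫⁻ z : E d, ENNReal.ofReal (gaussGrad z) * ∫⁻ x, B (t - τ, x) * v (t - τ, x) := by
    refine (eLpNorm_lintegral_le le_rfl ?_).trans (le_of_eq ?_)
    · have h1 : Measurable fun y : E d × E d => (t - τ, y.1 + √τ • y.2) := by fun_prop
      exact ((hG.comp measurable_snd).mul (hB.comp h1)).mul (hv.comp h1)
    · refine lintegral_congr fun z => ?_
      rw [eLpNorm_ennreal_of_ne_top one_ne_zero ENNReal.one_ne_top]
      simp only [ENNReal.toReal_one, ENNReal.rpow_one, div_one, mul_assoc]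
      rw [lintegral_const_mul, lintegral_add_right_eq_self (fun x => B (t - τ, x) * v (t - τ, x))]
      exact (hBt.mul hvt).comp (measurable_add_const _)
  rw [lintegral_mul_const _ hG] at h1
  have h2 := lintegral_mul_le_eLpNorm_mul_eLpNorm (μ := volume) q q' hBt.aemeasurable
    hvt.aemeasurable
  have h3 : eLpNorm (fun z : E d => ENNReal.ofReal (gaussGrad z)) 1 volume =
      ∫⁻ z : E d, ENNReal.ofReal (gaussGrad z) := by
    rw [eLpNorm_ennreal_of_ne_top one_ne_zero ENNReal.one_ne_top]
    simp
  rw [h3]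
  calc _ ≤ expKer (1 / 2) 0 τ * ((∫⁻ z : E d, ENNReal.ofReal (gaussGrad z)) *
        (eLpNorm (fun x => B (t - τ, x)) q volume * eLpNorm (fun x => v (t - τ, x)) q' volume)) := by
        gcongr
        exact h1.trans (mul_le_mul_right h2 _)
    _ = _ := by ring

theorem eLpNorm_heatFlow_le {u₀ : E d → ℝ} (hu : Measurable u₀) {p : ℝ≥0∞} (hp : 1 ≤ p) (t : ℝ) :
    eLpNorm (fun x => heatFlow u₀ (t, x)) p volume ≤ eLpNorm u₀ p volume := by
  have hG := (continuous_gauss (d := d)).measurable.ennreal_ofReal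
  have h0 : eLpNorm (fun x => heatFlow u₀ (t, x)) p volume ≤
      eLpNorm (fun x => ∫⁻ z, ENNReal.ofReal (gauss z) * ‖u₀ (x + √t • z)‖ₑ) p volume :=
    eLpNorm_mono_enorm fun x => by
      rw [enorm_eq_self]; exact enorm_heatFlow_le u₀ (t, x)
  refine h0.trans ((eLpNorm_lintegral_le hp ?_).trans (le_of_eq ?_))
  · have h1 : Measurable fun y : E d × E d => y.1 + √t • y.2 := by fun_prop
    exact (hG.comp measurable_snd).mul (hu.enorm.comp h1)
  · have : ∀ z : E d, eLpNorm (fun x => ENNReal.ofReal (gauss z) * ‖u₀ (x + √t • z)‖ₑ) p volume =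
        ENNReal.ofReal (gauss z) * eLpNorm u₀ p volume := by
      intro z
      have hm : Measurable fun x => ‖u₀ (x + √t • z)‖ₑ := hu.enorm.comp (measurable_add_const _)
      rw [eLpNorm_ennreal_const_mul _ hm,
        eLpNorm_comp_add_right (f := fun x => ‖u₀ x‖ₑ) _ hu.enorm, eLpNorm_enorm]
    simp_rw [this]
    rw [lintegral_mul_const _ hG, lintegral_gauss, one_mul]

/-- The weighted Young inequality for the factorization `|u₀| = |u₀|^{1/q} |u₀|^{1/q'}`, whose
factors are both measured by the `L¹` norm. -/
theorem eLpNorm_heatFlow_le_rpow_mul (q q' : ℝ≥0∞) [hqq : ENNReal.HolderConjugate q' q]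
    (hq' : q' ≠ ⊤) {u₀ : E d → ℝ} (hu : Measurable u₀) {t : ℝ} (ht : 0 < t) :
    eLpNorm (fun x => heatFlow u₀ (t, x)) q' volume ≤
      eLpNorm (fun z : E d => ENNReal.ofReal (gauss z)) q' volume * eLpNorm u₀ 1 volume *
        ENNReal.ofReal (t ^ (-halfExp d q)) := by
  have hG := (continuous_gauss (d := d)).measurable.ennreal_ofReal
  have hq1 : 1 ≤ q' := ENNReal.HolderConjugate.one_le q' q
  have hq0 : q' ≠ 0 := (zero_lt_one.trans_le hq1).ne'
  have hqq1 : 1 ≤ q := ENNReal.HolderConjugate.one_le q q'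
  have hqq0 : q ≠ 0 := (zero_lt_one.trans_le hqq1).ne'
  have hm0 : 0 < q'.toReal := ENNReal.toReal_pos hq0 hq'
  have hsum : q'⁻¹.toReal + q⁻¹.toReal = 1 := by
    rw [← ENNReal.toReal_add (by simpa using hq0) (by simpa using hqq0),
      ENNReal.HolderConjugate.inv_add_inv_eq_one, ENNReal.toReal_one]
  set N := eLpNorm u₀ 1 volume with hN
  have hN' : N = ∫⁻ x, ‖u₀ x‖ₑ := eLpNorm_one_eq_lintegral_enorm
  set f : E d → ℝ≥0∞ := fun x => ‖u₀ x‖ₑ ^ q⁻¹.toReal with hf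
  set v : E d → ℝ≥0∞ := fun x => ‖u₀ x‖ₑ ^ q'⁻¹.toReal with hv
  have h1 : eLpNorm (fun x => heatFlow u₀ (t, x)) q' volume ≤
      eLpNorm (fun x => ∫⁻ z, ENNReal.ofReal (gauss z) * f (x + √t • z) * v (x + √t • z)) q'
        volume := by
    refine eLpNorm_mono_enorm fun x => ?_
    rw [enorm_eq_self]
    refine (enorm_heatFlow_le u₀ (t, x)).trans (le_of_eq ?_)
    refine lintegral_congr fun z => ?_
    rw [mul_assoc]
    congr 1
    rw [hf, hv]
    simp only
    rw [← ENNReal.rpow_add_of_nonneg _ _ ENNReal.toReal_nonneg ENNReal.toReal_nonneg,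
      add_comm q⁻¹.toReal, hsum, ENNReal.rpow_one]
  have h2 := eLpNorm_lintegral_smul_le q q' q' hq' le_rfl (Real.sqrt_pos.2 ht) hG
    (hu.enorm.pow_const q⁻¹.toReal) (hu.enorm.pow_const q'⁻¹.toReal)
  rw [sqrt_rpow_halfExp ht] at h2
  have hNpow : ∀ {s : ℝ≥0∞}, s ≠ 0 → s ≠ ⊤ →
      eLpNorm (fun x => ‖u₀ x‖ₑ ^ s⁻¹.toReal) s volume = N ^ s⁻¹.toReal := by
    intro s h0 ht
    have hs := ENNReal.toReal_pos h0 ht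
    rw [eLpNorm_ennreal_of_ne_top h0 ht, hN', ENNReal.toReal_inv, one_div]
    simp_rw [← ENNReal.rpow_mul]
    rw [inv_mul_cancel₀ hs.ne']
    simp
  have h3 : eLpNorm f q volume ≤ N ^ q⁻¹.toReal := by
    -- For `q = ⊤` the exponent is zero and the factor is identically `1`, also where `u₀` vanishes.
    rcases eq_or_ne q ⊤ with rfl | hqt
    · rw [hf, eLpNorm_ennreal_top]
      simp only [ENNReal.inv_top, ENNReal.toReal_zero, ENNReal.rpow_zero]
      exact essSup_le_of_ae_le _ (Filter.Eventually.of_forall fun _ => le_rfl)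
    · exact (hNpow hqq0 hqt).le
  have h4 : eLpNorm v q' volume = N ^ q'⁻¹.toReal := hNpow hq0 hq'
  calc _ ≤ _ := h1.trans h2
    _ ≤ eLpNorm (fun z : E d => ENNReal.ofReal (gauss z)) q' volume *
        ENNReal.ofReal (t ^ (-halfExp d q)) * N ^ q⁻¹.toReal * N ^ q'⁻¹.toReal := by
        rw [← h4]; gcongr
    _ = eLpNorm (fun z : E d => ENNReal.ofReal (gauss z)) q' volume *
        ENNReal.ofReal (t ^ (-halfExp d q)) * (N ^ q⁻¹.toReal * N ^ q'⁻¹.toReal) := by ring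
    _ = _ := by
        rw [← ENNReal.rpow_add_of_nonneg _ _ ENNReal.toReal_nonneg ENNReal.toReal_nonneg, add_comm,
          hsum, ENNReal.rpow_one]
        ring

end Bounds

/-! ### Smoothness of superpositions of translates. -/

section Potential

variable {Ω P : Type} [MeasurableSpace Ω] {m : Measure Ω} [NormedAddCommGroup P]
  [MeasurableSpace P] [BorelSpace P] [SecondCountableTopology P]

/-- The superposition `p ↦ ∫ a(ξ) F(p - W(ξ)) dξ` of translates of `F`. -/
def potential {V : Type} [NormedAddCommGroup V] [NormedSpace ℝ V] (m : Measure Ω) (a : Ω → ℝ)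
    (W : Ω → P) (F : P → V) (p : P) : V := ∫ ξ, a ξ • F (p - W ξ) ∂m

variable {a : Ω → ℝ} {W : Ω → P}

theorem exists_norm_le_of_hasCompactSupport {P V : Type} [TopologicalSpace P] [NormedAddCommGroup V]
    {F : P → V} (hF : Continuous F) (hc : HasCompactSupport F) : ∃ C : ℝ, ∀ p, ‖F p‖ ≤ C :=
  hF.bounded_above_of_compact_support hc

theorem integrable_potential {V : Type} [NormedAddCommGroup V] [NormedSpace ℝ V]
    (ha : Integrable a m) (hW : Measurable W) {F : P → V}
    (hF : Continuous F) (hc : HasCompactSupport F) (p : P) :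
    Integrable (fun ξ => a ξ • F (p - W ξ)) m := by
  obtain ⟨C, hC⟩ := exists_norm_le_of_hasCompactSupport hF hc
  refine Integrable.smul_bdd (C := C) ha ?_ (Filter.Eventually.of_forall fun ξ => hC _)
  exact hF.stronglyMeasurable.aestronglyMeasurable.comp_measurable (measurable_const.sub hW)

variable [NormedSpace ℝ P]

theorem hasFDerivAt_potential {V : Type} [NormedAddCommGroup V] [NormedSpace ℝ V]
    (ha : Integrable a m) (hW : Measurable W) {F : P → V}
    (hF : ContDiff ℝ ∞ F) (hc : HasCompactSupport F) (p : P) :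
    HasFDerivAt (potential m a W F) (potential m a W (fderiv ℝ F) p) p := by
  have hF' : Continuous (fderiv ℝ F) := hF.continuous_fderiv (by simp)
  obtain ⟨C, hC⟩ := exists_norm_le_of_hasCompactSupport hF' (hc.fderiv (𝕜 := ℝ))
  refine hasFDerivAt_integral_of_dominated_of_fderiv_le (s := univ) (bound := fun ξ => ‖a ξ‖ * C)
    (F' := fun q ξ => a ξ • fderiv ℝ F (q - W ξ))
    Filter.univ_mem (Filter.Eventually.of_forall fun q =>
      (integrable_potential ha hW hF.continuous hc q).aestronglyMeasurable)
    (integrable_potential ha hW hF.continuous hc p)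
    (integrable_potential ha hW hF' (hc.fderiv (𝕜 := ℝ)) p).aestronglyMeasurable
    (Filter.Eventually.of_forall fun ξ q _ => ?_) (ha.norm.mul_const C)
    (Filter.Eventually.of_forall fun ξ q _ => ?_)
  · rw [norm_smul]
    exact mul_le_mul_of_nonneg_left (hC _) (norm_nonneg _)
  · have h1 : HasFDerivAt F (fderiv ℝ F (q - W ξ)) (q - W ξ) :=
      (hF.differentiable (by simp) _).hasFDerivAt
    exact (h1.comp q ((hasFDerivAt_id q).sub_const (W ξ))).const_smul (a ξ)

theorem contDiff_potential (ha : Integrable a m) (hW : Measurable W) {F : P → ℝ}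
    (hF : ContDiff ℝ ∞ F) (hc : HasCompactSupport F) : ContDiff ℝ ∞ (potential m a W F) := by
  -- The induction runs over all target spaces at once, since every derivative of `F` takes values
  -- in a new space.
  have key : ∀ (n : ℕ) (V : Type) [NormedAddCommGroup V] [NormedSpace ℝ V] (F : P → V),
      ContDiff ℝ ∞ F → HasCompactSupport F → ContDiff ℝ n (potential m a W F) := by
    intro n
    induction n with
    | zero =>
      intro V _ _ F hF hc
      have : Differentiable ℝ (potential m a W F) := fun p =>
        (hasFDerivAt_potential ha hW hF hc p).differentiableAt
      exact contDiff_zero.2 this.continuous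
    | succ n ih =>
      intro V _ _ F hF hc
      refine (contDiff_succ_iff_fderiv (n := n)).2 ⟨fun p =>
        (hasFDerivAt_potential ha hW hF hc p).differentiableAt, by simp, ?_⟩
      have : fderiv ℝ (potential m a W F) = potential m a W (fderiv ℝ F) := by
        ext1 p
        exact (hasFDerivAt_potential ha hW hF hc p).fderiv
      rw [this]
      exact ih _ _ (hF.fderiv_right (by simp)) (hc.fderiv (𝕜 := ℝ))
  exact contDiff_infty.2 fun n => key n ℝ F hF hc

theorem fderiv_potential_apply (ha : Integrable a m) (hW : Measurable W) {F : P → ℝ}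
    (hF : ContDiff ℝ ∞ F) (hc : HasCompactSupport F) (p v : P) :
    fderiv ℝ (potential m a W F) p v = potential m a W (fun q => fderiv ℝ F q v) p := by
  rw [(hasFDerivAt_potential ha hW hF hc p).fderiv, potential, potential,
    ContinuousLinearMap.integral_apply
      (integrable_potential ha hW (hF.continuous_fderiv (by simp)) (hc.fderiv (𝕜 := ℝ)) p)]
  rfl

end Potential

/-! ### Derivatives of test functions and the backward heat operator. -/

section TestFunctions

variable {d : ℕ}

theorem contDiff_fderiv_apply {P : Type} [NormedAddCommGroup P] [NormedSpace ℝ P] {F : P → ℝ}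
    (hF : ContDiff ℝ ∞ F) (v : P) : ContDiff ℝ ∞ fun q => fderiv ℝ F q v :=
  (hF.fderiv_right (by simp)).clm_apply contDiff_const

theorem hasCompactSupport_fderiv_apply {P : Type} [NormedAddCommGroup P] [NormedSpace ℝ P]
    {F : P → ℝ} (hc : HasCompactSupport F) (v : P) : HasCompactSupport fun q => fderiv ℝ F q v :=
  (hc.fderiv (𝕜 := ℝ)).comp_left (g := fun L : P →L[ℝ] ℝ => L v) rfl

/-- The `i`-th coordinate direction in space-time. -/
def spaceDir (i : Fin d) : ℝ × E d := (0, EuclideanSpace.single i 1)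

/-- The heat operator `∂_t + Δ` on functions of space-time. -/
def backwardHeat (F : ℝ × E d → ℝ) (p : ℝ × E d) : ℝ :=
  fderiv ℝ F p (1, 0) +
    ∑ i, fderiv ℝ (fun q => fderiv ℝ F q (spaceDir i)) p (spaceDir i)

theorem deriv_slice {F : ℝ × E d → ℝ} (hF : ContDiff ℝ ∞ F) (t : ℝ) (x : E d) :
    deriv (fun s => F (s, x)) t = fderiv ℝ F (t, x) (1, 0) := by
  have h1 : HasFDerivAt F (fderiv ℝ F (t, x)) (t, x) := (hF.differentiable (by simp) _).hasFDerivAt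
  have h2 : HasDerivAt (fun s : ℝ => (s, x)) ((1 : ℝ), (0 : E d)) t :=
    (hasDerivAt_id t).prodMk (hasDerivAt_const t x)
  exact (h1.comp_hasDerivAt t h2).deriv

theorem fderiv_slice {F : ℝ × E d → ℝ} (hF : ContDiff ℝ ∞ F) (t : ℝ) (x v : E d) :
    fderiv ℝ (fun y => F (t, y)) x v = fderiv ℝ F (t, x) (0, v) := by
  have h1 : HasFDerivAt F (fderiv ℝ F (t, x)) (t, x) := (hF.differentiable (by simp) _).hasFDerivAt
  have h2 : HasFDerivAt (fun y : E d => (t, y)) (ContinuousLinearMap.inr ℝ ℝ (E d)) x :=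
    hasFDerivAt_prodMk_right t x
  have h3 : HasFDerivAt (fun y => F (t, y)) _ x := h1.comp x h2
  rw [h3.fderiv]
  rfl

theorem inner_gradient_slice {F : ℝ × E d → ℝ} (hF : ContDiff ℝ ∞ F) (t : ℝ) (x v : E d) :
    inner ℝ v (gradient (fun y => F (t, y)) x) = fderiv ℝ F (t, x) (0, v) := by
  rw [real_inner_comm, gradient, InnerProductSpace.toDual_symm_apply, fderiv_slice hF]

theorem laplacian_slice {F : ℝ × E d → ℝ} (hF : ContDiff ℝ ∞ F) (t : ℝ) (x : E d) :
    (Δ fun y => F (t, y)) x =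
      ∑ i, fderiv ℝ (fun q => fderiv ℝ F q (spaceDir i)) (t, x) (spaceDir i) := by
  rw [InnerProductSpace.laplacian_eq_iteratedFDeriv_orthonormalBasis _
    (EuclideanSpace.basisFun (Fin d) ℝ)]
  refine Finset.sum_congr rfl fun i _ => ?_
  rw [iteratedFDeriv_two_apply]
  simp only [EuclideanSpace.basisFun_apply, Matrix.cons_val_zero, Matrix.cons_val_one]
  set e : E d := EuclideanSpace.single i 1
  have hg : ContDiff ℝ ∞ fun y : E d => F (t, y) := hF.comp (contDiff_prodMk_right t)
  have h1 : fderiv ℝ (fderiv ℝ fun y => F (t, y)) x e e =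
      fderiv ℝ (fun y => fderiv ℝ (fun y => F (t, y)) y e) x e := by
    have h2 : DifferentiableAt ℝ (fderiv ℝ fun y => F (t, y)) x :=
      (hg.fderiv_right (m := ∞) (by simp)).differentiable (by simp) x
    rw [fderiv_clm_apply h2 (differentiableAt_const e)]
    simp
  rw [h1]
  simp_rw [fderiv_slice hF t _ e]
  exact fderiv_slice (contDiff_fderiv_apply hF (spaceDir i)) t x e

theorem contDiff_backwardHeat {F : ℝ × E d → ℝ} (hF : ContDiff ℝ ∞ F) :
    ContDiff ℝ ∞ (backwardHeat F) := by
  unfold backwardHeat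
  exact (contDiff_fderiv_apply hF _).add (ContDiff.sum fun i _ =>
    contDiff_fderiv_apply (contDiff_fderiv_apply hF _) _)

theorem hasCompactSupport_backwardHeat {F : ℝ × E d → ℝ} (hc : HasCompactSupport F) :
    HasCompactSupport (backwardHeat F) := by
  refine hc.mono' fun p hp => ?_
  by_contra hn
  have h0 : F =ᶠ[nhds p] 0 := by
    rw [notMem_tsupport_iff_eventuallyEq] at hn; exact hn
  refine hp ?_
  have h1 : fderiv ℝ F =ᶠ[nhds p] fun _ => 0 := by
    have := h0.fderiv (𝕜 := ℝ)
    filter_upwards [this] with q hq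
    rw [hq]; simp
  unfold backwardHeat
  rw [h1.self_of_nhds]
  simp only [zero_apply, zero_add]
  refine Finset.sum_eq_zero fun i _ => ?_
  have h2 : (fun q => fderiv ℝ F q (spaceDir i)) =ᶠ[nhds p] fun _ => 0 := by
    filter_upwards [h1] with q hq
    rw [hq]; simp
  rw [h2.fderiv_eq]
  simp

theorem backwardHeat_potential {Ω : Type} [MeasurableSpace Ω] {m : Measure Ω} {a : Ω → ℝ}
    {W : Ω → ℝ × E d} (ha : Integrable a m) (hW : Measurable W) {F : ℝ × E d → ℝ}
    (hF : ContDiff ℝ ∞ F) (hc : HasCompactSupport F) (p : ℝ × E d) :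
    backwardHeat (potential m a W F) p = potential m a W (backwardHeat F) p := by
  have h1 : ∀ i : Fin d, (fun q => fderiv ℝ (potential m a W F) q (spaceDir i)) =
      potential m a W fun q => fderiv ℝ F q (spaceDir i) := fun i => by
    ext1 q
    exact fderiv_potential_apply ha hW hF hc q _
  unfold backwardHeat
  simp_rw [h1]
  rw [fderiv_potential_apply ha hW hF hc]
  simp_rw [fun i => fderiv_potential_apply ha hW (contDiff_fderiv_apply hF (spaceDir i))
    (hasCompactSupport_fderiv_apply hc _) p (spaceDir i)]
  unfold potential
  have h2 := fun v => integrable_potential ha hW (contDiff_fderiv_apply hF v).continuous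
    (hasCompactSupport_fderiv_apply hc v) p
  have h3 := fun i : Fin d => integrable_potential ha hW
    (contDiff_fderiv_apply (contDiff_fderiv_apply hF (spaceDir i)) (spaceDir i)).continuous
    (hasCompactSupport_fderiv_apply (hasCompactSupport_fderiv_apply hc (spaceDir i)) (spaceDir i)) p
  rw [← integral_finsetSum _ fun i _ => h3 i, ← integral_add (h2 _) (integrable_finsetSum _ fun i _ => h3 i)]
  refine integral_congr_ae (Filter.Eventually.of_forall fun ξ => ?_)
  simp only [smul_eq_mul]
  rw [mul_add, Finset.mul_sum]

end TestFunctions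

/-! ### Gaussian averages solve the heat equation. -/

section HeatIdentity

variable {d : ℕ}

theorem integrable_gauss_mul {f : E d → ℝ} (hf : Continuous f) {C : ℝ} (hC : ∀ z, ‖f z‖ ≤ C) :
    Integrable fun z => gauss z * f z :=
  integrable_gauss.mul_bdd (c := C) hf.aestronglyMeasurable (Filter.Eventually.of_forall hC)

/-- Integration by parts moves the derivative onto the Gaussian, whose gradient is `-z/2` times
itself; `c⁻¹` comes from the chain rule for `y - c z`. -/
theorem integral_gauss_mul_fderiv {f : E d → ℝ} (hf : ContDiff ℝ ∞ f) (hc : HasCompactSupport f)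
    (y v : E d) {c : ℝ} (h0 : 0 < c) :
    ∫ z, gauss z * fderiv ℝ f (y - c • z) v =
      c⁻¹ * ∫ z, (-(1 / 2) * gauss z * inner ℝ z v) * f (y - c • z) := by
  obtain ⟨C, hC⟩ := exists_norm_le_of_hasCompactSupport hf.continuous hc
  have hf' := contDiff_fderiv_apply hf v
  obtain ⟨C', hC'⟩ := exists_norm_le_of_hasCompactSupport hf'.continuous
    (hasCompactSupport_fderiv_apply hc v)
  have hs : Continuous fun z : E d => y - c • z := by fun_prop
  have hd : ∀ z, HasFDerivAt (fun z => f (y - c • z)) (-(c • fderiv ℝ f (y - c • z))) z := by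
    intro z
    have h1 : HasFDerivAt f (fderiv ℝ f (y - c • z)) (y - c • z) :=
      (hf.differentiable (by simp) _).hasFDerivAt
    have h2 : HasFDerivAt (fun z : E d => y - c • z) (-(c • ContinuousLinearMap.id ℝ (E d))) z :=
      ((hasFDerivAt_id z).const_smul c).const_sub y
    refine (h1.comp z h2).congr_fderiv ?_
    ext w
    simp
  have i1 : Integrable fun z => gauss z * fderiv ℝ f (y - c • z) v :=
    integrable_gauss_mul (hf'.continuous.comp hs) fun z => hC' _
  have hgrad : ∀ z : E d, ‖(-(1 / 2) * gauss z * inner ℝ z v : ℝ)‖ ≤ gaussDom z * ‖v‖ := by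
    intro z
    have h2 := norm_inner_le_norm (𝕜 := ℝ) z v
    have h3 := gaussGrad_le_gaussDom z
    rw [norm_mul, norm_mul, Real.norm_of_nonneg (gauss_pos z).le]
    have h4 : ‖(-(1 / 2) : ℝ)‖ = 1 / 2 := by norm_num
    rw [h4]
    calc 1 / 2 * gauss z * ‖(inner ℝ z v : ℝ)‖ ≤ 1 / 2 * gauss z * (‖z‖ * ‖v‖) := by
          have := (gauss_pos z).le
          gcongr
      _ = gaussGrad z * ‖v‖ := by unfold gaussGrad; ring
      _ ≤ _ := mul_le_mul_of_nonneg_right h3 (norm_nonneg v)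
  have i2 : Integrable fun z => (-(1 / 2) * gauss z * inner ℝ z v) * f (y - c • z) := by
    refine Integrable.mul_bdd (c := C) ?_ (hf.continuous.comp hs).aestronglyMeasurable
      (Filter.Eventually.of_forall fun z => hC _)
    refine (integrable_gaussDom.mul_const ‖v‖).mono' ?_ (Filter.Eventually.of_forall hgrad)
    exact ((continuous_gauss.const_mul _).mul (by fun_prop)).aestronglyMeasurable
  have h := integral_mul_fderiv_eq_neg_fderiv_mul_of_integrable (μ := (volume : Measure (E d)))
    (f := gauss) (g := fun z => f (y - c • z)) (v := v) ?_ ?_ ?_ ?_ ?_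
  · simp_rw [(hd _).fderiv, (hasFDerivAt_gauss _).fderiv] at h
    simp only [neg_apply, smul_apply, smul_eq_mul,
      innerSL_apply_apply, mul_neg, integral_neg, neg_inj] at h
    have h5 : ∀ z : E d, gauss z * (c * fderiv ℝ f (y - c • z) v) =
        c * (gauss z * fderiv ℝ f (y - c • z) v) := fun z => by ring
    simp_rw [h5, integral_const_mul] at h
    rw [← h, ← mul_assoc, inv_mul_cancel₀ h0.ne', one_mul]
  · simp_rw [(hasFDerivAt_gauss _).fderiv]
    simpa using i2
  · simp_rw [(hd _).fderiv]
    have := i1.const_mul (-c)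
    refine this.congr (Filter.Eventually.of_forall fun z => ?_)
    simp
    ring
  · exact integrable_gauss_mul (hf.continuous.comp hs) fun z => hC _
  · exact fun z _ => (hasFDerivAt_gauss z).differentiableAt
  · exact fun z _ => (hd z).differentiableAt

theorem norm_pair_le (s : ℝ) (v : E d) : ‖((s, v) : ℝ × E d)‖ ≤ ‖s‖ + ‖v‖ := by
  rw [Prod.norm_mk]
  exact max_le (le_add_of_nonneg_right (norm_nonneg _)) (le_add_of_nonneg_left (norm_nonneg _))

/-- Continuity, unlike the differentiation argument below, includes `τ = 0`, where the square root
is not differentiable. -/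
theorem continuous_integral_gauss_mul {f : ℝ × E d → ℝ} (hf : Continuous f)
    (hc : HasCompactSupport f) (s : ℝ) (y : E d) :
    Continuous fun τ : ℝ => ∫ z, gauss z * f (s + τ, y - √τ • z) := by
  obtain ⟨C, hC⟩ := exists_norm_le_of_hasCompactSupport hf hc
  refine continuous_of_dominated (bound := fun z => gauss z * C) (fun τ => ?_)
    (fun τ => Filter.Eventually.of_forall fun z => ?_) (integrable_gauss.mul_const C)
    (Filter.Eventually.of_forall fun z => ?_)
  · exact (continuous_gauss.mul (hf.comp (by fun_prop))).aestronglyMeasurable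
  · rw [norm_mul, Real.norm_of_nonneg (gauss_pos z).le]
    exact mul_le_mul_of_nonneg_left (hC _) (gauss_pos z).le
  · exact continuous_const.mul (hf.comp (by fun_prop))

/-- In the variable `z` the Gaussian is fixed. Differentiating `√τ` produces `-(2√τ)⁻¹ z · ∇F`, and
an integration by parts turns this into the Laplacian. -/
theorem hasDerivAt_integral_gauss_mul {F : ℝ × E d → ℝ} (hF : ContDiff ℝ ∞ F)
    (hc : HasCompactSupport F) (s : ℝ) (y : E d) {τ : ℝ} (hτ : 0 < τ) :
    HasDerivAt (fun τ : ℝ => ∫ z, gauss z * F (s + τ, y - √τ • z))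
      (∫ z, gauss z * backwardHeat F (s + τ, y - √τ • z)) τ := by
  obtain ⟨C, hC⟩ := exists_norm_le_of_hasCompactSupport hF.continuous hc
  have hF' : Continuous (fderiv ℝ F) := hF.continuous_fderiv (by simp)
  obtain ⟨C', hC'⟩ := exists_norm_le_of_hasCompactSupport hF' (hc.fderiv (𝕜 := ℝ))
  have hC0 : 0 ≤ C' := (norm_nonneg _).trans (hC' 0)
  have hsq : 0 < √(τ / 2) := Real.sqrt_pos.2 (by linarith)
  have hshift : ∀ τ : ℝ, Continuous fun z : E d => (s + τ, y - √τ • z) := fun τ => by fun_prop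
  have hderiv := hasDerivAt_integral_of_dominated_loc_of_deriv_le (μ := (volume : Measure (E d)))
    (F := fun τ z => gauss z * F (s + τ, y - √τ • z))
    (F' := fun τ z => gauss z * fderiv ℝ F (s + τ, y - √τ • z) (1, -((1 / (2 * √τ)) • z)))
    -- Staying above `τ / 2` keeps the factor `1 / √σ` bounded.
    (x₀ := τ) (s := Ioi (τ / 2)) (bound := fun z => C' * (1 + 1 / (2 * √(τ / 2))) * gaussDom z)
    (Ioi_mem_nhds (by linarith))
    (Filter.Eventually.of_forall fun τ =>
      (continuous_gauss.mul (hF.continuous.comp (hshift τ))).aestronglyMeasurable)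
    (integrable_gauss_mul (hF.continuous.comp (hshift τ)) fun z => hC _) ?_ ?_
    (integrable_gaussDom.const_mul _) ?_
  rotate_left
  · refine (continuous_gauss.mul ?_).aestronglyMeasurable
    exact (hF'.comp (hshift τ)).clm_apply (by fun_prop)
  · refine Filter.Eventually.of_forall fun z σ hσ => ?_
    have hσ0 : √(τ / 2) ≤ √σ := Real.sqrt_le_sqrt (le_of_lt hσ)
    have h1 := (fderiv ℝ F (s + σ, y - √σ • z)).le_of_opNorm_le (hC' _)
      ((1 : ℝ), -((1 / (2 * √σ)) • z))
    have h2 : ‖((1 : ℝ), -((1 / (2 * √σ)) • z))‖ ≤ (1 + 1 / (2 * √(τ / 2))) * (1 + ‖z‖) := by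
      refine (norm_pair_le _ _).trans ?_
      have hσ1 : 0 < √σ := hsq.trans_le hσ0
      rw [norm_one, norm_neg, norm_smul, Real.norm_of_nonneg (by positivity)]
      have h3 : 1 / (2 * √σ) ≤ 1 / (2 * √(τ / 2)) := by gcongr
      have h4 : 0 < 1 / (2 * √(τ / 2)) := by positivity
      nlinarith [norm_nonneg z]
    rw [norm_mul, Real.norm_of_nonneg (gauss_pos z).le]
    have h5 : (1 + ‖z‖) * gauss z ≤ gaussDom z := by
      refine le_trans ?_ (one_add_norm_mul_gauss_mul_exp_le z)
      exact le_mul_of_one_le_right (mul_nonneg (by positivity) (gauss_pos z).le)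
        (Real.one_le_exp (norm_nonneg z))
    calc gauss z * ‖fderiv ℝ F (s + σ, y - √σ • z) (1, -((1 / (2 * √σ)) • z))‖
        ≤ gauss z * (C' * ((1 + 1 / (2 * √(τ / 2))) * (1 + ‖z‖))) := by
          refine mul_le_mul_of_nonneg_left (h1.trans ?_) (gauss_pos z).le
          exact mul_le_mul_of_nonneg_left h2 hC0
      _ = C' * (1 + 1 / (2 * √(τ / 2))) * ((1 + ‖z‖) * gauss z) := by ring
      _ ≤ _ := mul_le_mul_of_nonneg_left h5 (by positivity)
  · refine Filter.Eventually.of_forall fun z σ hσ => ?_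
    have hσ1 : 0 < σ := lt_trans (by linarith) (mem_Ioi.1 hσ)
    have h1 : HasFDerivAt F (fderiv ℝ F (s + σ, y - √σ • z)) (s + σ, y - √σ • z) :=
      (hF.differentiable (by simp) _).hasFDerivAt
    have h2 : HasDerivAt (fun σ : ℝ => (s + σ, y - √σ • z)) ((1 : ℝ), -((1 / (2 * √σ)) • z)) σ := by
      refine HasDerivAt.prodMk ((hasDerivAt_id σ).const_add s) ?_
      exact ((Real.hasDerivAt_sqrt hσ1.ne').smul_const z).const_sub y
    exact (h1.comp_hasDerivAt σ h2).const_mul _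
  · refine hderiv.2.congr_deriv ?_
    have hsτ : 0 < √τ := Real.sqrt_pos.2 hτ
    set f : E d → ℝ := fun x => F (s + τ, x) with hfdef
    have hf : ContDiff ℝ ∞ f := hF.comp (contDiff_prodMk_right _)
    have hfc : HasCompactSupport f := by
      refine HasCompactSupport.intro (hc.isCompact.image continuous_snd) fun x hx => ?_
      by_contra hne
      exact hx ⟨(s + τ, x), subset_tsupport _ hne, rfl⟩
    have hi : ∀ i : Fin d, ∫ z, gauss z *
        fderiv ℝ (fun q => fderiv ℝ F q (spaceDir i)) (s + τ, y - √τ • z) (spaceDir i) =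
        (√τ)⁻¹ * ∫ z, (-(1 / 2) * gauss z * inner ℝ z (EuclideanSpace.single i (1 : ℝ))) *
          fderiv ℝ F (s + τ, y - √τ • z) (spaceDir i) := by
      intro i
      have h := integral_gauss_mul_fderiv
        (contDiff_fderiv_apply hf (EuclideanSpace.single i (1 : ℝ)))
        (hasCompactSupport_fderiv_apply hfc _) y (EuclideanSpace.single i (1 : ℝ)) hsτ
      have e1 : (fun x => fderiv ℝ f x (EuclideanSpace.single i (1 : ℝ))) =
          fun x => fderiv ℝ F (s + τ, x) (spaceDir i) := by
        ext x
        exact fderiv_slice hF _ _ _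
      have e2 : ∀ x, fderiv ℝ f x (EuclideanSpace.single i (1 : ℝ)) =
          fderiv ℝ F (s + τ, x) (spaceDir i) := fun x => congrFun e1 x
      rw [e1] at h
      simp_rw [fderiv_slice (contDiff_fderiv_apply hF (spaceDir i)), e2] at h
      exact h
    have hcont : ∀ v, Continuous fun z : E d => fderiv ℝ F (s + τ, y - √τ • z) v := fun v =>
      (contDiff_fderiv_apply hF v).continuous.comp (hshift τ)
    have hb : ∀ v, ∃ K, ∀ q, ‖fderiv ℝ F q v‖ ≤ K := fun v =>
      exists_norm_le_of_hasCompactSupport (contDiff_fderiv_apply hF v).continuous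
        (hasCompactSupport_fderiv_apply hc v)
    have j1 : Integrable fun z => gauss z * fderiv ℝ F (s + τ, y - √τ • z) (1, 0) := by
      obtain ⟨K, hK⟩ := hb (1, 0)
      exact integrable_gauss_mul (hcont _) fun z => hK _
    have j2 : ∀ i : Fin d, Integrable fun z => gauss z *
        fderiv ℝ (fun q => fderiv ℝ F q (spaceDir i)) (s + τ, y - √τ • z) (spaceDir i) := by
      intro i
      obtain ⟨K, hK⟩ := exists_norm_le_of_hasCompactSupport
        (contDiff_fderiv_apply (contDiff_fderiv_apply hF (spaceDir i)) (spaceDir i)).continuous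
        (hasCompactSupport_fderiv_apply (hasCompactSupport_fderiv_apply hc (spaceDir i))
          (spaceDir i))
      exact integrable_gauss_mul ((contDiff_fderiv_apply (contDiff_fderiv_apply hF (spaceDir i))
        (spaceDir i)).continuous.comp (hshift τ)) fun z => hK _
    have j3 : ∀ i : Fin d, Integrable fun z : E d =>
        (-(1 / 2) * gauss z * inner ℝ z (EuclideanSpace.single i (1 : ℝ))) *
          fderiv ℝ F (s + τ, y - √τ • z) (spaceDir i) := by
      intro i
      obtain ⟨K, hK⟩ := hb (spaceDir i)
      refine Integrable.mul_bdd (c := K) ?_ (hcont _).aestronglyMeasurable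
        (Filter.Eventually.of_forall fun z => hK _)
      refine integrable_gaussGrad.mono' ?_ (Filter.Eventually.of_forall fun z => ?_)
      · exact ((continuous_gauss.const_mul _).mul (by fun_prop)).aestronglyMeasurable
      · have h2 := norm_inner_le_norm (𝕜 := ℝ) z (EuclideanSpace.single i (1 : ℝ))
        rw [PiLp.norm_single, norm_one, mul_one] at h2
        rw [norm_mul, norm_mul, Real.norm_of_nonneg (gauss_pos z).le]
        have h4 : ‖(-(1 / 2) : ℝ)‖ = 1 / 2 := by norm_num
        rw [h4, gaussGrad]
        nlinarith [gauss_pos z]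
    have hR : ∫ z, gauss z * backwardHeat F (s + τ, y - √τ • z) =
        (∫ z, gauss z * fderiv ℝ F (s + τ, y - √τ • z) (1, 0)) + ∑ i, ∫ z, gauss z *
        fderiv ℝ (fun q => fderiv ℝ F q (spaceDir i)) (s + τ, y - √τ • z) (spaceDir i) := by
      rw [← integral_finsetSum _ fun i _ => j2 i,
        ← integral_add j1 (integrable_finsetSum _ fun i _ => j2 i)]
      refine integral_congr_ae (Filter.Eventually.of_forall fun z => ?_)
      simp only [backwardHeat]
      rw [mul_add, Finset.mul_sum]
    rw [hR]
    simp_rw [hi, ← integral_const_mul]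
    rw [← integral_finsetSum _ fun i _ => (j3 i).const_mul _,
      ← integral_add j1 (integrable_finsetSum _ fun i _ => (j3 i).const_mul _)]
    refine integral_congr_ae (Filter.Eventually.of_forall fun z => ?_)
    simp only
    have hz : ((1 : ℝ), -((1 / (2 * √τ)) • z)) =
        (1, 0) + ∑ i, (-(1 / (2 * √τ)) * z i) • (spaceDir i : ℝ × E d) := by
      refine Prod.ext ?_ ?_
      · simp [spaceDir, Prod.fst_sum]
      · simp only [spaceDir, Prod.snd_add, Prod.snd_sum, Prod.smul_snd, zero_add]
        ext j
        simp [Finset.sum_apply, Pi.single_apply]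
    rw [hz, map_add, map_sum, mul_add, Finset.mul_sum]
    congr 1
    refine Finset.sum_congr rfl fun i _ => ?_
    rw [map_smul, smul_eq_mul]
    have h6 : inner ℝ z (EuclideanSpace.single i (1 : ℝ)) = z i := by
      simp [EuclideanSpace.inner_single_right]
    rw [h6]
    field_simp

/-- Fundamental theorem of calculus in `τ`: the endpoint `0` returns `F` because the Gaussian has
mass one, and the endpoint `1` contributes nothing. -/
theorem integral_gauss_mul_backwardHeat {F : ℝ × E d → ℝ} (hF : ContDiff ℝ ∞ F)
    (hc : HasCompactSupport F) {s : ℝ} (y : E d) (h1 : ∀ x, F (s + 1, x) = 0) :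
    ∫ τ in Ioo (0 : ℝ) 1, ∫ z, gauss z * backwardHeat F (s + τ, y - √τ • z) = - F (s, y) := by
  rw [← integral_Ioc_eq_integral_Ioo, ← intervalIntegral.integral_of_le zero_le_one]
  rw [intervalIntegral.integral_eq_sub_of_hasDerivAt_of_le zero_le_one
    (continuous_integral_gauss_mul hF.continuous hc s y).continuousOn
    (fun τ hτ => hasDerivAt_integral_gauss_mul hF hc s y hτ.1)
    ((continuous_integral_gauss_mul (contDiff_backwardHeat hF).continuous
      (hasCompactSupport_backwardHeat hc) s y).intervalIntegrable _ _)]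
  simp [h1, integral_mul_const, integral_gauss]

end HeatIdentity

/-! ### Backward heat potentials and their duality with the forward operators. -/

section MildFormula

variable {d : ℕ}

instance (d : ℕ) : (volume : Measure (ℝ × E d)).IsAddRightInvariant :=
  inferInstanceAs ((volume : Measure ℝ).prod (volume : Measure (E d))).IsAddRightInvariant

/-- The space-time displacement of the heat flow. -/
def heatShift (w : ℝ × E d) : ℝ × E d := (-w.1, √w.1 • w.2)

theorem measurable_heatShift : Measurable (heatShift : ℝ × E d → ℝ × E d) := by
  unfold heatShift; fun_prop

theorem sub_heatShift (p w : ℝ × E d) : p - heatShift w = (p.1 + w.1, p.2 - √w.1 • w.2) := by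
  simp [heatShift, Prod.ext_iff]

theorem add_heatShift (p w : ℝ × E d) : p + heatShift w = (p.1 - w.1, p.2 + √w.1 • w.2) := by
  simp [heatShift, Prod.ext_iff, sub_eq_add_neg]

theorem exp_neg_norm_sub_heatShift_le (p : ℝ × E d) {w : ℝ × E d} (hw : w.1 ≤ 1) :
    Real.exp (-‖(p - heatShift w).2‖) ≤ Real.exp (-‖p.2‖) * Real.exp ‖w.2‖ := by
  rw [sub_heatShift, ← Real.exp_add]
  refine Real.exp_le_exp.2 ?_
  have h1 : ‖√w.1 • w.2‖ ≤ ‖w.2‖ := by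
    rw [norm_smul, Real.norm_of_nonneg (Real.sqrt_nonneg _)]
    have : √w.1 ≤ 1 := by rw [Real.sqrt_le_one]; exact hw
    nlinarith [norm_nonneg w.2]
  have h2 := norm_sub_norm_le p.2 (√w.1 • w.2)
  simp only
  linarith

theorem exists_norm_le_mul_exp {V : Type} [NormedAddCommGroup V] [NormedSpace ℝ V]
    {f : ℝ × E d → V} (hf : Continuous f) (hc : HasCompactSupport f) :
    ∃ C : ℝ, 0 ≤ C ∧ ∀ p, ‖f p‖ ≤ C * Real.exp (-‖p.2‖) := by
  obtain ⟨C, hC⟩ := exists_norm_le_of_hasCompactSupport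
    (F := fun p : ℝ × E d => Real.exp ‖p.2‖ • f p) (by fun_prop) hc.smul_left
  refine ⟨C, (norm_nonneg _).trans (hC 0), fun p => ?_⟩
  have := hC p
  rw [norm_smul, Real.norm_of_nonneg (Real.exp_pos _).le] at this
  rw [Real.exp_neg, ← div_eq_mul_inv, le_div_iff₀ (Real.exp_pos _), mul_comm]
  exact this

theorem integrable_snd_heatMeasure {f : E d → ℝ} (hf : Integrable f) :
    Integrable (fun w : ℝ × E d => f w.2) (heatMeasure d) := by
  have h := (integrable_const (μ := volume.restrict (Ioo (0 : ℝ) 1)) (1 : ℝ)).mul_prod hf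
  simpa using h

/-- Truncations of `gauss` as functions of `(τ, z)`. -/
def gaussTrunc (n : ℕ) (w : ℝ × E d) : ℝ :=
  ((Ioo (0 : ℝ) 1) ×ˢ Metric.closedBall (0 : E d) n).indicator (fun w => gauss w.2) w

theorem gaussTrunc_nonneg (n : ℕ) (w : ℝ × E d) : 0 ≤ gaussTrunc n w :=
  indicator_nonneg (fun w _ => (gauss_pos w.2).le) w

theorem gaussTrunc_le (n : ℕ) (w : ℝ × E d) : gaussTrunc n w ≤ gauss w.2 :=
  indicator_le_self' (fun w _ => (gauss_pos w.2).le) w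

theorem integrable_gaussTrunc (n : ℕ) :
    Integrable (gaussTrunc n : ℝ × E d → ℝ) (heatMeasure d) :=
  (integrable_snd_heatMeasure integrable_gauss).indicator
    (measurableSet_Ioo.prod measurableSet_closedBall)

theorem tendsto_gaussTrunc {w : ℝ × E d} (hw : 0 < w.1 ∧ w.1 < 1) :
    Filter.Tendsto (fun n => gaussTrunc n w) Filter.atTop (nhds (gauss w.2)) := by
  refine tendsto_const_nhds.congr' ?_
  obtain ⟨N, hN⟩ := exists_nat_ge ‖w.2‖
  filter_upwards [Filter.eventually_ge_atTop N] with n hn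
  rw [gaussTrunc, indicator_of_mem]
  refine ⟨hw, ?_⟩
  rw [mem_closedBall_zero_iff]
  exact hN.trans (by exact_mod_cast hn)

theorem exists_ne_of_potential_ne_zero {Ω P : Type} [MeasurableSpace Ω] {m : Measure Ω}
    [NormedAddCommGroup P] {a : Ω → ℝ} {W : Ω → P} {F : P → ℝ} {p : P}
    (h : potential m a W F p ≠ 0) : ∃ ξ, a ξ ≠ 0 ∧ F (p - W ξ) ≠ 0 := by
  by_contra hn
  push Not at hn
  refine h ?_
  unfold potential
  rw [← integral_zero Ω ℝ (μ := m)]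
  refine integral_congr_ae (Filter.Eventually.of_forall fun ξ => ?_)
  by_cases h0 : a ξ = 0
  · simp [h0]
  · simp [hn ξ h0]

/-- The full potential has Gaussian tails and is not an admissible test function. Where the
truncated kernel lives, displacements have norm at most `n + 1`. -/
theorem hasCompactSupport_potential_gaussTrunc (n : ℕ) {F : ℝ × E d → ℝ}
    (hc : HasCompactSupport F) :
    HasCompactSupport (potential (heatMeasure d) (gaussTrunc n) heatShift F) := by
  refine HasCompactSupport.intro
    (hc.isCompact.add (isCompact_closedBall (0 : ℝ × E d) (n + 1))) fun p hp => ?_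
  by_contra hne
  obtain ⟨w, h1, h2⟩ := exists_ne_of_potential_ne_zero hne
  have hw := mem_of_indicator_ne_zero h1
  refine hp ?_
  rw [← sub_add_cancel p (heatShift w)]
  refine Set.add_mem_add (subset_tsupport _ h2) ?_
  rw [mem_closedBall_zero_iff]
  have hz := hw.2
  rw [mem_closedBall_zero_iff] at hz
  have h3 : √w.1 ≤ 1 := by rw [Real.sqrt_le_one]; exact hw.1.2.le
  have hn : (0 : ℝ) ≤ n := Nat.cast_nonneg n
  rw [heatShift, Prod.norm_mk, norm_neg, norm_smul, Real.norm_of_nonneg hw.1.1.le,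
    Real.norm_of_nonneg (Real.sqrt_nonneg _)]
  refine max_le (by linarith [hw.1.2]) ?_
  nlinarith [norm_nonneg w.2, Real.sqrt_nonneg w.1]

/-- Displacements lead backward in time, and the compact support of `F` ends at some `T < 1`; this
strict gap survives the closure. -/
theorem tsupport_potential_gaussTrunc_subset (n : ℕ) {F : ℝ × E d → ℝ}
    (hc : HasCompactSupport F) (hs : tsupport F ⊆ Ioo 0 1 ×ˢ univ) :
    tsupport (potential (heatMeasure d) (gaussTrunc n) heatShift F) ⊆ Iio 1 ×ˢ univ := by
  obtain ⟨T, hT1, hT⟩ : ∃ T < (1 : ℝ), ∀ p ∈ tsupport F, p.1 ≤ T := by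
    rcases (tsupport F).eq_empty_or_nonempty with h | h
    · exact ⟨0, by norm_num, by simp [h]⟩
    · obtain ⟨p, hp, hmax⟩ := hc.isCompact.exists_isMaxOn h continuous_fst.continuousOn
      exact ⟨p.1, (hs hp).1.2, fun q hq => hmax hq⟩
  have h1 : tsupport (potential (heatMeasure d) (gaussTrunc n) heatShift F) ⊆ {p | p.1 ≤ T} := by
    refine closure_minimal (fun p hp => ?_) (isClosed_le continuous_fst continuous_const)
    obtain ⟨w, h1, h2⟩ := exists_ne_of_potential_ne_zero hp
    have hw := mem_of_indicator_ne_zero h1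
    have h3 := hT _ (subset_tsupport _ h2)
    rw [sub_heatShift] at h3
    simp only at h3
    have := hw.1.1
    change p.1 ≤ T
    linarith
  exact fun p hp => ⟨(h1 hp).trans_lt hT1, mem_univ _⟩

theorem norm_gauss_smul_le {f : ℝ × E d → ℝ} {C : ℝ}
    (hC : ∀ p, ‖f p‖ ≤ C * Real.exp (-‖p.2‖)) (h0 : 0 ≤ C) (p : ℝ × E d) {w : ℝ × E d}
    (hw : 0 < w.1 ∧ w.1 < 1) {a : ℝ} (ha0 : 0 ≤ a) (ha : a ≤ gauss w.2) :
    ‖a • f (p - heatShift w)‖ ≤ C * Real.exp (-‖p.2‖) * gaussDom w.2 := by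
  rw [norm_smul, Real.norm_of_nonneg ha0]
  have h1 := exp_neg_norm_sub_heatShift_le p hw.2.le
  calc a * ‖f (p - heatShift w)‖
      ≤ gauss w.2 * (C * (Real.exp (-‖p.2‖) * Real.exp ‖w.2‖)) := by
        refine mul_le_mul ha ((hC _).trans ?_) (norm_nonneg _) (gauss_pos _).le
        exact mul_le_mul_of_nonneg_left h1 h0
    _ = C * Real.exp (-‖p.2‖) * (gauss w.2 * Real.exp ‖w.2‖) := by ring
    _ ≤ _ := by
        refine mul_le_mul_of_nonneg_left (gauss_mul_exp_le _) ?_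
        exact mul_nonneg h0 (Real.exp_pos _).le

theorem norm_potential_gaussTrunc_le (n : ℕ) {f : ℝ × E d → ℝ} {C : ℝ}
    (hC : ∀ p, ‖f p‖ ≤ C * Real.exp (-‖p.2‖)) (h0 : 0 ≤ C) (p : ℝ × E d) :
    ‖potential (heatMeasure d) (gaussTrunc n) heatShift f p‖ ≤
      C * Real.exp (-‖p.2‖) * ∫ w, gaussDom w.2 ∂heatMeasure d := by
  rw [← integral_const_mul]
  refine norm_integral_le_of_norm_le
    ((integrable_snd_heatMeasure integrable_gaussDom).const_mul _) ?_
  filter_upwards [ae_heatMeasure_pos] with w hw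
  exact norm_gauss_smul_le hC h0 p hw (gaussTrunc_nonneg n w) (gaussTrunc_le n w)

theorem tendsto_potential_gaussTrunc {f : ℝ × E d → ℝ} (hf : Continuous f)
    (hc : HasCompactSupport f) (p : ℝ × E d) :
    Filter.Tendsto (fun n => potential (heatMeasure d) (gaussTrunc n) heatShift f p) Filter.atTop
      (nhds (potential (heatMeasure d) (fun w => gauss w.2) heatShift f p)) := by
  obtain ⟨C, h0, hC⟩ := exists_norm_le_mul_exp hf hc
  refine tendsto_integral_of_dominated_convergence
    (fun w => C * Real.exp (-‖p.2‖) * gaussDom w.2)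
    (fun n => (integrable_potential (integrable_gaussTrunc n) measurable_heatShift hf hc
      p).aestronglyMeasurable)
    ((integrable_snd_heatMeasure integrable_gaussDom).const_mul _) (fun n => ?_) ?_
  · filter_upwards [ae_heatMeasure_pos] with w hw
    exact norm_gauss_smul_le hC h0 p hw (gaussTrunc_nonneg n w) (gaussTrunc_le n w)
  · filter_upwards [ae_heatMeasure_pos] with w hw
    exact (tendsto_gaussTrunc hw).smul_const _

theorem potential_gauss_eq_integral {f : ℝ × E d → ℝ} (hf : Continuous f)
    (hc : HasCompactSupport f) (p : ℝ × E d) :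
    potential (heatMeasure d) (fun w => gauss w.2) heatShift f p =
      ∫ τ in Ioo (0 : ℝ) 1, ∫ z, gauss z * f (p.1 + τ, p.2 - √τ • z) := by
  have hi := integrable_potential (integrable_snd_heatMeasure (d := d) integrable_gauss)
    measurable_heatShift hf hc p
  unfold potential
  rw [integral_prod _ hi]
  simp_rw [sub_heatShift, smul_eq_mul]

/-- For `p.1 ≥ 0` the time `p.1 + 1` lies beyond the support of `F`, which removes the boundary
term. Thus the potential of `F` solves the backward heat equation with source `-F`. -/
theorem potential_gauss_backwardHeat {F : ℝ × E d → ℝ} (hF : ContDiff ℝ ∞ F)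
    (hc : HasCompactSupport F) (hs : tsupport F ⊆ Ioo 0 1 ×ˢ univ) {p : ℝ × E d} (hp : 0 ≤ p.1) :
    potential (heatMeasure d) (fun w => gauss w.2) heatShift (backwardHeat F) p = - F p := by
  rw [potential_gauss_eq_integral (contDiff_backwardHeat hF).continuous
    (hasCompactSupport_backwardHeat hc)]
  refine integral_gauss_mul_backwardHeat hF hc p.2 fun x => ?_
  by_contra hne
  have := (hs (subset_tsupport _ hne)).1.2
  simp only at this
  linarith

/-- The kernel of `duhamel`. -/
def duhamelKer (b : E d) (w : ℝ × E d) : ℝ :=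
  w.1 ^ (-(1 / 2) : ℝ) * (-(1 / 2) * gauss w.2 * inner ℝ w.2 b)

theorem duhamel_eq (b : ℝ × E d → E d) (v : ℝ × E d → ℝ) (p : ℝ × E d) :
    duhamel b v p =
      ∫ w, duhamelKer (b (p + heatShift w)) w * v (p + heatShift w) ∂heatMeasure d := by
  simp_rw [add_heatShift]; rfl

theorem duhamelMaj_eq_heatShift (B v : ℝ × E d → ℝ≥0∞) (p : ℝ × E d) :
    duhamelMaj B v p = ∫⁻ w, ENNReal.ofReal (w.1 ^ (-(1 / 2) : ℝ) * gaussGrad w.2) *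
      B (p + heatShift w) * v (p + heatShift w) ∂heatMeasure d := by
  simp_rw [add_heatShift]; rfl

theorem norm_duhamelKer_le (b : E d) {w : ℝ × E d} (hw : 0 ≤ w.1) :
    ‖duhamelKer b w‖ ≤ w.1 ^ (-(1 / 2) : ℝ) * gaussGrad w.2 * ‖b‖ := by
  have h1 : 0 ≤ w.1 ^ (-(1 / 2) : ℝ) := Real.rpow_nonneg hw _
  rw [duhamelKer, norm_mul, Real.norm_of_nonneg h1, norm_mul, norm_mul,
    Real.norm_of_nonneg (gauss_pos _).le, gaussGrad]
  refine le_trans (mul_le_mul_of_nonneg_left ?_ h1) (le_of_eq (mul_assoc _ _ _).symm)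
  have h2 := norm_inner_le_norm (𝕜 := ℝ) w.2 b
  have h3 : ‖(-(1 / 2) : ℝ)‖ = 1 / 2 := by norm_num
  rw [h3]
  nlinarith [gauss_pos w.2]

theorem measurable_duhamelKer : Measurable fun y : E d × (ℝ × E d) => duhamelKer y.1 y.2 := by
  unfold duhamelKer
  have h3 := (continuous_gauss (d := d)).measurable
  refine Measurable.mul (by fun_prop) (Measurable.mul ?_ ?_)
  · exact (h3.comp (measurable_snd.comp measurable_snd)).const_mul _
  · exact Measurable.inner (measurable_snd.comp measurable_snd) measurable_fst

theorem integrable_rpow_mul_gaussDom :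
    Integrable (fun w : ℝ × E d => w.1 ^ (-(1 / 2) : ℝ) * gaussDom w.2) (heatMeasure d) := by
  have h2 : IntegrableOn (fun τ : ℝ => τ ^ (-(1 / 2) : ℝ)) (Ioo 0 1) volume :=
    (intervalIntegral.integrableOn_Ioo_rpow_iff one_pos).2 (by norm_num)
  exact Integrable.mul_prod h2 integrable_gaussDom

theorem integrable_duhamelKer (b : E d) : Integrable (duhamelKer b) (heatMeasure d) := by
  refine (integrable_rpow_mul_gaussDom.mul_const ‖b‖).mono'
    (measurable_duhamelKer.comp measurable_prodMk_left).aestronglyMeasurable ?_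
  filter_upwards [ae_heatMeasure_pos] with w hw
  refine (norm_duhamelKer_le b hw.1.le).trans ?_
  have h1 : 0 ≤ w.1 ^ (-(1 / 2) : ℝ) := Real.rpow_nonneg hw.1.le _
  gcongr
  exact gaussGrad_le_gaussDom _

/-- Once moved onto the Gaussian, the derivative gives the Duhamel kernel; `(√τ)⁻¹` is the origin of
`τ ^ (-1/2)`. The vector `b` is frozen here and later becomes the value of the drift at `p`. -/
theorem potential_gauss_fderiv {F : ℝ × E d → ℝ} (hF : ContDiff ℝ ∞ F)
    (hc : HasCompactSupport F) (p : ℝ × E d) (b : E d) :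
    potential (heatMeasure d) (fun w => gauss w.2) heatShift (fun q => fderiv ℝ F q (0, b)) p =
      ∫ w, duhamelKer b w * F (p - heatShift w) ∂heatMeasure d := by
  have hi := integrable_potential (integrable_duhamelKer b) measurable_heatShift hF.continuous hc p
  have hi' : Integrable (fun w => duhamelKer b w * F (p - heatShift w)) (heatMeasure d) := hi
  rw [potential_gauss_eq_integral (contDiff_fderiv_apply hF _).continuous
    (hasCompactSupport_fderiv_apply hc _), integral_prod _ hi']
  refine setIntegral_congr_fun measurableSet_Ioo fun τ hτ => ?_
  beta_reduce
  set f : E d → ℝ := fun x => F (p.1 + τ, x) with hfdef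
  have hf : ContDiff ℝ ∞ f := hF.comp (contDiff_prodMk_right _)
  have hfc : HasCompactSupport f := by
    refine HasCompactSupport.intro (hc.isCompact.image continuous_snd) fun x hx => ?_
    by_contra hne
    exact hx ⟨(p.1 + τ, x), subset_tsupport _ hne, rfl⟩
  have h := integral_gauss_mul_fderiv hf hfc p.2 b (Real.sqrt_pos.2 hτ.1)
  simp_rw [hfdef, fderiv_slice hF] at h
  rw [h, ← integral_const_mul]
  refine integral_congr_ae (Filter.Eventually.of_forall fun z => ?_)
  simp only [duhamelKer, sub_heatShift]
  have : (√τ)⁻¹ = τ ^ (-(1 / 2) : ℝ) := by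
    rw [Real.rpow_neg hτ.1.le, Real.sqrt_eq_rpow]
  rw [this]
  ring

/-- Tonelli and a translation by the displacement; the weight then changes by at most `exp ‖z‖`,
which `gaussDom` absorbs. -/
theorem lintegral_duhamelMaj_mul_exp_lt_top {b : ℝ × E d → E d} {u : ℝ × E d → ℝ}
    (hb : Measurable b) (hu : Measurable u)
    (hI : ∫⁻ p : ℝ × E d, ‖b p‖ₑ * ‖u p‖ₑ * ENNReal.ofReal (Real.exp (-‖p.2‖)) < ⊤) :
    ∫⁻ p : ℝ × E d, duhamelMaj (fun y => ‖b y‖ₑ) (fun y => ‖u y‖ₑ) p *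
      ENNReal.ofReal (Real.exp (-‖p.2‖)) < ⊤ := by
  have hG := (continuous_gaussGrad (d := d)).measurable
  have hk : Measurable fun w : ℝ × E d =>
      ENNReal.ofReal (w.1 ^ (-(1 / 2) : ℝ) * gaussGrad w.2) := by fun_prop
  have he : Measurable fun p : ℝ × E d => ENNReal.ofReal (Real.exp (-‖p.2‖)) := by fun_prop
  have hsh : Measurable fun y : (ℝ × E d) × (ℝ × E d) => y.1 + heatShift y.2 :=
    measurable_fst.add (measurable_heatShift.comp measurable_snd)
  have hm : Measurable fun y : (ℝ × E d) × (ℝ × E d) =>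
      ENNReal.ofReal (y.2.1 ^ (-(1 / 2) : ℝ) * gaussGrad y.2.2) * ‖b (y.1 + heatShift y.2)‖ₑ *
        ‖u (y.1 + heatShift y.2)‖ₑ * ENNReal.ofReal (Real.exp (-‖y.1.2‖)) :=
    (((hk.comp measurable_snd).mul (hb.comp hsh).enorm).mul (hu.comp hsh).enorm).mul
      (he.comp measurable_fst)
  have e1 : ∀ p : ℝ × E d, duhamelMaj (fun y => ‖b y‖ₑ) (fun y => ‖u y‖ₑ) p *
      ENNReal.ofReal (Real.exp (-‖p.2‖)) =
      ∫⁻ w, ENNReal.ofReal (w.1 ^ (-(1 / 2) : ℝ) * gaussGrad w.2) * ‖b (p + heatShift w)‖ₑ *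
        ‖u (p + heatShift w)‖ₑ * ENNReal.ofReal (Real.exp (-‖p.2‖)) ∂heatMeasure d := by
    intro p
    have hp : Measurable fun w : ℝ × E d => p + heatShift w := measurable_heatShift.const_add p
    rw [duhamelMaj_eq_heatShift, lintegral_mul_const]
    exact (hk.mul (hb.comp hp).enorm).mul (hu.comp hp).enorm
  simp_rw [e1]
  rw [lintegral_lintegral_swap hm.aemeasurable]
  set I := ∫⁻ p : ℝ × E d, ‖b p‖ₑ * ‖u p‖ₑ * ENNReal.ofReal (Real.exp (-‖p.2‖)) with hIdef
  have e2 : ∀ᵐ w ∂heatMeasure d,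
      ∫⁻ p : ℝ × E d, ENNReal.ofReal (w.1 ^ (-(1 / 2) : ℝ) * gaussGrad w.2) *
        ‖b (p + heatShift w)‖ₑ * ‖u (p + heatShift w)‖ₑ * ENNReal.ofReal (Real.exp (-‖p.2‖)) ≤
      ENNReal.ofReal (w.1 ^ (-(1 / 2) : ℝ) * gaussDom w.2) * I := by
    filter_upwards [ae_heatMeasure_pos] with w hw
    have h1 : ∀ p : ℝ × E d, ENNReal.ofReal (w.1 ^ (-(1 / 2) : ℝ) * gaussGrad w.2) *
        ‖b (p + heatShift w)‖ₑ * ‖u (p + heatShift w)‖ₑ * ENNReal.ofReal (Real.exp (-‖p.2‖)) =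
        (fun q : ℝ × E d => ENNReal.ofReal (w.1 ^ (-(1 / 2) : ℝ) * gaussGrad w.2) *
          ‖b q‖ₑ * ‖u q‖ₑ * ENNReal.ofReal (Real.exp (-‖(q - heatShift w).2‖)))
          (p + heatShift w) := by
      intro p
      simp only [add_sub_cancel_right]
    simp_rw [h1]
    rw [lintegral_add_right_eq_self (fun q : ℝ × E d =>
      ENNReal.ofReal (w.1 ^ (-(1 / 2) : ℝ) * gaussGrad w.2) *
          ‖b q‖ₑ * ‖u q‖ₑ * ENNReal.ofReal (Real.exp (-‖(q - heatShift w).2‖)))]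
    rw [hIdef, ← lintegral_const_mul]
    swap
    · exact (hb.enorm.mul hu.enorm).mul he
    refine lintegral_mono fun q => ?_
    have h2 := exp_neg_norm_sub_heatShift_le q hw.2.le
    have h0 : 0 ≤ w.1 ^ (-(1 / 2) : ℝ) := Real.rpow_nonneg hw.1.le _
    have h3 : w.1 ^ (-(1 / 2) : ℝ) * gaussGrad w.2 * Real.exp (-‖(q - heatShift w).2‖) ≤
        w.1 ^ (-(1 / 2) : ℝ) * gaussDom w.2 * Real.exp (-‖q.2‖) := by
      calc _ ≤ w.1 ^ (-(1 / 2) : ℝ) * gaussGrad w.2 * (Real.exp (-‖q.2‖) * Real.exp ‖w.2‖) :=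
            mul_le_mul_of_nonneg_left h2 (mul_nonneg h0 (gaussGrad_nonneg _))
        _ = w.1 ^ (-(1 / 2) : ℝ) * (gaussGrad w.2 * Real.exp ‖w.2‖) * Real.exp (-‖q.2‖) := by ring
        _ ≤ _ := by
            refine mul_le_mul_of_nonneg_right ?_ (Real.exp_pos _).le
            exact mul_le_mul_of_nonneg_left (gaussGrad_mul_exp_le _) h0
    have h4 := ENNReal.ofReal_le_ofReal h3
    rw [ENNReal.ofReal_mul (mul_nonneg h0 (gaussGrad_nonneg _)),
      ENNReal.ofReal_mul (mul_nonneg h0 (gaussDom_nonneg _))] at h4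
    calc _ = ENNReal.ofReal (w.1 ^ (-(1 / 2) : ℝ) * gaussGrad w.2) *
          ENNReal.ofReal (Real.exp (-‖(q - heatShift w).2‖)) * (‖b q‖ₑ * ‖u q‖ₑ) := by ring
      _ ≤ _ := mul_le_mul_left h4 _
      _ = _ := by ring
  refine (lintegral_mono_ae e2).trans_lt ?_
  have hm2 : Measurable fun w : ℝ × E d =>
      ENNReal.ofReal (w.1 ^ (-(1 / 2) : ℝ) * gaussDom w.2) := by
    have := (continuous_gaussDom (d := d)).measurable
    fun_prop
  rw [lintegral_mul_const _ hm2]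
  exact ENNReal.mul_lt_top integrable_rpow_mul_gaussDom.lintegral_lt_top hI

/-- Backward potential and forward Duhamel operator are adjoint: Fubini and the substitution `p ↦ p
+ heatShift w`. Integrability is proved for `H`, where the majorant is at hand, and carried to `G`
by the same substitution. -/
theorem integral_mul_duhamel {b : ℝ × E d → E d} {u : ℝ × E d → ℝ} (hb : Measurable b)
    (hu : Measurable u)
    (hI : ∫⁻ p : ℝ × E d, ‖b p‖ₑ * ‖u p‖ₑ * ENNReal.ofReal (Real.exp (-‖p.2‖)) < ⊤)
    {F : ℝ × E d → ℝ} (hF : Continuous F) (hc : HasCompactSupport F) :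
    ∫ p : ℝ × E d, u p * ∫ w, duhamelKer (b p) w * F (p - heatShift w) ∂heatMeasure d =
      ∫ p : ℝ × E d, F p * duhamel b u p := by
  obtain ⟨C, h0, hC⟩ := exists_norm_le_mul_exp hF hc
  set G : (ℝ × E d) × (ℝ × E d) → ℝ := fun y =>
    u y.1 * (duhamelKer (b y.1) y.2 * F (y.1 - heatShift y.2)) with hG
  set H : (ℝ × E d) × (ℝ × E d) → ℝ := fun y =>
    F y.1 * (duhamelKer (b (y.1 + heatShift y.2)) y.2 * u (y.1 + heatShift y.2)) with hH
  have hsh : Measurable fun y : (ℝ × E d) × (ℝ × E d) => y.1 + heatShift y.2 :=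
    measurable_fst.add (measurable_heatShift.comp measurable_snd)
  have hsh' : Measurable fun y : (ℝ × E d) × (ℝ × E d) => y.1 - heatShift y.2 :=
    measurable_fst.sub (measurable_heatShift.comp measurable_snd)
  have hGm : Measurable G := (hu.comp measurable_fst).mul
    ((measurable_duhamelKer.comp ((hb.comp measurable_fst).prodMk measurable_snd)).mul
      (hF.measurable.comp hsh'))
  have hHm : Measurable H := (hF.measurable.comp measurable_fst).mul
    ((measurable_duhamelKer.comp ((hb.comp hsh).prodMk measurable_snd)).mul (hu.comp hsh))
  have hHi : Integrable H (volume.prod (heatMeasure d)) := by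
    refine ⟨hHm.aestronglyMeasurable, ?_⟩
    rw [hasFiniteIntegral_iff_enorm, lintegral_prod _ hHm.enorm.aemeasurable]
    have hfin := ENNReal.mul_lt_top (ENNReal.ofReal_lt_top (r := C))
      (lintegral_duhamelMaj_mul_exp_lt_top hb hu hI)
    have hmm : Measurable fun p : ℝ × E d => duhamelMaj (fun y => ‖b y‖ₑ) (fun y => ‖u y‖ₑ) p *
        ENNReal.ofReal (Real.exp (-‖p.2‖)) :=
      (measurable_duhamelMaj hb.enorm hu.enorm).mul (by fun_prop)
    rw [← lintegral_const_mul _ hmm] at hfin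
    refine lt_of_le_of_lt (lintegral_mono fun p => ?_) hfin
    have h1 : ‖F p‖ₑ ≤ ENNReal.ofReal C * ENNReal.ofReal (Real.exp (-‖p.2‖)) := by
      rw [← ENNReal.ofReal_mul h0, ← ofReal_norm]
      exact ENNReal.ofReal_le_ofReal (hC p)
    have h2 : ∫⁻ w, ‖duhamelKer (b (p + heatShift w)) w * u (p + heatShift w)‖ₑ ∂heatMeasure d ≤
        duhamelMaj (fun y => ‖b y‖ₑ) (fun y => ‖u y‖ₑ) p := by
      simp_rw [add_heatShift]
      exact lintegral_enorm_duhamel_le b u p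
    have hp : Measurable fun w : ℝ × E d => p + heatShift w := measurable_heatShift.const_add p
    have hmm2 : Measurable fun w => ‖duhamelKer (b (p + heatShift w)) w * u (p + heatShift w)‖ₑ :=
      ((measurable_duhamelKer.comp ((hb.comp hp).prodMk measurable_id)).mul (hu.comp hp)).enorm
    calc ∫⁻ w, ‖H (p, w)‖ₑ ∂heatMeasure d = ‖F p‖ₑ *
          ∫⁻ w, ‖duhamelKer (b (p + heatShift w)) w * u (p + heatShift w)‖ₑ ∂heatMeasure d := by
          rw [← lintegral_const_mul _ hmm2]
          refine lintegral_congr fun w => ?_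
          rw [hH]
          simp only
          rw [enorm_mul]
      _ ≤ (ENNReal.ofReal C * ENNReal.ofReal (Real.exp (-‖p.2‖))) *
          duhamelMaj (fun y => ‖b y‖ₑ) (fun y => ‖u y‖ₑ) p := by gcongr
      _ = _ := by ring
  have hGH : ∀ p w, G (p + heatShift w, w) = H (p, w) := by
    intro p w
    simp only [hG, hH, add_sub_cancel_right]
    ring
  have hGi : Integrable G (volume.prod (heatMeasure d)) := by
    refine ⟨hGm.aestronglyMeasurable, ?_⟩
    have h1 := hHi.2
    rw [hasFiniteIntegral_iff_enorm] at h1 ⊢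
    rw [lintegral_prod_symm _ hHm.enorm.aemeasurable] at h1
    rw [lintegral_prod_symm _ hGm.enorm.aemeasurable]
    refine lt_of_eq_of_lt (lintegral_congr fun w => ?_) h1
    rw [← lintegral_add_right_eq_self (fun p => ‖G (p, w)‖ₑ) (heatShift w)]
    simp_rw [hGH]
  calc ∫ p : ℝ × E d, u p * ∫ w, duhamelKer (b p) w * F (p - heatShift w) ∂heatMeasure d
      = ∫ p : ℝ × E d, (∫ w, G (p, w) ∂heatMeasure d) := by
        simp_rw [hG, integral_const_mul]
    _ = ∫ w, (∫ p : ℝ × E d, G (p, w)) ∂heatMeasure d := integral_integral_swap hGi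
    _ = ∫ w, (∫ p : ℝ × E d, H (p, w)) ∂heatMeasure d := by
        refine integral_congr_ae (Filter.Eventually.of_forall fun w => ?_)
        simp only
        rw [← integral_add_right_eq_self (fun p => G (p, w)) (heatShift w)]
        simp_rw [hGH]
    _ = ∫ p : ℝ × E d, (∫ w, H (p, w) ∂heatMeasure d) := (integral_integral_swap hHi).symm
    _ = _ := by
        simp_rw [duhamel_eq, hH, integral_const_mul]

theorem integrable_heatFlow {u₀ : E d → ℝ} (hu : Measurable u₀) (hui : Integrable u₀) :
    Integrable (heatFlow u₀) ((volume.restrict (Ioo (0 : ℝ) 1)).prod volume) := by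
  refine ⟨(measurable_heatFlow hu).aestronglyMeasurable, ?_⟩
  rw [hasFiniteIntegral_iff_enorm, lintegral_prod _ (measurable_heatFlow hu).enorm.aemeasurable]
  have h1 : ∀ t : ℝ, ∫⁻ x, ‖heatFlow u₀ (t, x)‖ₑ ≤ eLpNorm u₀ 1 volume := by
    intro t
    rw [← eLpNorm_one_eq_lintegral_enorm]
    exact eLpNorm_heatFlow_le hu le_rfl t
  refine (lintegral_mono h1).trans_lt ?_
  rw [lintegral_const]
  refine ENNReal.mul_lt_top (memLp_one_iff_integrable.2 hui).2 ?_
  simp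

/-- The same duality for the datum, with a substitution in space only, as the datum sits at time
zero. -/
theorem integral_mul_heatFlow {u₀ : E d → ℝ} (hu : Measurable u₀) (hui : Integrable u₀)
    {F : ℝ × E d → ℝ} (hF : Continuous F) (hc : HasCompactSupport F)
    (hs : tsupport F ⊆ Ioo 0 1 ×ˢ univ) :
    ∫ x, u₀ x * potential (heatMeasure d) (fun w => gauss w.2) heatShift F (0, x) =
      ∫ p : ℝ × E d, F p * heatFlow u₀ p := by
  obtain ⟨C, hC⟩ := exists_norm_le_of_hasCompactSupport hF hc
  have hC0 : 0 ≤ C := (norm_nonneg _).trans (hC 0)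
  have hg := (continuous_gauss (d := d)).measurable
  set G : E d × (ℝ × E d) → ℝ := fun y =>
    u₀ y.1 * (gauss y.2.2 * F (y.2.1, y.1 - √y.2.1 • y.2.2)) with hG
  have hGm : Measurable G := by
    refine (hu.comp measurable_fst).mul ((hg.comp (measurable_snd.comp measurable_snd)).mul
      (hF.measurable.comp (by fun_prop)))
  have hGi : Integrable G (volume.prod (heatMeasure d)) := by
    have h1 : Integrable (fun y : E d × (ℝ × E d) => u₀ y.1 * (gauss y.2.2 * C))
        (volume.prod (heatMeasure d)) :=
      hui.mul_prod ((integrable_snd_heatMeasure integrable_gauss).mul_const C)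
    refine h1.mono hGm.aestronglyMeasurable (Filter.Eventually.of_forall fun y => ?_)
    rw [hG]
    simp only [norm_mul]
    gcongr
    exact (hC _).trans (le_abs_self C)
  have e0 : ∀ x, u₀ x * potential (heatMeasure d) (fun w => gauss w.2) heatShift F (0, x) =
      ∫ w, G (x, w) ∂heatMeasure d := by
    intro x
    simp only [potential, sub_heatShift, zero_add, smul_eq_mul, hG]
    rw [integral_const_mul]
  simp_rw [e0]
  rw [integral_integral_swap hGi, integral_prod _ hGi.integral_prod_right]
  have hFi : Integrable (fun p : ℝ × E d => F p * heatFlow u₀ p)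
      ((volume.restrict (Ioo (0 : ℝ) 1)).prod volume) :=
    (integrable_heatFlow hu hui).bdd_mul (c := C) hF.aestronglyMeasurable
      (Filter.Eventually.of_forall hC)
  have e1 : ∫ p : ℝ × E d, F p * heatFlow u₀ p =
      ∫ p, F p * heatFlow u₀ p ∂((volume.restrict (Ioo (0 : ℝ) 1)).prod volume) := by
    have : (volume.restrict (Ioo (0 : ℝ) 1)).prod (volume : Measure (E d)) =
        (volume : Measure (ℝ × E d)).restrict (Ioo 0 1 ×ˢ univ) := by
      rw [Measure.volume_eq_prod, ← Measure.prod_restrict, Measure.restrict_univ]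
    rw [this]
    refine (setIntegral_eq_integral_of_forall_compl_eq_zero fun p hp => ?_).symm
    have : F p = 0 := by
      by_contra hne
      exact hp (hs (subset_tsupport _ hne))
    rw [this, zero_mul]
  rw [e1, integral_prod _ hFi]
  refine setIntegral_congr_fun measurableSet_Ioo fun τ hτ => ?_
  beta_reduce
  have hXm : Measurable fun y : E d × E d => gauss y.2 * (u₀ (y.1 + √τ • y.2) * F (τ, y.1)) :=
    (hg.comp measurable_snd).mul ((hu.comp (by fun_prop)).mul (hF.measurable.comp (by fun_prop)))
  have hXi : Integrable (fun y : E d × E d => gauss y.2 * (u₀ (y.1 + √τ • y.2) * F (τ, y.1)))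
      (volume.prod volume) := by
    refine ⟨hXm.aestronglyMeasurable, ?_⟩
    rw [hasFiniteIntegral_iff_enorm, lintegral_prod_symm _ hXm.enorm.aemeasurable]
    have h1 : ∀ z : E d, ∫⁻ x, ‖gauss z * (u₀ (x + √τ • z) * F (τ, x))‖ₑ ≤
        ENNReal.ofReal (gauss z) * (eLpNorm u₀ 1 volume * ENNReal.ofReal C) := by
      intro z
      calc _ ≤ ∫⁻ x, ENNReal.ofReal (gauss z) * (‖u₀ (x + √τ • z)‖ₑ * ENNReal.ofReal C) := by
            refine lintegral_mono fun x => ?_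
            rw [enorm_mul, enorm_mul, ← ofReal_norm (gauss z), Real.norm_of_nonneg (gauss_pos z).le,
              ← ofReal_norm (F _)]
            gcongr
            exact hC _
        _ = _ := by
            have hm : Measurable fun x => ‖u₀ (x + √τ • z)‖ₑ :=
              (hu.comp (measurable_add_const _)).enorm
            rw [lintegral_const_mul _ (hm.mul_const _), lintegral_mul_const _ hm,
              lintegral_add_right_eq_self (fun x => ‖u₀ x‖ₑ), eLpNorm_one_eq_lintegral_enorm]
    refine (lintegral_mono h1).trans_lt ?_
    rw [lintegral_mul_const _ hg.ennreal_ofReal, lintegral_gauss, one_mul]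
    exact ENNReal.mul_lt_top (memLp_one_iff_integrable.2 hui).2 ENNReal.ofReal_lt_top
  have e2 : ∀ z : E d, ∫ x, G (x, (τ, z)) = ∫ x, gauss z * (u₀ (x + √τ • z) * F (τ, x)) := by
    intro z
    rw [← integral_add_right_eq_self (fun x => G (x, (τ, z))) (√τ • z)]
    refine integral_congr_ae (Filter.Eventually.of_forall fun x => ?_)
    simp only [hG, add_sub_cancel_right]
    ring
  simp_rw [e2]
  rw [← integral_integral_swap hXi]
  refine integral_congr_ae (Filter.Eventually.of_forall fun x => ?_)
  simp only [heatFlow]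
  rw [← integral_const_mul]
  refine integral_congr_ae (Filter.Eventually.of_forall fun z => ?_)
  simp only
  ring

end MildFormula

/-! ### From the weak equation to the mild equation. -/

section MildEquation

variable {d : ℕ}

theorem timeMeasure_prod_volume : timeMeasure.prod (volume : Measure (E d)) =
    (volume : Measure (ℝ × E d)).restrict (Icc 0 1 ×ˢ univ) := by
  rw [Measure.volume_eq_prod, ← Measure.prod_restrict, Measure.restrict_univ]

theorem integrable_mul_of_integrable_exp {F g : ℝ × E d → ℝ} (hF : Continuous F)
    (hc : HasCompactSupport F) {m : Measure (ℝ × E d)}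
    (hgi : Integrable (fun p => g p * Real.exp (-‖p.2‖)) m) :
    Integrable (fun p => F p * g p) m := by
  obtain ⟨C, h0, hC⟩ := exists_norm_le_mul_exp hF hc
  have h1 : Integrable (fun p => (F p * Real.exp ‖p.2‖) * (g p * Real.exp (-‖p.2‖))) m := by
    refine hgi.bdd_mul (c := C) (by fun_prop) (Filter.Eventually.of_forall fun p => ?_)
    rw [norm_mul, Real.norm_of_nonneg (Real.exp_pos _).le]
    calc _ ≤ C * Real.exp (-‖p.2‖) * Real.exp ‖p.2‖ := by gcongr; exact hC p
      _ = C := by rw [mul_assoc, ← Real.exp_add, neg_add_cancel, Real.exp_zero, mul_one]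
  refine h1.congr (Filter.Eventually.of_forall fun p => ?_)
  have : Real.exp ‖p.2‖ * Real.exp (-‖p.2‖) = 1 := by
    rw [← Real.exp_add, add_neg_cancel, Real.exp_zero]
  calc _ = F p * g p * (Real.exp ‖p.2‖ * Real.exp (-‖p.2‖)) := by ring
    _ = _ := by rw [this, mul_one]

theorem norm_fderiv_apply_le_mul_exp {F : ℝ × E d → ℝ} {C : ℝ}
    (hC : ∀ p, ‖fderiv ℝ F p‖ ≤ C * Real.exp (-‖p.2‖)) (b : E d) (p : ℝ × E d) :
    ‖fderiv ℝ F p (0, b)‖ ≤ C * ‖b‖ * Real.exp (-‖p.2‖) := by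
  have h1 := (fderiv ℝ F p).le_opNorm (0, b)
  have h2 : ‖((0 : ℝ), b)‖ = ‖b‖ := by simp [Prod.norm_mk]
  rw [h2] at h1
  calc _ ≤ _ := h1
    _ ≤ C * Real.exp (-‖p.2‖) * ‖b‖ := by gcongr; exact hC p
    _ = _ := by ring

/-- The weak equation is tested with the truncated backward potential of `F`, and the truncation is
removed by dominated convergence. In the limit the heat operator returns `-F`, the drift term
dualizes to the Duhamel operator and the initial term to the heat flow. The weight `exp (-‖x‖)`
provides the domination. -/
theorem integral_mul_eq_of_weak_solution {b : ℝ × E d → E d} {u : ℝ × E d → ℝ} {u₀ : E d → ℝ}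
    (hb : Measurable b) (hu : Measurable u) (hu₀ : Measurable u₀) (hui : Integrable u₀)
    (hb0 : ∀ p : ℝ × E d, p.1 ∉ Ioc (0 : ℝ) 1 → b p = 0)
    (hI1 : Integrable (fun p : ℝ × E d => u p * Real.exp (-‖p.2‖)) (timeMeasure.prod volume))
    (hI2 : ∫⁻ p : ℝ × E d, ‖b p‖ₑ * ‖u p‖ₑ * ENNReal.ofReal (Real.exp (-‖p.2‖)) < ⊤)
    (heq : ∀ φ : ℝ × E d → ℝ, ContDiff ℝ ∞ φ → HasCompactSupport φ → tsupport φ ⊆ Iio 1 ×ˢ univ →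
      ∫ p, u p * (backwardHeat φ p + fderiv ℝ φ p (0, b p)) ∂(timeMeasure.prod volume) +
        ∫ x, u₀ x * φ (0, x) = 0)
    {F : ℝ × E d → ℝ} (hF : ContDiff ℝ ∞ F) (hc : HasCompactSupport F)
    (hs : tsupport F ⊆ Ioo 0 1 ×ˢ univ) :
    ∫ p, F p * u p ∂(timeMeasure.prod volume) =
      (∫ p : ℝ × E d, F p * heatFlow u₀ p) + ∫ p : ℝ × E d, F p * duhamel b u p := by
  set J := ∫ w, gaussDom w.2 ∂heatMeasure d with hJ
  have hJ0 : 0 ≤ J := integral_nonneg fun w => gaussDom_nonneg _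
  have hBc := (contDiff_backwardHeat hF).continuous
  have hBs := hasCompactSupport_backwardHeat hc
  obtain ⟨C₀, h00, hC₀⟩ := exists_norm_le_mul_exp hF.continuous hc
  obtain ⟨C₁, h10, hC₁⟩ := exists_norm_le_mul_exp hBc hBs
  obtain ⟨C₂, h20, hC₂⟩ := exists_norm_le_mul_exp (hF.continuous_fderiv (by simp))
    (hc.fderiv (𝕜 := ℝ))
  set φ : ℕ → ℝ × E d → ℝ := fun n => potential (heatMeasure d) (gaussTrunc n) heatShift F with hφ
  have hφd : ∀ n, ContDiff ℝ ∞ (φ n) := fun n =>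
    contDiff_potential (integrable_gaussTrunc n) measurable_heatShift hF hc
  set K : ℝ × E d → ℝ := fun p =>
    potential (heatMeasure d) (fun w => gauss w.2) heatShift (fun q => fderiv ℝ F q (0, b p)) p
    with hK
  have hB1 : ∀ n p, ‖backwardHeat (φ n) p‖ ≤ C₁ * Real.exp (-‖p.2‖) * J := fun n p => by
    rw [hφ, backwardHeat_potential (integrable_gaussTrunc n) measurable_heatShift hF hc]
    exact norm_potential_gaussTrunc_le n hC₁ h10 p
  have hB2 : ∀ n p, ‖fderiv ℝ (φ n) p (0, b p)‖ ≤ C₂ * ‖b p‖ * Real.exp (-‖p.2‖) * J :=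
    fun n p => by
    rw [hφ, fderiv_potential_apply (integrable_gaussTrunc n) measurable_heatShift hF hc]
    exact norm_potential_gaussTrunc_le n (norm_fderiv_apply_le_mul_exp hC₂ (b p))
      (mul_nonneg h20 (norm_nonneg _)) p
  have hT2 : ∀ p, Filter.Tendsto (fun n => fderiv ℝ (φ n) p (0, b p)) Filter.atTop
      (nhds (K p)) := fun p => by
    simp_rw [hφ, fderiv_potential_apply (integrable_gaussTrunc _) measurable_heatShift hF hc]
    exact tendsto_potential_gaussTrunc (contDiff_fderiv_apply hF _).continuous
      (hasCompactSupport_fderiv_apply hc _) p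
  have hT1 : ∀ p : ℝ × E d, 0 ≤ p.1 → Filter.Tendsto (fun n => backwardHeat (φ n) p) Filter.atTop
      (nhds (- F p)) := fun p hp => by
    simp_rw [hφ, backwardHeat_potential (integrable_gaussTrunc _) measurable_heatShift hF hc]
    rw [← potential_gauss_backwardHeat hF hc hs hp]
    exact tendsto_potential_gaussTrunc hBc hBs p
  have hI2' : Integrable (fun p : ℝ × E d => u p * (‖b p‖ * Real.exp (-‖p.2‖))) := by
    have hm : Measurable fun p : ℝ × E d => u p * (‖b p‖ * Real.exp (-‖p.2‖)) :=
      hu.mul (hb.norm.mul (by fun_prop))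
    refine ⟨hm.aestronglyMeasurable, ?_⟩
    rw [hasFiniteIntegral_iff_enorm]
    refine lt_of_eq_of_lt (lintegral_congr fun p => ?_) hI2
    rw [enorm_mul, enorm_mul, enorm_norm, Real.enorm_of_nonneg (Real.exp_pos _).le]
    ring
  have hI2'' : Integrable (fun p : ℝ × E d => u p * (‖b p‖ * Real.exp (-‖p.2‖)))
      (timeMeasure.prod volume) := by
    rw [timeMeasure_prod_volume]; exact hI2'.restrict
  -- Since `p` enters both as a point and through the frozen vector `b p`, measurability is read off
  -- from the approximating sequence.
  have hKm : Measurable K := measurable_of_tendsto_metrizable (f := fun n p =>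
      fderiv ℝ (φ n) p (0, b p)) (fun n => by
        have h1 : Continuous fun y : (ℝ × E d) × E d => fderiv ℝ (φ n) y.1 (0, y.2) :=
          (((hφd n).continuous_fderiv (by simp)).comp continuous_fst).clm_apply
            (continuous_const.prodMk continuous_snd)
        exact h1.measurable.comp (measurable_id.prodMk hb))
    (tendsto_pi_nhds.2 hT2)
  have hKi : Integrable (fun p => u p * K p) := by
    refine (hI2'.norm.mul_const (C₂ * J)).mono' (hu.mul hKm).aestronglyMeasurable
      (Filter.Eventually.of_forall fun p => ?_)
    have h1 : ‖K p‖ ≤ C₂ * ‖b p‖ * Real.exp (-‖p.2‖) * J :=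
      le_of_tendsto (hT2 p).norm (Filter.Eventually.of_forall fun n => hB2 n p)
    rw [norm_mul, norm_mul, norm_mul, norm_norm, Real.norm_of_nonneg (Real.exp_pos _).le]
    calc _ ≤ ‖u p‖ * (C₂ * ‖b p‖ * Real.exp (-‖p.2‖) * J) := by gcongr
      _ = _ := by ring
  have hFu : Integrable (fun p => F p * u p) (timeMeasure.prod volume) :=
    integrable_mul_of_integrable_exp hF.continuous hc hI1
  have hL1 : Filter.Tendsto (fun n => ∫ p, u p * (backwardHeat (φ n) p + fderiv ℝ (φ n) p (0, b p))
      ∂(timeMeasure.prod volume)) Filter.atTop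
      (nhds (∫ p, u p * (- F p + K p) ∂(timeMeasure.prod volume))) := by
    refine tendsto_integral_of_dominated_convergence (fun p =>
      ‖u p * Real.exp (-‖p.2‖)‖ * (C₁ * J) + ‖u p * (‖b p‖ * Real.exp (-‖p.2‖))‖ * (C₂ * J))
      (fun n => ?_) ((hI1.norm.mul_const _).add (hI2''.norm.mul_const _))
      (fun n => Filter.Eventually.of_forall fun p => ?_) ?_
    · have h1 : Continuous fun y : (ℝ × E d) × E d => fderiv ℝ (φ n) y.1 (0, y.2) :=
          (((hφd n).continuous_fderiv (by simp)).comp continuous_fst).clm_apply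
            (continuous_const.prodMk continuous_snd)
      exact (hu.mul ((contDiff_backwardHeat (hφd n)).continuous.measurable.add
        (h1.measurable.comp (measurable_id.prodMk hb)))).aestronglyMeasurable
    · rw [norm_mul, norm_mul, norm_mul, norm_mul, norm_norm, Real.norm_of_nonneg (Real.exp_pos _).le]
      calc _ ≤ ‖u p‖ * (C₁ * Real.exp (-‖p.2‖) * J + C₂ * ‖b p‖ * Real.exp (-‖p.2‖) * J) := by
            gcongr
            exact (norm_add_le _ _).trans (add_le_add (hB1 n p) (hB2 n p))
        _ = _ := by ring
    · rw [timeMeasure_prod_volume]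
      filter_upwards [ae_restrict_mem (measurableSet_Icc.prod MeasurableSet.univ)] with p hp
      exact ((hT1 p hp.1.1).add (hT2 p)).const_mul _
  have hL2 : Filter.Tendsto (fun n => ∫ x, u₀ x * φ n (0, x)) Filter.atTop
      (nhds (∫ x, u₀ x * potential (heatMeasure d) (fun w => gauss w.2) heatShift F (0, x))) := by
    refine tendsto_integral_of_dominated_convergence (fun x => ‖u₀ x‖ * (C₀ * J))
      (fun n => ?_) (hui.norm.mul_const _) (fun n => Filter.Eventually.of_forall fun x => ?_)
      (Filter.Eventually.of_forall fun x => ?_)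
    · exact (hu₀.mul ((hφd n).continuous.measurable.comp
        measurable_prodMk_left)).aestronglyMeasurable
    · rw [norm_mul]
      gcongr
      refine (norm_potential_gaussTrunc_le n hC₀ h00 (0, x)).trans ?_
      rw [← hJ]
      gcongr
      refine mul_le_of_le_one_right h00 ?_
      simp
    · exact (tendsto_potential_gaussTrunc hF.continuous hc (0, x)).const_mul _
  have hL := hL1.add hL2
  simp_rw [heq (φ _) (hφd _) (hasCompactSupport_potential_gaussTrunc _ hc)
    (tsupport_potential_gaussTrunc_subset _ hc hs)] at hL
  have h0 := tendsto_nhds_unique hL tendsto_const_nhds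
  rw [integral_mul_heatFlow hu₀ hui hF.continuous hc hs] at h0
  have hKr : Integrable (fun p => u p * K p) (timeMeasure.prod volume) := by
    rw [timeMeasure_prod_volume]; exact hKi.restrict
  have h1 : ∫ p, u p * (- F p + K p) ∂(timeMeasure.prod volume) =
      - ∫ p, F p * u p ∂(timeMeasure.prod volume) +
        ∫ p, u p * K p ∂(timeMeasure.prod volume) := by
    have hFn : Integrable (fun p => -(F p * u p)) (timeMeasure.prod volume) := hFu.neg
    rw [← integral_neg, ← integral_add hFn hKr]
    refine integral_congr_ae (Filter.Eventually.of_forall fun p => ?_)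
    ring
  have h2 : ∫ p, u p * K p ∂(timeMeasure.prod volume) = ∫ p : ℝ × E d, F p * duhamel b u p := by
    rw [← integral_mul_duhamel hb hu hI2 hF.continuous hc, timeMeasure_prod_volume,
      setIntegral_eq_integral_of_forall_compl_eq_zero]
    · simp_rw [hK, potential_gauss_fderiv hF hc]
    · intro p hp
      have : b p = 0 := hb0 p fun h => hp ⟨⟨h.1.le, h.2⟩, mem_univ _⟩
      have h0 : ∀ q : ℝ × E d, fderiv ℝ F q ((0 : ℝ), (0 : E d)) = 0 := fun q => map_zero _
      simp only [hK, this, potential, h0, smul_zero, integral_zero, mul_zero]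
  rw [h1, h2] at h0
  linarith

/-- The fundamental lemma of the calculus of variations on the open strip. Integrability against the
exponential weight is enough, as the weight is bounded below on compact sets. -/
theorem eq_heatFlow_add_duhamel {b : ℝ × E d → E d} {u : ℝ × E d → ℝ} {u₀ : E d → ℝ}
    (hb : Measurable b) (hu : Measurable u) (hu₀ : Measurable u₀) (hui : Integrable u₀)
    (hb0 : ∀ p : ℝ × E d, p.1 ∉ Ioc (0 : ℝ) 1 → b p = 0)
    (hI1 : Integrable (fun p : ℝ × E d => u p * Real.exp (-‖p.2‖)) (timeMeasure.prod volume))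
    (hI2 : ∫⁻ p : ℝ × E d, ‖b p‖ₑ * ‖u p‖ₑ * ENNReal.ofReal (Real.exp (-‖p.2‖)) < ⊤)
    (heq : ∀ φ : ℝ × E d → ℝ, ContDiff ℝ ∞ φ → HasCompactSupport φ → tsupport φ ⊆ Iio 1 ×ˢ univ →
      ∫ p, u p * (backwardHeat φ p + fderiv ℝ φ p (0, b p)) ∂(timeMeasure.prod volume) +
        ∫ x, u₀ x * φ (0, x) = 0) :
    ∀ᵐ p : ℝ × E d, p.1 ∈ Ioo (0 : ℝ) 1 → u p = heatFlow u₀ p + duhamel b u p := by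
  set Ω : Set (ℝ × E d) := Ioo 0 1 ×ˢ univ with hΩ
  have hΩo : IsOpen Ω := isOpen_Ioo.prod isOpen_univ
  have hm := measurable_duhamel hb hu
  have hi1 : Integrable (fun p : ℝ × E d => u p * Real.exp (-‖p.2‖)) (volume.restrict Ω) := by
    rw [timeMeasure_prod_volume] at hI1
    exact hI1.mono_measure (Measure.restrict_mono (prod_mono Ioo_subset_Icc_self le_rfl) le_rfl)
  have hi2 : Integrable (fun p : ℝ × E d => heatFlow u₀ p * Real.exp (-‖p.2‖))
      (volume.restrict Ω) := by
    have h1 := integrable_heatFlow hu₀ hui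
    have h2 : (volume.restrict (Ioo (0 : ℝ) 1)).prod (volume : Measure (E d)) =
        (volume : Measure (ℝ × E d)).restrict Ω := by
      rw [Measure.volume_eq_prod, hΩ, ← Measure.prod_restrict, Measure.restrict_univ]
    rw [h2] at h1
    refine h1.mul_bdd (c := 1) (by fun_prop) (Filter.Eventually.of_forall fun p => ?_)
    rw [Real.norm_of_nonneg (Real.exp_pos _).le]
    simp
  have hi3 : Integrable (fun p : ℝ × E d => duhamel b u p * Real.exp (-‖p.2‖)) := by
    have hmm : Measurable fun p : ℝ × E d => duhamel b u p * Real.exp (-‖p.2‖) :=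
      hm.mul (by fun_prop)
    refine ⟨hmm.aestronglyMeasurable, ?_⟩
    rw [hasFiniteIntegral_iff_enorm]
    refine lt_of_le_of_lt (lintegral_mono fun p => ?_)
      (lintegral_duhamelMaj_mul_exp_lt_top hb hu hI2)
    rw [enorm_mul, Real.enorm_of_nonneg (Real.exp_pos _).le]
    gcongr
    exact enorm_duhamel_le b u p
  have hi : Integrable (fun p : ℝ × E d => (u p - (heatFlow u₀ p + duhamel b u p)) *
      Real.exp (-‖p.2‖)) (volume.restrict Ω) := by
    refine (hi1.sub (hi2.add hi3.restrict)).congr (Filter.Eventually.of_forall fun p => ?_)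
    simp only [Pi.add_apply, Pi.sub_apply]
    ring
  have hloc : LocallyIntegrableOn (fun p => u p - (heatFlow u₀ p + duhamel b u p)) Ω := by
    have h1 : LocallyIntegrableOn (fun p : ℝ × E d => (u p - (heatFlow u₀ p + duhamel b u p)) *
      Real.exp (-‖p.2‖)) Ω := IntegrableOn.locallyIntegrableOn hi
    have h2 := h1.mul_continuousOn (g := fun p : ℝ × E d => Real.exp ‖p.2‖) (by fun_prop)
      hΩo.isLocallyClosed
    refine (locallyIntegrableOn_congr (Filter.Eventually.of_forall fun p => ?_)).1 h2
    have : Real.exp (-‖p.2‖) * Real.exp ‖p.2‖ = 1 := by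
      rw [← Real.exp_add, neg_add_cancel, Real.exp_zero]
    rw [mul_assoc, this, mul_one]
  have key := hΩo.ae_eq_zero_of_integral_contDiff_smul_eq_zero hloc fun F hF hc hs => ?_
  · filter_upwards [key] with p hp hp1
    exact sub_eq_zero.1 (hp ⟨hp1, mem_univ _⟩)
  have hsupp : ∀ g : ℝ × E d → ℝ, Function.support (fun p => F p * g p) ⊆ Ω := fun g p hp =>
    hs (subset_tsupport _ (left_ne_zero_of_mul hp))
  have hfull : ∀ {g : ℝ × E d → ℝ},
      Integrable (fun p : ℝ × E d => g p * Real.exp (-‖p.2‖)) (volume.restrict Ω) →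
      Integrable (fun p => F p * g p) := fun {g} hg =>
    (integrableOn_iff_integrable_of_support_subset (hsupp g)).1
      (integrable_mul_of_integrable_exp hF.continuous hc hg)
  have h1 := integral_mul_eq_of_weak_solution hb hu hu₀ hui hb0 hI1 hI2 heq hF hc hs
  rw [timeMeasure_prod_volume, setIntegral_eq_integral_of_forall_compl_eq_zero] at h1
  · simp_rw [smul_eq_mul, mul_sub, mul_add]
    have h2 : Integrable (fun p => F p * heatFlow u₀ p + F p * duhamel b u p) :=
      (hfull hi2).add (hfull hi3.restrict)
    rw [integral_sub (hfull hi1) h2,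
      integral_add (hfull hi2) (hfull hi3.restrict), h1, sub_self]
  · intro p hp
    by_contra hne
    exact hp ⟨Ioo_subset_Icc_self (hsupp u hne).1, mem_univ _⟩

end MildEquation

/-! ### Picard iterates: uniform bounds and convergence to the solution. -/

section Picard

variable {d : ℕ}

/-- A measurable drift on `(0, 1] × ℝ^d` whose norm in `L^r(L^q)` is at most `M`. -/
structure IsDrift (b : ℝ × E d → E d) (q : ℝ≥0∞) (r : ℝ) (M : ℝ≥0∞) : Prop where
  measurable : Measurable b
  eq_zero : ∀ p : ℝ × E d, p.1 ∉ Ioc (0 : ℝ) 1 → b p = 0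
  norm_le : (∫⁻ s, eLpNorm (fun x => ‖b (s, x)‖ₑ) q volume ^ r) ^ (1 / r) ≤ M

/-- The norm of the gradient of `gauss` in `L^{q'}`. -/
def gradConst (d : ℕ) (q' : ℝ≥0∞) : ℝ≥0∞ :=
  eLpNorm (fun z : E d => ENNReal.ofReal (gaussGrad z)) q' volume

variable {b : ℝ × E d → E d} {q q' : ℝ≥0∞} {r ρ : ℝ} {M : ℝ≥0∞}

theorem IsDrift.measurable_norm (hb : IsDrift b q r M) :
    Measurable fun s => eLpNorm (fun x => ‖b (s, x)‖ₑ) q volume :=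
  measurable_eLpNorm_right hb.measurable.enorm.stronglyMeasurable q

theorem IsDrift.norm_eq_zero (hb : IsDrift b q r M) :
    ∀ s ∉ Ioc (0 : ℝ) 1, eLpNorm (fun x => ‖b (s, x)‖ₑ) q volume = 0 := by
  intro s hs
  have : (fun x => ‖b (s, x)‖ₑ) = 0 := by
    ext x
    rw [hb.eq_zero (s, x) hs, enorm_zero, Pi.zero_apply]
  rw [this, eLpNorm_zero]

/-- As the drift vanishes outside `(0, 1]`, a comparison known almost everywhere on that interval is
enough. -/
theorem IsDrift.lintegral_mul_le (hb : IsDrift b q r M) {k : ℝ → ℝ≥0∞} (hk : Measurable k)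
    {f g : ℝ → ℝ≥0∞} (hg : Measurable g) {A : ℝ≥0∞}
    (hfg : ∀ᵐ s, s ∈ Ioc (0 : ℝ) 1 → f s ≤ A * g s) (t : ℝ) :
    ∫⁻ τ, k τ * eLpNorm (fun x => ‖b (t - τ, x)‖ₑ) q volume * f (t - τ) ≤
      A * ∫⁻ τ, k τ * eLpNorm (fun x => ‖b (t - τ, x)‖ₑ) q volume * g (t - τ) := by
  have h1 : ∀ᵐ τ, t - τ ∈ Ioc (0 : ℝ) 1 → f (t - τ) ≤ A * g (t - τ) :=
    (Measure.measurePreserving_sub_left volume t).quasiMeasurePreserving.ae hfg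
  have hs : Measurable fun τ : ℝ => t - τ := measurable_const.sub measurable_id
  have hm : Measurable fun τ =>
      k τ * eLpNorm (fun x => ‖b (t - τ, x)‖ₑ) q volume * g (t - τ) :=
    (hk.mul (hb.measurable_norm.comp hs)).mul (hg.comp hs)
  rw [← lintegral_const_mul _ hm]
  refine lintegral_mono_ae ?_
  filter_upwards [h1] with τ hτ
  by_cases h : t - τ ∈ Ioc (0 : ℝ) 1
  · exact (mul_le_mul_right (hτ h) _).trans (le_of_eq (by ring))
  · rw [hb.norm_eq_zero _ h, mul_zero, zero_mul, zero_mul, mul_zero]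

theorem eLpNorm_duhamel_le {p : ℝ≥0∞} (b : ℝ × E d → E d) (v : ℝ × E d → ℝ) (t : ℝ) :
    eLpNorm (fun x => duhamel b v (t, x)) p volume ≤
      eLpNorm (fun x => duhamelMaj (fun y => ‖b y‖ₑ) (fun y => ‖v y‖ₑ) (t, x)) p volume :=
  eLpNorm_mono_enorm fun x => by rw [enorm_eq_self]; exact enorm_duhamel_le b v (t, x)

/-- Space and time estimates combined in the form that is iterated: the weight reproduces itself,
with a factor that is small for large `l`. -/
theorem eLpNorm_duhamel_le_weight [ENNReal.HolderConjugate q' q] (hq' : q' ≠ ⊤)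
    (hr : ρ.HolderConjugate r) (hb : IsDrift b q r M) {v : ℝ × E d → ℝ} (hv : Measurable v)
    {p : ℝ≥0∞} (hp : q' ≤ p) {y l : ℝ} (hy : 0 ≤ y) (hya : y ≤ 1 / 2 + halfExp d q) (hy1 : y ≤ 1)
    (hl : 0 ≤ l) {A : ℝ≥0∞} (hA : ∀ᵐ s, s ∈ Ioc (0 : ℝ) 1 →
      eLpNorm (fun x => v (s, x)) p volume ≤ A * ENNReal.ofReal (s ^ (-y) * Real.exp (l * s)))
    {t : ℝ} (ht : t ≤ 1) :
    eLpNorm (fun x => duhamel b v (t, x)) p volume ≤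
      gradConst d q' * (6 * (expKerNorm ρ (1 / 2 + halfExp d q) l * M)) * A *
        ENNReal.ofReal (t ^ (-y) * Real.exp (l * t)) := by
  have hβ := hb.measurable_norm
  refine (eLpNorm_duhamel_le b v t).trans ?_
  refine (eLpNorm_duhamelMaj_le q q' p hq' hp hb.measurable.enorm hv.enorm t).trans ?_
  rw [← gradConst]
  simp_rw [fun s : ℝ => eLpNorm_enorm (p := p) (μ := volume) (fun x : E d => v (s, x))]
  set W : ℝ → ℝ≥0∞ := fun s => ENNReal.ofReal (s ^ (-y) * Real.exp (l * s)) with hW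
  have hWm : Measurable W := by rw [hW]; fun_prop
  have h1 := hb.lintegral_mul_le (measurable_expKer (1 / 2 + halfExp d q) 0) hWm hA t
  have h2 := lintegral_expKer_mul_weight_le hr hy hya hy1 hl hβ hb.norm_eq_zero ht
  calc _ ≤ gradConst d q' * (A * ∫⁻ τ, expKer (1 / 2 + halfExp d q) 0 τ *
        eLpNorm (fun x => ‖b (t - τ, x)‖ₑ) q volume * W (t - τ)) := by gcongr
    _ ≤ gradConst d q' * (A * (6 * (expKerNorm ρ (1 / 2 + halfExp d q) l * M) * W t)) := by
        gcongr
        refine h2.trans ?_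
        gcongr
        exact hb.norm_le
    _ = _ := by ring

/-- The Picard iterates of the mild formulation. -/
def picard (b : ℝ × E d → E d) (u₀ : E d → ℝ) : ℕ → ℝ × E d → ℝ
  | 0 => 0
  | n + 1 => fun p => heatFlow u₀ p + duhamel b (picard b u₀ n) p

theorem measurable_picard (hb : Measurable b) {u₀ : E d → ℝ} (hu : Measurable u₀) :
    ∀ n, Measurable (picard b u₀ n)
  | 0 => measurable_const
  | n + 1 => (measurable_heatFlow hu).add (measurable_duhamel hb (measurable_picard hb hu n))

theorem measurable_slice {F : Type} [MeasurableSpace F] {v : ℝ × E d → F} (hv : Measurable v)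
    (t : ℝ) : Measurable fun x => v (t, x) :=
  hv.comp measurable_prodMk_left

/-- The bound `2 A` reproduces itself: the heat flow contributes `A` and the Duhamel term half of `2
A`. -/
theorem eLpNorm_picard_le [ENNReal.HolderConjugate q' q] (hq' : q' ≠ ⊤)
    (hr : ρ.HolderConjugate r) (hb : IsDrift b q r M) {u₀ : E d → ℝ} (hu : Measurable u₀)
    {p : ℝ≥0∞} (hp : q' ≤ p) {y l : ℝ} (hy : 0 ≤ y) (hya : y ≤ 1 / 2 + halfExp d q) (hy1 : y ≤ 1)
    (hl : 0 ≤ l)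
    (hκ : gradConst d q' * (6 * (expKerNorm ρ (1 / 2 + halfExp d q) l * M)) ≤ 1 / 2) {A : ℝ≥0∞}
    (hA : ∀ t ∈ Ioc (0 : ℝ) 1,
      eLpNorm (fun x => heatFlow u₀ (t, x)) p volume ≤ A * ENNReal.ofReal (t ^ (-y))) :
    ∀ n, ∀ t ∈ Ioc (0 : ℝ) 1, eLpNorm (fun x => picard b u₀ n (t, x)) p volume ≤
      2 * A * ENNReal.ofReal (t ^ (-y) * Real.exp (l * t)) := by
  intro n
  induction n with
  | zero =>
    intro t _
    have : (fun x : E d => picard b u₀ 0 (t, x)) = 0 := rfl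
    rw [this, eLpNorm_zero]
    exact zero_le
  | succ n ih =>
    intro t ht
    have h1 := eLpNorm_duhamel_le_weight hq' hr hb (measurable_picard hb.measurable hu n) hp hy hya
      hy1 hl (Filter.Eventually.of_forall ih) ht.2
    have hq1 : 1 ≤ q' := ENNReal.HolderConjugate.one_le q' q
    have h2 : ENNReal.ofReal (t ^ (-y)) ≤ ENNReal.ofReal (t ^ (-y) * Real.exp (l * t)) := by
      refine ENNReal.ofReal_le_ofReal (le_mul_of_one_le_right (Real.rpow_nonneg ht.1.le _) ?_)
      exact Real.one_le_exp (mul_nonneg hl ht.1.le)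
    calc eLpNorm (fun x => picard b u₀ (n + 1) (t, x)) p volume
        ≤ eLpNorm (fun x => heatFlow u₀ (t, x)) p volume +
          eLpNorm (fun x => duhamel b (picard b u₀ n) (t, x)) p volume :=
          eLpNorm_add_le (measurable_slice (measurable_heatFlow hu) t).aestronglyMeasurable
            (measurable_slice (measurable_duhamel hb.measurable
              (measurable_picard hb.measurable hu n)) t).aestronglyMeasurable (hq1.trans hp)
      _ ≤ A * ENNReal.ofReal (t ^ (-y) * Real.exp (l * t)) +
          1 / 2 * (2 * A) * ENNReal.ofReal (t ^ (-y) * Real.exp (l * t)) := by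
          refine add_le_add ((hA t ht).trans (mul_le_mul_right h2 _)) (h1.trans ?_)
          gcongr
      _ = _ := by
          rw [← mul_assoc (1 / 2 : ℝ≥0∞), one_div, ENNReal.inv_mul_cancel two_ne_zero
            ENNReal.ofNat_ne_top]
          ring

theorem ae_slice_of_ae {P : ℝ × E d → Prop} (h : ∀ᵐ p : ℝ × E d, P p) :
    ∀ᵐ t : ℝ, ∀ᵐ x : E d, P (t, x) :=
  Measure.ae_ae_of_ae_prod (μ := (volume : Measure ℝ)) (ν := (volume : Measure (E d))) h

/-- A function satisfying the mild equation inherits the bounds of the Picard iterates. -/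
theorem eLpNorm_le_of_picard_le [ENNReal.HolderConjugate q' q] (hq' : q' ≠ ⊤)
    (hr : ρ.HolderConjugate r) (hb : IsDrift b q r M) {u₀ : E d → ℝ} (hu₀ : Measurable u₀)
    {u : ℝ × E d → ℝ} (hu : Measurable u) {p₀ : ℝ≥0∞} (hp₀ : q' ≤ p₀) {l : ℝ} (hl : 0 ≤ l)
    (hκ : gradConst d q' * (expKerNorm ρ (1 / 2 + halfExp d q) l * M) ≤ 1 / 2)
    (hu2 : ∫⁻ t in Ioc (0 : ℝ) 1, eLpNorm (fun x => u (t, x)) p₀ volume ^ ρ < ⊤)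
    (hI : ∫⁻ p : ℝ × E d, ‖b p‖ₑ * ‖u p‖ₑ * ENNReal.ofReal (Real.exp (-‖p.2‖)) < ⊤)
    (hmild : ∀ᵐ p : ℝ × E d, p.1 ∈ Ioo (0 : ℝ) 1 → u p = heatFlow u₀ p + duhamel b u p)
    {p : ℝ≥0∞} {B : ℝ → ℝ≥0∞} (hB : ∀ n, ∀ t ∈ Ioc (0 : ℝ) 1,
      eLpNorm (fun x => picard b u₀ n (t, x)) p volume ≤ B t) :
    ∀ᵐ t, t ∈ Ioc (0 : ℝ) 1 → eLpNorm (fun x => u (t, x)) p volume ≤ B t := by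
  have hq1 : 1 ≤ q' := ENNReal.HolderConjugate.one_le q' q
  have hP := measurable_picard hb.measurable hu₀
  set D : ℕ → ℝ → ℝ≥0∞ := fun n t =>
    eLpNorm (fun x => u (t, x) - picard b u₀ n (t, x)) p₀ volume with hD
  -- Integrability against a positive weight gives finiteness almost everywhere, which permits
  -- subtracting Duhamel integrals.
  have hfin : ∀ᵐ p : ℝ × E d, duhamelMaj (fun y => ‖b y‖ₑ) (fun y => ‖u y‖ₑ) p < ⊤ := by
    have h1 := lintegral_duhamelMaj_mul_exp_lt_top hb.measurable hu hI
    have h2 : Measurable fun p : ℝ × E d => duhamelMaj (fun y => ‖b y‖ₑ) (fun y => ‖u y‖ₑ) p *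
        ENNReal.ofReal (Real.exp (-‖p.2‖)) :=
      (measurable_duhamelMaj hb.measurable.enorm hu.enorm).mul (by fun_prop)
    filter_upwards [ae_lt_top h2 h1.ne] with p hp
    rcases ENNReal.mul_lt_top_iff.1 hp with h | h | h
    · exact h.1
    · rw [h]; exact ENNReal.zero_lt_top
    · have := ENNReal.ofReal_pos.2 (Real.exp_pos (-‖p.2‖))
      exact absurd h this.ne'
  have hIoo : ∀ᵐ t : ℝ, t ∈ Ioc (0 : ℝ) 1 → t ∈ Ioo (0 : ℝ) 1 := by
    have h1 : ∀ᵐ t : ℝ, t ≠ 1 := by simp [ae_iff]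
    filter_upwards [h1] with t ht h
    exact ⟨h.1, lt_of_le_of_ne h.2 ht⟩
  have hstep : ∀ n, ∀ᵐ t, t ∈ Ioc (0 : ℝ) 1 →
      D (n + 1) t ≤ gradConst d q' * ∫⁻ τ, expKer (1 / 2 + halfExp d q) 0 τ *
        eLpNorm (fun x => ‖b (t - τ, x)‖ₑ) q volume * D n (t - τ) := by
    intro n
    filter_upwards [ae_slice_of_ae hmild, ae_slice_of_ae hfin, hIoo] with t h1 h2 h3 ht
    have h4 := eLpNorm_duhamelMaj_le q q' p₀ hq' hp₀ hb.measurable.enorm (hu.sub (hP n)).enorm t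
    simp only [Pi.sub_apply] at h4
    simp_rw [fun s : ℝ => eLpNorm_enorm (p := p₀) (μ := volume)
      (fun x : E d => u (s, x) - picard b u₀ n (s, x))] at h4
    refine le_trans ?_ h4
    refine eLpNorm_mono_enorm_ae ?_
    filter_upwards [h1, h2] with x hx1 hx2
    rw [enorm_eq_self, hx1 (h3 ht)]
    have : heatFlow u₀ (t, x) + duhamel b u (t, x) - picard b u₀ (n + 1) (t, x) =
        duhamel b u (t, x) - duhamel b (picard b u₀ n) (t, x) := by
      simp only [picard]; ring
    rw [this]
    exact enorm_duhamel_sub_le hb.measurable hu (hP n) _ hx2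
  -- The contraction is applied to `u - picard n` in `L^{p₀}`; since the zeroth iterate is zero, the
  -- initial difference is `u` itself.
  have hconv := ae_tendsto_zero_of_volterra (a := 1 / 2 + halfExp d q) (l := l) hr hl
    hb.measurable_norm hb.norm_eq_zero (κ := gradConst d q') (D := D)
    (le_trans (by gcongr; exact hb.norm_le) hκ)
    (fun n => measurable_eLpNorm_right (hu.sub (hP n)).stronglyMeasurable p₀)
    (by simpa [hD, picard] using hu2) hstep
  filter_upwards [hconv] with t ht1 ht
  have ht2 := ht1 ht
  have hm : TendstoInMeasure volume (fun n x => picard b u₀ n (t, x)) Filter.atTop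
      (fun x => u (t, x)) := by
    refine tendstoInMeasure_of_tendsto_eLpNorm (p := p₀)
      (zero_lt_one.trans_le (hq1.trans hp₀)).ne'
      (fun n => (measurable_slice (hP n) t).aestronglyMeasurable)
      (measurable_slice hu t).aestronglyMeasurable ?_
    refine ht2.congr fun n => ?_
    rw [hD, eLpNorm_sub_comm]
    rfl
  -- A subsequence converges almost everywhere in `x`, so Fatou carries over bounds in any exponent
  -- `p`, not only in the `p₀` in which convergence was proved.
  obtain ⟨ns, -, hns⟩ := hm.exists_seq_tendsto_ae
  refine (Lp.eLpNorm_lim_le_liminf_eLpNorm (fun n =>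
    (measurable_slice (hP (ns n)) t).aestronglyMeasurable) _ hns).trans ?_
  refine Filter.liminf_le_of_le (by isBoundedDefault) fun c hc => ?_
  obtain ⟨n, hn⟩ := hc.exists
  exact hn.trans (hB _ t ht)

end Picard

/-! ### Continuity of translations for curves in `L¹`. -/

section Translation

/-- For finite `p`, composition in `L^p` depends continuously on the measure preserving map, and
translations form a continuous family of such maps. -/
theorem tendsto_eLpNorm_comp_add_sub {G V : Type*} [NormedAddCommGroup G] [NormedSpace ℝ G]
    [FiniteDimensional ℝ G] [MeasurableSpace G] [BorelSpace G] {μ : Measure G}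
    [μ.IsAddHaarMeasure] [NormedAddCommGroup V] {p : ℝ≥0∞} (hp1 : 1 ≤ p) (hp : p ≠ ⊤) {f : G → V}
    (hf : MemLp f p μ) :
    Filter.Tendsto (fun h => eLpNorm (fun x => f (x + h) - f x) p μ) (nhds 0) (nhds 0) := by
  have : Fact (1 ≤ p) := ⟨hp1⟩
  have : ProperSpace G := FiniteDimensional.proper ℝ G
  let g : C(G, C(G, G)) := (ContinuousMap.mk (fun a : G × G => a.2 + a.1) (by fun_prop)).curry
  have hg : ∀ h, MeasurePreserving (g h) μ μ := fun h => measurePreserving_add_right μ h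
  have h1 : Continuous fun h => Lp.compMeasurePreserving (g h) (hg h) (hf.toLp f) :=
    continuous_const.compMeasurePreservingLp g.continuous hg hp
  have h2 := (Lp.tendsto_Lp_iff_tendsto_eLpNorm' _ _).1 (h1.tendsto 0)
  refine h2.congr fun h => eLpNorm_congr_ae ?_
  have h3 : ∀ h, ⇑(Lp.compMeasurePreserving (g h) (hg h) (hf.toLp f)) =ᵐ[μ] fun x => f (x + h) :=
    fun h => (Lp.coeFn_compMeasurePreserving _ (hg h)).trans
      ((hg h).quasiMeasurePreserving.ae_eq_comp hf.coeFn_toLp)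
  filter_upwards [h3 h, h3 0] with x hx hx0
  simp only [Pi.sub_apply]
  rw [hx, hx0, add_zero]

/-- In a separable space an open set is a countable union of balls with centres in a dense set and
radii `1 / (n + 1)`. -/
theorem measurable_of_measurable_edist {X Y : Type*} [MeasurableSpace X] [PseudoEMetricSpace Y]
    [SecondCountableTopology Y] [MeasurableSpace Y] [BorelSpace Y] {f : X → Y}
    (hf : ∀ y, Measurable fun x => edist (f x) y) : Measurable f := by
  refine measurable_of_isOpen fun U hU => ?_
  obtain ⟨D, hDc, hDd⟩ := TopologicalSpace.exists_countable_dense Y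
  have h1 : f ⁻¹' U = ⋃ y ∈ D, ⋃ n : ℕ, ⋃ _ : Metric.eball y ((n : ℝ≥0∞) + 1)⁻¹ ⊆ U,
      {x | edist (f x) y < ((n : ℝ≥0∞) + 1)⁻¹} := by
    ext x
    simp only [mem_preimage, mem_iUnion, exists_prop]
    constructor
    · intro hx
      obtain ⟨ε, hε, hb⟩ := EMetric.isOpen_iff.1 hU _ hx
      obtain ⟨n, hn⟩ := ENNReal.exists_inv_nat_lt (ENNReal.half_pos hε.ne').ne'
      have hn' : ((n : ℝ≥0∞) + 1)⁻¹ < ε / 2 :=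
        lt_of_le_of_lt (ENNReal.inv_le_inv.2 le_self_add) hn
      have hpos : 0 < ((n : ℝ≥0∞) + 1)⁻¹ := by
        rw [ENNReal.inv_pos]; exact ENNReal.add_ne_top.2 ⟨ENNReal.natCast_ne_top n, ENNReal.one_ne_top⟩
      obtain ⟨y, hyD, hy⟩ := hDd.exists_mem_open Metric.isOpen_eball
        ⟨f x, Metric.mem_eball_self hpos⟩
      refine ⟨y, hyD, n, fun z hz => hb ?_, ?_⟩
      · rw [Metric.mem_eball] at hy hz ⊢
        calc edist z (f x) ≤ edist z y + edist y (f x) := edist_triangle _ _ _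
          _ < ε / 2 + ε / 2 := ENNReal.add_lt_add (hz.trans hn') (hy.trans hn')
          _ = ε := ENNReal.add_halves ε
      · rw [Metric.mem_eball, edist_comm] at hy
        exact hy
    · rintro ⟨y, -, n, hsub, hx⟩
      exact hsub hx
  rw [h1]
  refine MeasurableSet.biUnion hDc fun y _ => MeasurableSet.iUnion fun n => MeasurableSet.iUnion
    fun _ => measurableSet_lt (hf y) measurable_const

variable {X V : Type*} [MeasurableSpace X] [MeasurableSpace.CountablyGenerated X] {ν : Measure X}
  [SigmaFinite ν] [NormedAddCommGroup V] [SecondCountableTopology V] [MeasurableSpace V]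
  [BorelSpace V] {f : ℝ × X → V}

open Classical in
/-- The curve in `L¹` given by the integrable slices of a function. -/
def sliceCurve (ν : Measure X) (f : ℝ × X → V) (s : ℝ) : Lp V 1 ν :=
  if h : MemLp (fun x => f (s, x)) 1 ν then h.toLp _ else 0

/-- `L¹` is separable here, so it is enough that distances to fixed elements are measurable, and
these are norms of slices. -/
theorem measurable_sliceCurve (hf : Measurable f) :
    StronglyMeasurable (sliceCurve ν f) := by
  let _ : MeasurableSpace (Lp V 1 ν) := borel _
  have : BorelSpace (Lp V 1 ν) := ⟨rfl⟩
  have : Fact ((1 : ℝ≥0∞) ≠ ⊤) := ⟨ENNReal.one_ne_top⟩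
  refine Measurable.stronglyMeasurable (measurable_of_measurable_edist fun g => ?_)
  have hfs : ∀ s, AEStronglyMeasurable (fun x => f (s, x)) ν := fun s =>
    (hf.comp measurable_prodMk_left).aestronglyMeasurable
  set S : Set ℝ := {s | eLpNorm (fun x => f (s, x)) 1 ν < ⊤} with hS
  have hSm : MeasurableSet S :=
    measurableSet_lt (measurable_eLpNorm_right hf.stronglyMeasurable 1) measurable_const
  have hg := (Lp.stronglyMeasurable g).measurable
  have hfg : Measurable fun p : ℝ × X => f p - g p.2 := hf.sub (hg.comp measurable_snd)
  have h1 := measurable_eLpNorm_right (ν := ν) hfg.stronglyMeasurable 1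
  have h2 : (fun s => edist (sliceCurve ν f s) g) =
      S.piecewise (fun s => eLpNorm (fun x => f (s, x) - g x) 1 ν) (fun _ => edist 0 g) := by
    ext s
    by_cases h : s ∈ S
    · rw [piecewise_eq_of_mem _ _ _ h, sliceCurve, dif_pos ⟨hfs s, h⟩, Lp.edist_def]
      refine eLpNorm_congr_ae ?_
      filter_upwards [MemLp.coeFn_toLp (⟨hfs s, h⟩ : MemLp (fun x => f (s, x)) 1 ν)] with x hx
      rw [Pi.sub_apply, hx]
    · rw [piecewise_eq_of_notMem _ _ _ h, sliceCurve, dif_neg fun h' => h h'.2]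
  rw [h2]
  exact h1.piecewise hSm measurable_const

/-- Viewed as a curve, `f` lies in `L^r(ℝ; L¹)`, where translations in time are continuous. -/
theorem tendsto_lintegral_slice_comp_add_sub (hf : Measurable f) {r : ℝ} (hr : 1 ≤ r)
    (hfr : ∫⁻ s, eLpNorm (fun x => f (s, x)) 1 ν ^ r < ⊤) :
    Filter.Tendsto (fun h : ℝ =>
      (∫⁻ s, eLpNorm (fun x => f (s + h, x) - f (s, x)) 1 ν ^ r) ^ (1 / r)) (nhds 0) (nhds 0) := by
  have hr0 : 0 < r := one_pos.trans_le hr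
  have hfs : ∀ s, AEStronglyMeasurable (fun x => f (s, x)) ν := fun s =>
    (hf.comp measurable_prodMk_left).aestronglyMeasurable
  have hm := measurable_eLpNorm_right (ν := ν) hf.stronglyMeasurable 1
  have hfin : ∀ᵐ s, MemLp (fun x => f (s, x)) 1 ν := by
    filter_upwards [ae_lt_top (hm.pow_const r) hfr.ne] with s hs
    exact ⟨hfs s, (ENNReal.rpow_lt_top_iff_of_pos hr0).1 hs⟩
  have hp0 : ENNReal.ofReal r ≠ 0 := by simpa using hr0
  have hpt : ENNReal.ofReal r ≠ ⊤ := ENNReal.ofReal_ne_top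
  have hpr : (ENNReal.ofReal r).toReal = r := ENNReal.toReal_ofReal hr0.le
  have hF : MemLp (sliceCurve ν f) (ENNReal.ofReal r) volume := by
    refine ⟨(measurable_sliceCurve hf).aestronglyMeasurable, ?_⟩
    rw [eLpNorm_lt_top_iff_lintegral_rpow_enorm_lt_top hp0 hpt, hpr]
    refine lt_of_eq_of_lt (lintegral_congr_ae ?_) hfr
    filter_upwards [hfin] with s hs
    rw [sliceCurve, dif_pos hs, Lp.enorm_toLp]
  refine (tendsto_eLpNorm_comp_add_sub (ENNReal.one_le_ofReal.2 hr) hpt hF).congr fun h => ?_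
  rw [eLpNorm_eq_lintegral_rpow_enorm_toReal hp0 hpt, hpr]
  congr 1
  refine lintegral_congr_ae ?_
  have hfin' : ∀ᵐ s, MemLp (fun x => f (s + h, x)) 1 ν :=
    (measurePreserving_add_right volume h).quasiMeasurePreserving.ae hfin
  filter_upwards [hfin, hfin'] with s hs hs'
  rw [sliceCurve, sliceCurve, dif_pos hs, dif_pos hs', ← MemLp.toLp_sub, Lp.enorm_toLp]
  rfl

end Translation

/-! ### Interpolation between `L¹` and `L^∞`. -/

section Interpolation

/-- Integrate the pointwise inequality `|f|^p ≤ ‖f‖_∞^{p-1} |f|`. -/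
theorem eLpNorm_le_rpow_mul_rpow {X V : Type*} [MeasurableSpace X] {μ : Measure X}
    [NormedAddCommGroup V] {f : X → V} (hf : AEStronglyMeasurable f μ) {p : ℝ} (hp : 1 ≤ p) :
    eLpNorm f (ENNReal.ofReal p) μ ≤ eLpNorm f ⊤ μ ^ ((p - 1) / p) * eLpNorm f 1 μ ^ (1 / p) := by
  have hp0 : 0 < p := one_pos.trans_le hp
  rw [eLpNorm_eq_lintegral_rpow_enorm_toReal (by simpa using hp0) ENNReal.ofReal_ne_top,
    ENNReal.toReal_ofReal hp0.le, eLpNorm_one_eq_lintegral_enorm]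
  have h1 : ∫⁻ x, ‖f x‖ₑ ^ p ∂μ ≤ eLpNorm f ⊤ μ ^ (p - 1) * ∫⁻ x, ‖f x‖ₑ ∂μ := by
    rw [← lintegral_const_mul'' _ hf.enorm, eLpNorm_exponent_top]
    refine lintegral_mono_ae ?_
    filter_upwards [ae_le_eLpNormEssSup (f := f) (μ := μ)] with x hx
    calc ‖f x‖ₑ ^ p = ‖f x‖ₑ ^ (p - 1) * ‖f x‖ₑ ^ (1 : ℝ) := by
          rw [← ENNReal.rpow_add_of_nonneg _ _ (by linarith) zero_le_one, sub_add_cancel]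
      _ ≤ _ := by
          rw [ENNReal.rpow_one]
          exact mul_le_mul_left (ENNReal.rpow_le_rpow hx (by linarith)) _
  calc _ ≤ (eLpNorm f ⊤ μ ^ (p - 1) * ∫⁻ x, ‖f x‖ₑ ∂μ) ^ (1 / p) :=
        ENNReal.rpow_le_rpow h1 (by positivity)
    _ = _ := by
        rw [ENNReal.mul_rpow_of_nonneg _ _ (by positivity), ← ENNReal.rpow_mul, mul_one_div]

end Interpolation

/-! ### Continuity in time, with values in `L¹`, of both terms of the mild formula. -/

section TimeContinuity

variable {d : ℕ}

/-- With the Gaussian fixed, two times differ by the translation `(√t - √t₀) z` of the datum.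
Translation continuity and domination by `2 ‖u₀‖₁` conclude; `t₀ = 0` needs no separate treatment.
-/
theorem tendsto_eLpNorm_heatFlow_sub {u₀ : E d → ℝ} (hu : Measurable u₀) (hui : Integrable u₀)
    (t₀ : ℝ) : Filter.Tendsto (fun t =>
      eLpNorm (fun x => heatFlow u₀ (t, x) - heatFlow u₀ (t₀, x)) 1 volume) (nhds t₀) (nhds 0) := by
  have hu1 := memLp_one_iff_integrable.2 hui
  have hg := (continuous_gauss (d := d)).measurable.ennreal_ofReal
  set S : ℝ → E d → E d → ℝ := fun t x z => u₀ (x + √t • z) with hS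
  have hSm : ∀ t, Measurable fun y : E d × E d => S t y.1 y.2 := fun t => hu.comp (by fun_prop)
  have hint : ∀ t, ∀ᵐ x, Integrable fun z => gauss z * S t x z := by
    intro t
    have hm : Measurable fun y : E d × E d => ENNReal.ofReal (gauss y.2) * ‖S t y.1 y.2‖ₑ :=
      (hg.comp measurable_snd).mul (hSm t).enorm
    have h1 : ∫⁻ x, ∫⁻ z, ENNReal.ofReal (gauss z) * ‖S t x z‖ₑ < ⊤ := by
      rw [lintegral_lintegral_swap hm.aemeasurable]
      have h2 : ∀ z : E d, ∫⁻ x, ENNReal.ofReal (gauss z) * ‖S t x z‖ₑ =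
          ENNReal.ofReal (gauss z) * eLpNorm u₀ 1 volume := fun z => by
        have hm1 : Measurable fun x => ‖S t x z‖ₑ := ((hSm t).comp measurable_prodMk_right).enorm
        rw [lintegral_const_mul _ hm1, hS, eLpNorm_one_eq_lintegral_enorm]
        congr 1
        exact lintegral_add_right_eq_self (fun x => ‖u₀ x‖ₑ) _
      simp_rw [h2]
      rw [lintegral_mul_const _ hg, lintegral_gauss, one_mul]
      exact hu1.2
    filter_upwards [ae_lt_top hm.lintegral_prod_right' h1.ne] with x hx
    refine ⟨((continuous_gauss (d := d)).measurable.mul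
      ((hSm t).comp measurable_prodMk_left)).aestronglyMeasurable, ?_⟩
    rw [hasFiniteIntegral_iff_enorm]
    refine lt_of_eq_of_lt (lintegral_congr fun z => ?_) hx
    rw [enorm_mul, Real.enorm_of_nonneg (gauss_pos z).le]
  set κ : E d → ℝ≥0∞ := fun h => eLpNorm (fun x => u₀ (x + h) - u₀ x) 1 volume with hκ
  have hκ0 : Filter.Tendsto κ (nhds 0) (nhds 0) :=
    tendsto_eLpNorm_comp_add_sub le_rfl ENNReal.one_ne_top hu1
  have hκm : Measurable κ := by
    have h1 : Measurable fun y : E d × E d => u₀ (y.2 + y.1) - u₀ y.2 :=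
      (hu.comp (by fun_prop)).sub (hu.comp measurable_snd)
    exact measurable_eLpNorm_right h1.stronglyMeasurable 1
  have hκ2 : ∀ h, κ h ≤ 2 * eLpNorm u₀ 1 volume := fun h => by
    have h1 : AEStronglyMeasurable (fun x => u₀ (x + h)) volume :=
      (hu.comp (measurable_add_const h)).aestronglyMeasurable
    refine (eLpNorm_sub_le h1 hu.aestronglyMeasurable le_rfl).trans (le_of_eq ?_)
    have h2 : eLpNorm (fun x => u₀ (x + h)) 1 volume = eLpNorm u₀ 1 volume :=
      eLpNorm_comp_measurePreserving hu.aestronglyMeasurable (measurePreserving_add_right volume h)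
    rw [h2, two_mul]
  have hle : ∀ t, eLpNorm (fun x => heatFlow u₀ (t, x) - heatFlow u₀ (t₀, x)) 1 volume ≤
      ∫⁻ z : E d, ENNReal.ofReal (gauss z) * κ ((√t - √t₀) • z) := by
    intro t
    have hm : Measurable fun y : E d × E d =>
        ENNReal.ofReal (gauss y.2) * ‖S t y.1 y.2 - S t₀ y.1 y.2‖ₑ :=
      (hg.comp measurable_snd).mul ((hSm t).sub (hSm t₀)).enorm
    calc eLpNorm (fun x => heatFlow u₀ (t, x) - heatFlow u₀ (t₀, x)) 1 volume
        ≤ ∫⁻ x, ∫⁻ z, ENNReal.ofReal (gauss z) * ‖S t x z - S t₀ x z‖ₑ := by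
          rw [eLpNorm_one_eq_lintegral_enorm]
          refine lintegral_mono_ae ?_
          filter_upwards [hint t, hint t₀] with x h1 h2
          have h3 : heatFlow u₀ (t, x) - heatFlow u₀ (t₀, x) =
              ∫ z, gauss z * (S t x z - S t₀ x z) := by
            simp_rw [mul_sub]
            rw [integral_sub h1 h2]
            rfl
          rw [h3]
          refine (enorm_integral_le_lintegral_enorm _).trans (le_of_eq ?_)
          refine lintegral_congr fun z => ?_
          rw [enorm_mul, Real.enorm_of_nonneg (gauss_pos z).le]
      _ = ∫⁻ z, ∫⁻ x, ENNReal.ofReal (gauss z) * ‖S t x z - S t₀ x z‖ₑ :=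
          lintegral_lintegral_swap hm.aemeasurable
      _ = _ := by
          refine lintegral_congr fun z => ?_
          have hm2 : Measurable fun x => ‖S t x z - S t₀ x z‖ₑ :=
            (((hSm t).comp measurable_prodMk_right).sub
              ((hSm t₀).comp measurable_prodMk_right)).enorm
          rw [lintegral_const_mul _ hm2, hκ]
          congr 1
          simp only
          rw [eLpNorm_one_eq_lintegral_enorm, ← lintegral_add_right_eq_self
            (fun x => ‖u₀ (x + (√t - √t₀) • z) - u₀ x‖ₑ) (√t₀ • z)]
          refine lintegral_congr fun x => ?_
          simp only [hS]
          congr 3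
          rw [sub_smul]
          abel
  refine tendsto_of_tendsto_of_tendsto_of_le_of_le tendsto_const_nhds ?_ (fun _ => zero_le) hle
  have h0 : ∫⁻ z : E d, ENNReal.ofReal (gauss z) * 0 = 0 := by simp
  rw [← h0]
  refine tendsto_lintegral_filter_of_dominated_convergence
    (fun z => ENNReal.ofReal (gauss z) * (2 * eLpNorm u₀ 1 volume))
    (Filter.Eventually.of_forall fun t => hg.mul (hκm.comp (by fun_prop)))
    (Filter.Eventually.of_forall fun t => Filter.Eventually.of_forall fun z =>
      mul_le_mul_right (hκ2 _) _) ?_ (Filter.Eventually.of_forall fun z => ?_)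
  · rw [lintegral_mul_const _ hg, lintegral_gauss, one_mul]
    exact (ENNReal.mul_lt_top ENNReal.ofNat_lt_top hu1.2).ne
  · refine ENNReal.Tendsto.const_mul (hκ0.comp ?_) (Or.inr ENNReal.ofReal_ne_top)
    have h1 : Filter.Tendsto (fun t => (√t - √t₀) • z) (nhds t₀) (nhds ((√t₀ - √t₀) • z)) := by
      refine Continuous.tendsto ?_ t₀
      fun_prop
    rwa [sub_self, zero_smul] at h1

/-- Only the flux `v b` matters, so a single function has to be translated in time. -/
theorem duhamel_eq_duhamel_smul (b : ℝ × E d → E d) (v : ℝ × E d → ℝ) :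
    duhamel b v = duhamel (fun p => v p • b p) fun _ => 1 := by
  ext p
  unfold duhamel
  refine integral_congr_ae (Filter.Eventually.of_forall fun w => ?_)
  simp only [real_inner_smul_right]
  ring

theorem integrable_duhamelKer_mul {f : ℝ × E d → E d} (hf : Measurable f) {p : ℝ × E d}
    (hp : duhamelMaj (fun y => ‖f y‖ₑ) (fun _ => 1) p < ⊤) :
    Integrable (fun w => duhamelKer (f (p + heatShift w)) w) (heatMeasure d) := by
  have h1 : Measurable fun w : ℝ × E d => p + heatShift w := measurable_heatShift.const_add p
  refine ⟨(measurable_duhamelKer.comp ((hf.comp h1).prodMk measurable_id)).aestronglyMeasurable, ?_⟩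
  rw [hasFiniteIntegral_iff_enorm]
  have h2 := lintegral_enorm_duhamel_le f (fun _ => (1 : ℝ)) p
  simp_rw [enorm_one, mul_one, ← add_heatShift] at h2
  exact h2.trans_lt hp

theorem eLpNorm_one_duhamelMaj_one_le {ρ r : ℝ} (hr : ρ.HolderConjugate r) {f : ℝ × E d → ℝ≥0∞}
    (hf : Measurable f) (t : ℝ) :
    eLpNorm (fun x => duhamelMaj f (fun _ => 1) (t, x)) 1 volume ≤
      gradConst d 1 * (expKerNorm ρ (1 / 2) 0 *
        (∫⁻ s, eLpNorm (fun x => f (s, x)) 1 volume ^ r) ^ (1 / r)) := by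
  refine (eLpNorm_one_duhamelMaj_le 1 ⊤ hf measurable_const t).trans ?_
  rw [← gradConst]
  refine mul_le_mul_right ?_ _
  refine le_trans (lintegral_mono fun τ => ?_) (lintegral_expKer_mul_le (a := 1 / 2) (l := 0) hr
    (measurable_eLpNorm_right hf.stronglyMeasurable 1) t)
  refine mul_le_of_le_one_right' ?_
  rw [eLpNorm_ennreal_top]
  exact essSup_le_of_ae_le 1 (Filter.Eventually.of_forall fun _ => le_rfl)

/-- The operator is a convolution in time, so its increment is the operator applied to the increment
of the flux; finite majorants justify the subtraction for almost every `x`. -/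
theorem eLpNorm_duhamel_sub_le {ρ r : ℝ} (hr : ρ.HolderConjugate r) (hρ : 1 / 2 * ρ < 1)
    {f : ℝ × E d → E d} (hf : Measurable f)
    (hfr : ∫⁻ s, eLpNorm (fun x => f (s, x)) 1 volume ^ r < ⊤) (t h : ℝ) :
    eLpNorm (fun x => duhamel f (fun _ => 1) (t + h, x) - duhamel f (fun _ => 1) (t, x)) 1 volume ≤
      gradConst d 1 * (expKerNorm ρ (1 / 2) 0 *
        (∫⁻ s, eLpNorm (fun x => f (s + h, x) - f (s, x)) 1 volume ^ r) ^ (1 / r)) := by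
  have hgc : gradConst d 1 < ⊤ :=
    eLpNorm_lt_top_of_le_gaussDom le_rfl ENNReal.one_ne_top gaussGrad_le_gaussDom
  have hkc : expKerNorm ρ (1 / 2) 0 < ⊤ := expKerNorm_lt_top hr.pos hρ le_rfl
  have hfin : ∀ t, ∀ᵐ x, duhamelMaj (fun y => ‖f y‖ₑ) (fun _ => 1) (t, x) < ⊤ := by
    intro t
    have h1 := eLpNorm_one_duhamelMaj_one_le hr hf.enorm t
    simp_rw [fun s : ℝ => eLpNorm_enorm (p := 1) (μ := volume) (fun x : E d => f (s, x))] at h1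
    have h2 := h1.trans_lt (ENNReal.mul_lt_top hgc (ENNReal.mul_lt_top hkc
      (ENNReal.rpow_lt_top_of_nonneg (one_div_nonneg.2 hr.symm.nonneg) hfr.ne)))
    rw [eLpNorm_one_eq_lintegral_enorm] at h2
    exact ae_lt_top (measurable_slice (measurable_duhamelMaj hf.enorm measurable_const) t) h2.ne
  set g : ℝ × E d → E d := fun p => f (p.1 + h, p.2) - f p with hg
  have hgm : Measurable g := (hf.comp (by fun_prop)).sub hf
  have h1 := eLpNorm_one_duhamelMaj_one_le hr hgm.enorm t
  simp_rw [fun s : ℝ => eLpNorm_enorm (p := 1) (μ := volume) (fun x : E d => g (s, x))] at h1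
  refine le_trans (eLpNorm_mono_enorm_ae ?_) h1
  filter_upwards [hfin t, hfin (t + h)] with x hx hx'
  have e1 : duhamel f (fun _ => 1) (t + h, x) - duhamel f (fun _ => 1) (t, x) =
      duhamel g (fun _ => 1) (t, x) := by
    simp_rw [duhamel_eq, mul_one]
    rw [← integral_sub (integrable_duhamelKer_mul hf hx') (integrable_duhamelKer_mul hf hx)]
    refine integral_congr_ae (Filter.Eventually.of_forall fun w => ?_)
    simp only [hg, duhamelKer, inner_sub_right, add_heatShift, add_sub_right_comm]
    ring
  rw [e1, enorm_eq_self]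
  refine (enorm_duhamel_le g (fun _ => 1) (t, x)).trans (le_of_eq ?_)
  simp_rw [enorm_one]

theorem tendsto_eLpNorm_duhamel_sub {ρ r : ℝ} (hr : ρ.HolderConjugate r) (hρ : 1 / 2 * ρ < 1)
    {b : ℝ × E d → E d} {v : ℝ × E d → ℝ} (hb : Measurable b) (hv : Measurable v)
    (hfr : ∫⁻ s, eLpNorm (fun x => v (s, x) • b (s, x)) 1 volume ^ r < ⊤) (t₀ : ℝ) :
    Filter.Tendsto (fun t => eLpNorm (fun x => duhamel b v (t, x) - duhamel b v (t₀, x)) 1 volume)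
      (nhds t₀) (nhds 0) := by
  have hf : Measurable fun p => v p • b p := hv.smul hb
  have hgc : gradConst d 1 < ⊤ :=
    eLpNorm_lt_top_of_le_gaussDom le_rfl ENNReal.one_ne_top gaussGrad_le_gaussDom
  have hkc : expKerNorm ρ (1 / 2) 0 < ⊤ := expKerNorm_lt_top hr.pos hρ le_rfl
  have h1 := tendsto_lintegral_slice_comp_add_sub (ν := (volume : Measure (E d))) hf
    hr.symm.lt.le hfr
  have h2 := ENNReal.Tendsto.const_mul (a := gradConst d 1) (ENNReal.Tendsto.const_mul
    (a := expKerNorm ρ (1 / 2) 0) h1 (Or.inr hkc.ne)) (Or.inr hgc.ne)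
  rw [mul_zero, mul_zero] at h2
  have h3 : Filter.Tendsto (fun t => t - t₀) (nhds t₀) (nhds 0) := by
    have : Continuous fun t => t - t₀ := by fun_prop
    simpa using this.tendsto t₀
  refine tendsto_of_tendsto_of_tendsto_of_le_of_le tendsto_const_nhds (h2.comp h3)
    (fun _ => zero_le) fun t => ?_
  rw [duhamel_eq_duhamel_smul]
  have h4 := eLpNorm_duhamel_sub_le hr hρ hf hfr t₀ (t - t₀)
  rwa [add_sub_cancel] at h4

end TimeContinuity

/-! ### Bounds and continuity of the right-hand side of the mild equation. -/

section Bounds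

variable {d : ℕ} {b : ℝ × E d → E d} {q q' : ℝ≥0∞} {r ρ : ℝ} {M : ℝ≥0∞}

/-- The right-hand side of the mild formulation. -/
def mildRhs (b : ℝ × E d → E d) (u₀ : E d → ℝ) (u : ℝ × E d → ℝ) (t : ℝ) (x : E d) : ℝ :=
  heatFlow u₀ (t, x) + duhamel b u (t, x)

theorem measurable_mildRhs (hb : Measurable b) {u₀ : E d → ℝ} (hu₀ : Measurable u₀)
    {u : ℝ × E d → ℝ} (hu : Measurable u) (t : ℝ) : Measurable (mildRhs b u₀ u t) :=
  (measurable_slice (measurable_heatFlow hu₀) t).add (measurable_slice (measurable_duhamel hb hu) t)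

theorem eLpNorm_mildRhs_le (hb : Measurable b) {u₀ : E d → ℝ} (hu₀ : Measurable u₀)
    {u : ℝ × E d → ℝ} (hu : Measurable u) {p : ℝ≥0∞} (hp : 1 ≤ p) (t : ℝ) :
    eLpNorm (mildRhs b u₀ u t) p volume ≤
      eLpNorm u₀ p volume + eLpNorm (fun x => duhamel b u (t, x)) p volume :=
  (eLpNorm_add_le (measurable_slice (measurable_heatFlow hu₀) t).aestronglyMeasurable
    (measurable_slice (measurable_duhamel hb hu) t).aestronglyMeasurable hp).trans
    (add_le_add (eLpNorm_heatFlow_le hu₀ hp t) le_rfl)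

/-- `u` solves the mild formulation almost everywhere and is integrable enough for uniqueness. -/
structure IsMildSolution (b : ℝ × E d → E d) (u₀ : E d → ℝ) (p₀ : ℝ≥0∞) (ρ : ℝ)
    (u : ℝ × E d → ℝ) : Prop where
  measurable : Measurable u
  norm_lt_top : ∫⁻ t in Ioc (0 : ℝ) 1, eLpNorm (fun x => u (t, x)) p₀ volume ^ ρ < ⊤
  lintegral_lt_top : ∫⁻ p : ℝ × E d, ‖b p‖ₑ * ‖u p‖ₑ * ENNReal.ofReal (Real.exp (-‖p.2‖)) < ⊤
  eq_mild : ∀ᵐ p : ℝ × E d, p.1 ∈ Ioo (0 : ℝ) 1 → u p = heatFlow u₀ p + duhamel b u p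

theorem exists_growth_rate (hr : ρ.HolderConjugate r) (hα : (1 / 2 + halfExp d q) * ρ < 1)
    (hM : M ≠ ⊤) (hq1 : 1 ≤ q') (hq' : q' ≠ ⊤) :
    ∃ l : ℝ, 0 ≤ l ∧
      gradConst d q' * (6 * (expKerNorm ρ (1 / 2 + halfExp d q) l * M)) ≤ 1 / 2 := by
  have hgc : gradConst d q' ≠ ⊤ :=
    (eLpNorm_lt_top_of_le_gaussDom hq1 hq' gaussGrad_le_gaussDom).ne
  -- The summand `1` keeps `K` different from zero, hence invertible.
  set K := 6 * (gradConst d q' * M) + 1 with hK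
  have hK0 : K ≠ 0 := by rw [hK]; exact (zero_lt_one.trans_le le_add_self).ne'
  have hKt : K ≠ ⊤ := ENNReal.add_ne_top.2
    ⟨ENNReal.mul_ne_top ENNReal.ofNat_ne_top (ENNReal.mul_ne_top hgc hM), ENNReal.one_ne_top⟩
  obtain ⟨l, hl, hle⟩ := exists_expKerNorm_le (ρ := ρ) (a := 1 / 2 + halfExp d q) hr.pos hα
    (δ := (2 * K)⁻¹) (ENNReal.inv_pos.2 (ENNReal.mul_ne_top ENNReal.ofNat_ne_top hKt))
  refine ⟨l, hl, ?_⟩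
  calc _ = (6 * (gradConst d q' * M)) * expKerNorm ρ (1 / 2 + halfExp d q) l := by ring
    _ ≤ K * (2 * K)⁻¹ := mul_le_mul' le_self_add hle
    _ = 1 / 2 := by
        rw [ENNReal.mul_inv (Or.inl two_ne_zero) (Or.inl ENNReal.ofNat_ne_top), mul_left_comm,
          ENNReal.mul_inv_cancel hK0 hKt, mul_one, one_div]

/-- The weight exponent is `0` for bounded data, and `d/(2q)`, the smoothing rate of the heat flow
from `L¹` to `L^{q'}`, for integrable data. -/
theorem IsMildSolution.ae_bounds [ENNReal.HolderConjugate q' q] (hq' : q' ≠ ⊤)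
    (hr : ρ.HolderConjugate r) (hα : (1 / 2 + halfExp d q) * ρ < 1) (hb : IsDrift b q r M)
    {u₀ : E d → ℝ} (hu₀ : Measurable u₀) {p₀ : ℝ≥0∞} (hp₀ : q' ≤ p₀) {u : ℝ × E d → ℝ}
    (hu : IsMildSolution b u₀ p₀ ρ u) {l : ℝ} (hl : 0 ≤ l)
    (hκ : gradConst d q' * (6 * (expKerNorm ρ (1 / 2 + halfExp d q) l * M)) ≤ 1 / 2) :
    (∀ᵐ t, t ∈ Ioc (0 : ℝ) 1 → eLpNorm (fun x => u (t, x)) ⊤ volume ≤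
      2 * eLpNorm u₀ ⊤ volume * ENNReal.ofReal (t ^ (-(0 : ℝ)) * Real.exp (l * t))) ∧
    ∀ᵐ t, t ∈ Ioc (0 : ℝ) 1 → eLpNorm (fun x => u (t, x)) q' volume ≤
      2 * (eLpNorm (fun z : E d => ENNReal.ofReal (gauss z)) q' volume * eLpNorm u₀ 1 volume) *
        ENNReal.ofReal (t ^ (-halfExp d q) * Real.exp (l * t)) := by
  have hγ := halfExp_nonneg d q
  have hγ1 : halfExp d q ≤ 1 := by nlinarith [hr.lt]
  have hκ' : gradConst d q' * (expKerNorm ρ (1 / 2 + halfExp d q) l * M) ≤ 1 / 2 := by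
    refine le_trans (mul_le_mul_right ?_ _) hκ
    exact le_mul_of_one_le_left zero_le (by norm_num)
  constructor
  · refine eLpNorm_le_of_picard_le hq' hr hb hu₀ hu.measurable hp₀ hl hκ' hu.norm_lt_top
      hu.lintegral_lt_top hu.eq_mild (eLpNorm_picard_le hq' hr hb hu₀ le_top le_rfl (by linarith)
        zero_le_one hl hκ fun t ht => ?_)
    rw [neg_zero, Real.rpow_zero, ENNReal.ofReal_one, mul_one]
    exact eLpNorm_heatFlow_le hu₀ le_top t
  · exact eLpNorm_le_of_picard_le hq' hr hb hu₀ hu.measurable hp₀ hl hκ' hu.norm_lt_top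
      hu.lintegral_lt_top hu.eq_mild (eLpNorm_picard_le hq' hr hb hu₀ le_rfl hγ (by linarith)
        hγ1 hl hκ fun t ht => eLpNorm_heatFlow_le_rpow_mul q q' hq' hu₀ ht.1)

/-- The sup bound is one more use of the weighted estimate. For `L¹`, the `L^{q'}` bound with its
singularity `t ^ (-d/(2q))` is inserted into the estimate with kernel `τ ^ (-1/2)`, and the
exponents add up to the admissible one. The bounds on `u` are needed only at almost every time,
since `u` enters under a time integral, so the result holds at every `t`. -/
theorem exists_eLpNorm_mildRhs_le [ENNReal.HolderConjugate q' q] (hq' : q' ≠ ⊤)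
    (hr : ρ.HolderConjugate r) (hα : (1 / 2 + halfExp d q) * ρ < 1) (hM : M ≠ ⊤) :
    ∃ C₁ C₂ : ℝ≥0, ∀ (b : ℝ × E d → E d) (u₀ : E d → ℝ) (p₀ : ℝ≥0∞) (u : ℝ × E d → ℝ),
      IsDrift b q r M → Measurable u₀ → q' ≤ p₀ → IsMildSolution b u₀ p₀ ρ u →
      ∀ t ∈ Icc (0 : ℝ) 1, eLpNorm (mildRhs b u₀ u t) 1 volume ≤ C₁ * eLpNorm u₀ 1 volume ∧
        eLpNorm (mildRhs b u₀ u t) ⊤ volume ≤ C₂ * eLpNorm u₀ ⊤ volume := by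
  have hq1 : 1 ≤ q' := ENNReal.HolderConjugate.one_le q' q
  obtain ⟨l, hl, hκ⟩ := exists_growth_rate hr hα hM hq1 hq'
  have hγ := halfExp_nonneg d q
  set γ := halfExp d q with hγd
  set G := eLpNorm (fun z : E d => ENNReal.ofReal (gauss z)) q' volume with hG
  have hGt : G ≠ ⊤ := (eLpNorm_lt_top_of_le_gaussDom hq1 hq' gauss_le_gaussDom).ne
  have hgc : gradConst d 1 ≠ ⊤ :=
    (eLpNorm_lt_top_of_le_gaussDom le_rfl ENNReal.one_ne_top gaussGrad_le_gaussDom).ne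
  have hkc : expKerNorm ρ (1 / 2 + γ) 0 ≠ ⊤ := (expKerNorm_lt_top hr.pos hα le_rfl).ne
  set K₁ : ℝ≥0∞ := 1 + gradConst d 1 * ((2 * G * ENNReal.ofReal (Real.exp l)) *
    (2 * (expKerNorm ρ (1 / 2 + γ) 0 * M))) with hK₁
  set K₂ : ℝ≥0∞ := 1 + ENNReal.ofReal (Real.exp l) with hK₂
  have hK₁t : K₁ ≠ ⊤ := by
    refine ENNReal.add_ne_top.2 ⟨ENNReal.one_ne_top, ENNReal.mul_ne_top hgc (ENNReal.mul_ne_top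
      (ENNReal.mul_ne_top (ENNReal.mul_ne_top ENNReal.ofNat_ne_top hGt) ENNReal.ofReal_ne_top)
      (ENNReal.mul_ne_top ENNReal.ofNat_ne_top (ENNReal.mul_ne_top hkc hM)))⟩
  have hK₂t : K₂ ≠ ⊤ := ENNReal.add_ne_top.2 ⟨ENNReal.one_ne_top, ENNReal.ofReal_ne_top⟩
  refine ⟨K₁.toNNReal, K₂.toNNReal, fun b u₀ p₀ u hb hu₀ hp₀ hu t ht => ?_⟩
  rw [ENNReal.coe_toNNReal hK₁t, ENNReal.coe_toNNReal hK₂t]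
  obtain ⟨hsup, h1⟩ := hu.ae_bounds hq' hr hα hb hu₀ hp₀ hl hκ
  have hexp : ∀ s : ℝ, s ≤ 1 → Real.exp (l * s) ≤ Real.exp l := fun s hs =>
    Real.exp_le_exp.2 (mul_le_of_le_one_right hl hs)
  constructor
  · refine (eLpNorm_mildRhs_le hb.measurable hu₀ hu.measurable le_rfl t).trans ?_
    have h2 : eLpNorm (fun x => duhamel b u (t, x)) 1 volume ≤
        gradConst d 1 * ∫⁻ τ, expKer (1 / 2) 0 τ * eLpNorm (fun x => ‖b (t - τ, x)‖ₑ) q volume *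
          eLpNorm (fun x => u (t - τ, x)) q' volume := by
      refine (eLpNorm_duhamel_le b u t).trans ?_
      refine (eLpNorm_one_duhamelMaj_le q q' hb.measurable.enorm hu.measurable.enorm t).trans ?_
      rw [← gradConst]
      simp_rw [fun s : ℝ => eLpNorm_enorm (p := q') (μ := volume) (fun x : E d => u (s, x))]
      exact le_rfl
    have hWm : Measurable fun s : ℝ => ENNReal.ofReal (s ^ (-γ)) := by fun_prop
    have h3 : ∀ᵐ s, s ∈ Ioc (0 : ℝ) 1 → eLpNorm (fun x => u (s, x)) q' volume ≤
        (2 * (G * eLpNorm u₀ 1 volume) * ENNReal.ofReal (Real.exp l)) *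
          ENNReal.ofReal (s ^ (-γ)) := by
      filter_upwards [h1] with s hs hs1
      refine (hs hs1).trans ?_
      rw [ENNReal.ofReal_mul (Real.rpow_nonneg hs1.1.le _),
        mul_comm (ENNReal.ofReal (s ^ (-γ))), ← mul_assoc]
      gcongr
      exact mul_le_of_le_one_right hl hs1.2
    have h4 := hb.lintegral_mul_le (measurable_expKer (1 / 2) 0) hWm h3 t
    have h5 := lintegral_expKer_mul_rpow_le (x := 1 / 2) (y := γ) hr (by norm_num) hγ
      hb.measurable_norm hb.norm_eq_zero ht.2
    calc _ ≤ eLpNorm u₀ 1 volume + gradConst d 1 *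
          ((2 * (G * eLpNorm u₀ 1 volume) * ENNReal.ofReal (Real.exp l)) *
            (2 * (expKerNorm ρ (1 / 2 + γ) 0 * M))) := by
          refine add_le_add le_rfl (h2.trans (mul_le_mul_right (h4.trans ?_) _))
          refine mul_le_mul_right (h5.trans ?_) _
          gcongr
          exact hb.norm_le
      _ = _ := by rw [hK₁]; ring
  · refine (eLpNorm_mildRhs_le hb.measurable hu₀ hu.measurable le_top t).trans ?_
    have h2 := eLpNorm_duhamel_le_weight hq' hr hb hu.measurable (p := ⊤) le_top le_rfl
      (by linarith) zero_le_one hl hsup ht.2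
    rw [hK₂, add_mul, one_mul]
    refine add_le_add le_rfl (h2.trans ?_)
    calc _ ≤ 1 / 2 * (2 * eLpNorm u₀ ⊤ volume) * ENNReal.ofReal (Real.exp l) := by
          gcongr
          rw [neg_zero, Real.rpow_zero, one_mul]
          exact hexp t ht.2
      _ = _ := by
          rw [← mul_assoc (1 / 2 : ℝ≥0∞), one_div, ENNReal.inv_mul_cancel two_ne_zero
            ENNReal.ofNat_ne_top, one_mul, mul_comm]

theorem IsMildSolution.ae_eq_mildRhs {u₀ : E d → ℝ} {p₀ : ℝ≥0∞} {u : ℝ × E d → ℝ}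
    (hu : IsMildSolution b u₀ p₀ ρ u) :
    ∀ᵐ t, t ∈ Ioc (0 : ℝ) 1 → (fun x => u (t, x)) =ᵐ[volume] mildRhs b u₀ u t := by
  have h1 : ∀ᵐ t : ℝ, t ≠ 1 := by simp [ae_iff]
  filter_upwards [ae_slice_of_ae hu.eq_mild, h1] with t h2 h3 ht
  filter_upwards [h2] with x hx
  exact hx ⟨ht.1, lt_of_le_of_ne ht.2 h3⟩

/-- The flux lies in `L^r(L¹)`: interpolation bounds `u` in `L^{q'}` uniformly in time, and Hölder
pairs this with the drift. -/
theorem IsMildSolution.tendsto_eLpNorm_one_sub [ENNReal.HolderConjugate q' q] (hq' : q' ≠ ⊤)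
    (hr : ρ.HolderConjugate r) (hρ : 1 / 2 * ρ < 1) (hM : M ≠ ⊤) (hb : IsDrift b q r M)
    {u₀ : E d → ℝ} (hu₀ : Measurable u₀) (hui : Integrable u₀) {p₀ : ℝ≥0∞} {u : ℝ × E d → ℝ}
    (hu : IsMildSolution b u₀ p₀ ρ u) {B₁ B₂ : ℝ≥0∞} (hB₁ : B₁ ≠ ⊤) (hB₂ : B₂ ≠ ⊤)
    (h1 : ∀ t ∈ Icc (0 : ℝ) 1, eLpNorm (mildRhs b u₀ u t) 1 volume ≤ B₁)
    (h2 : ∀ t ∈ Icc (0 : ℝ) 1, eLpNorm (mildRhs b u₀ u t) ⊤ volume ≤ B₂) (t₀ : ℝ) :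
    Filter.Tendsto (fun t => eLpNorm (fun x => mildRhs b u₀ u t x - mildRhs b u₀ u t₀ x) 1 volume)
      (nhds t₀) (nhds 0) := by
  have hq1 : 1 ≤ q' := ENNReal.HolderConjugate.one_le q' q
  have hr0 : 0 < r := hr.symm.pos
  have hq'r : ENNReal.ofReal q'.toReal = q' := ENNReal.ofReal_toReal hq'
  have hq1r : 1 ≤ q'.toReal := by
    rw [← ENNReal.toReal_one]; exact ENNReal.toReal_mono hq' hq1
  have hum := hu.measurable
  have hfr : ∫⁻ s, eLpNorm (fun x => u (s, x) • b (s, x)) 1 volume ^ r < ⊤ := by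
    set K := B₂ ^ ((q'.toReal - 1) / q'.toReal) * B₁ ^ (1 / q'.toReal) with hK
    have hKt : K ≠ ⊤ := ENNReal.mul_ne_top
      (ENNReal.rpow_ne_top_of_nonneg (div_nonneg (by linarith) (by linarith)) hB₂)
      (ENNReal.rpow_ne_top_of_nonneg (by positivity) hB₁)
    have h3 : ∀ᵐ s, eLpNorm (fun x => u (s, x) • b (s, x)) 1 volume ^ r ≤
        K ^ r * eLpNorm (fun x => ‖b (s, x)‖ₑ) q volume ^ r := by
      filter_upwards [hu.ae_eq_mildRhs] with s hs
      rw [← ENNReal.mul_rpow_of_nonneg _ _ hr0.le]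
      refine ENNReal.rpow_le_rpow ?_ hr0.le
      by_cases hs1 : s ∈ Ioc (0 : ℝ) 1
      · have h4 : eLpNorm (fun x => u (s, x)) q' volume ≤ K := by
          rw [eLpNorm_congr_ae (hs hs1), ← hq'r]
          refine (eLpNorm_le_rpow_mul_rpow (measurable_mildRhs hb.measurable hu₀ hum
            s).aestronglyMeasurable hq1r).trans (mul_le_mul' ?_ ?_)
          · exact ENNReal.rpow_le_rpow (h2 s (Ioc_subset_Icc_self hs1))
              (div_nonneg (by linarith) (by linarith))
          · exact ENNReal.rpow_le_rpow (h1 s (Ioc_subset_Icc_self hs1)) (by positivity)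
        rw [eLpNorm_one_eq_lintegral_enorm]
        simp_rw [enorm_smul]
        refine (lintegral_mul_le_eLpNorm_mul_eLpNorm q' q
          (measurable_slice hum s).enorm.aemeasurable
          (measurable_slice hb.measurable s).enorm.aemeasurable).trans ?_
        rw [eLpNorm_enorm (fun x => u (s, x))]
        gcongr
      · have : (fun x => u (s, x) • b (s, x)) = 0 := by
          ext1 x
          rw [hb.eq_zero (s, x) hs1, smul_zero, Pi.zero_apply]
        rw [this, eLpNorm_zero]
        exact zero_le
    refine (lintegral_mono_ae h3).trans_lt ?_
    rw [lintegral_const_mul _ (hb.measurable_norm.pow_const r)]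
    refine ENNReal.mul_lt_top (ENNReal.rpow_lt_top_of_nonneg hr0.le hKt) ?_
    have h5 := hb.norm_le.trans_lt (lt_top_iff_ne_top.2 hM)
    exact (ENNReal.rpow_lt_top_iff_of_pos (one_div_pos.2 hr0)).1 h5
  have h3 := (tendsto_eLpNorm_heatFlow_sub hu₀ hui t₀).add
    (tendsto_eLpNorm_duhamel_sub hr hρ hb.measurable hum hfr t₀)
  rw [add_zero] at h3
  refine tendsto_of_tendsto_of_tendsto_of_le_of_le tendsto_const_nhds h3
    (fun _ => zero_le) fun t => ?_
  have hH := measurable_heatFlow hu₀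
  have hD := measurable_duhamel hb.measurable hum
  refine le_trans (le_of_eq ?_) (eLpNorm_add_le
    ((measurable_slice hH t).sub (measurable_slice hH t₀)).aestronglyMeasurable
    ((measurable_slice hD t).sub (measurable_slice hD t₀)).aestronglyMeasurable le_rfl)
  congr 1
  ext x
  simp only [mildRhs, Pi.add_apply]
  ring

/-- The square of the `L²` norm is at most the product of the sup norm, which stays bounded, and the
`L¹` norm, which tends to zero for increments. -/
theorem IsMildSolution.exists_continuous_rep [ENNReal.HolderConjugate q' q] (hq' : q' ≠ ⊤)
    (hr : ρ.HolderConjugate r) (hρ : 1 / 2 * ρ < 1) (hM : M ≠ ⊤) (hb : IsDrift b q r M)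
    {u₀ : E d → ℝ} (hu₀ : Measurable u₀) (hui : Integrable u₀) {p₀ : ℝ≥0∞} {u : ℝ × E d → ℝ}
    (hu : IsMildSolution b u₀ p₀ ρ u) {B₁ B₂ : ℝ≥0∞} (hB₁ : B₁ ≠ ⊤) (hB₂ : B₂ ≠ ⊤)
    (h1 : ∀ t ∈ Icc (0 : ℝ) 1, eLpNorm (mildRhs b u₀ u t) 1 volume ≤ B₁)
    (h2 : ∀ t ∈ Icc (0 : ℝ) 1, eLpNorm (mildRhs b u₀ u t) ⊤ volume ≤ B₂) :
    ∃ w : ℝ → L2 d, ContinuousOn w (Icc 0 1) ∧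
      ∀ t ∈ Icc (0 : ℝ) 1, w t =ᵐ[volume] mildRhs b u₀ u t := by
  classical
  have hwm : ∀ t, AEStronglyMeasurable (mildRhs b u₀ u t) volume := fun t =>
    (measurable_mildRhs hb.measurable hu₀ hu.measurable t).aestronglyMeasurable
  have hint : ∀ {f : E d → ℝ}, AEStronglyMeasurable f volume → eLpNorm f 2 volume ≤
      eLpNorm f ⊤ volume ^ (1 / 2 : ℝ) * eLpNorm f 1 volume ^ (1 / 2 : ℝ) := fun {f} hf => by
    have h3 := eLpNorm_le_rpow_mul_rpow hf (p := 2) one_le_two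
    rw [ENNReal.ofReal_ofNat] at h3
    norm_num at h3 ⊢
    exact h3
  have hw2 : ∀ t ∈ Icc (0 : ℝ) 1, MemLp (mildRhs b u₀ u t) 2 volume := fun t ht =>
    ⟨hwm t, (hint (hwm t)).trans_lt (ENNReal.mul_lt_top
      (ENNReal.rpow_lt_top_of_nonneg (by norm_num) (ne_top_of_le_ne_top hB₂ (h2 t ht)))
      (ENNReal.rpow_lt_top_of_nonneg (by norm_num) (ne_top_of_le_ne_top hB₁ (h1 t ht))))⟩
  set w : ℝ → L2 d := fun t => if h : MemLp (mildRhs b u₀ u t) 2 volume then h.toLp _ else 0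
    with hw
  have hwt : ∀ t (ht : t ∈ Icc (0 : ℝ) 1), w t = (hw2 t ht).toLp _ := fun t ht =>
    dif_pos (hw2 t ht)
  refine ⟨w, fun t₀ ht₀ => ?_, fun t ht => ?_⟩
  swap
  · rw [hwt t ht]; exact MemLp.coeFn_toLp _
  rw [ContinuousWithinAt, tendsto_iff_edist_tendsto_0]
  have h3 := (hu.tendsto_eLpNorm_one_sub hq' hr hρ hM hb hu₀ hui hB₁ hB₂ h1 h2 t₀).mono_left
    (nhdsWithin_le_nhds (s := Icc 0 1))
  have h4 := (ENNReal.continuous_rpow_const (y := 1 / 2)).tendsto 0 |>.comp h3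
  have h5 := ENNReal.Tendsto.const_mul (a := (B₂ + B₂) ^ (1 / 2 : ℝ)) h4
    (Or.inr (ENNReal.rpow_ne_top_of_nonneg (by norm_num) (ENNReal.add_ne_top.2 ⟨hB₂, hB₂⟩)))
  rw [ENNReal.zero_rpow_of_pos (by norm_num), mul_zero] at h5
  refine tendsto_of_tendsto_of_tendsto_of_le_of_le' tendsto_const_nhds h5
    (Filter.Eventually.of_forall fun _ => zero_le) ?_
  filter_upwards [self_mem_nhdsWithin] with t ht
  rw [hwt t ht, hwt t₀ ht₀, Lp.edist_toLp_toLp]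
  refine (hint ((hwm t).sub (hwm t₀))).trans (mul_le_mul' (ENNReal.rpow_le_rpow ?_ (by norm_num))
    le_rfl)
  exact (eLpNorm_sub_le (hwm t) (hwm t₀) le_top).trans (add_le_add (h2 t ht) (h2 t₀ ht₀))

end Bounds

/-! ### Mollification and jointly measurable representatives. -/

section Mollifier

/-- Bump functions concentrating at the origin. -/
def smallBump (d n : ℕ) : ContDiffBump (0 : E d) where
  rIn := 1 / (n + 1)
  rOut := 2 / (n + 1)
  rIn_pos := by positivity
  rIn_lt_rOut := by gcongr; norm_num

/-- The normalization of `smallBump`. -/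
def mollifier (d n : ℕ) : E d → ℝ := (smallBump d n).normed volume

variable {d : ℕ}

theorem contDiff_mollifier (n : ℕ) : ContDiff ℝ ∞ (mollifier d n) :=
  (smallBump d n).contDiff_normed

theorem hasCompactSupport_mollifier (n : ℕ) : HasCompactSupport (mollifier d n) :=
  (smallBump d n).hasCompactSupport_normed

theorem eLpNorm_one_mollifier (n : ℕ) : eLpNorm (mollifier d n) 1 volume = 1 := by
  have h0 : ∀ x, 0 ≤ mollifier d n x := fun x => (smallBump d n).nonneg_normed x
  rw [eLpNorm_one_eq_lintegral_enorm]
  simp_rw [Real.enorm_of_nonneg (h0 _)]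
  rw [← ofReal_integral_eq_lintegral_ofReal
    ((contDiff_mollifier n).continuous.integrable_of_hasCompactSupport
      (hasCompactSupport_mollifier n)) (Filter.Eventually.of_forall h0)]
  have : ∫ x, mollifier d n x = 1 := (smallBump d n).integral_normed
  rw [this, ENNReal.ofReal_one]

/-- The mollification of a function. -/
def mollify (n : ℕ) (g : E d → ℝ) (x : E d) : ℝ := ∫ y, mollifier d n (x - y) * g y

theorem mollify_eq_convolution (n : ℕ) (g : E d → ℝ) :
    mollify n g = convolution (mollifier d n) g (ContinuousLinearMap.lsmul ℝ ℝ) volume := by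
  ext x
  rw [convolution_lsmul_swap]
  rfl

theorem ae_tendsto_mollify {g : E d → ℝ} (hg : LocallyIntegrable g) :
    ∀ᵐ x, Filter.Tendsto (fun n => mollify n g x) Filter.atTop (nhds (g x)) := by
  have h1 : Filter.Tendsto (fun n => (smallBump d n).rOut) Filter.atTop (nhds 0) := by
    have := tendsto_one_div_add_atTop_nhds_zero_nat (𝕜 := ℝ) |>.const_mul 2
    rw [mul_zero] at this
    refine this.congr fun n => ?_
    rw [smallBump]
    ring
  have h2 := ContDiffBump.ae_convolution_tendsto_right_of_locallyIntegrable (K := 2) h1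
    (Filter.Eventually.of_forall fun n => by rw [smallBump]; simp only; exact le_of_eq (by ring)) hg
  filter_upwards [h2] with x hx
  simp_rw [mollify_eq_convolution]
  exact hx

theorem continuous_mollify (n : ℕ) {g : E d → ℝ} (hg : LocallyIntegrable g) :
    Continuous (mollify n g) := by
  rw [mollify_eq_convolution]
  exact (hasCompactSupport_mollifier n).continuous_convolution_left _
    (contDiff_mollifier n).continuous hg

theorem integral_mul_eq_inner_toLp (f : L2 d) {k : E d → ℝ} (hk : MemLp k 2 volume) :
    ∫ y, k y * f y = inner ℝ (hk.toLp k) f := by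
  rw [L2.inner_def]
  refine integral_congr_ae ?_
  filter_upwards [hk.coeFn_toLp] with y hy
  rw [hy, RCLike.inner_apply, conj_trivial, mul_comm]

/-- Elements of `L²` have no point values, but their mollifications are continuous in `x` and
measurable in `t`, hence jointly measurable. They converge almost everywhere, and the `limsup` is a
measurable choice defined everywhere. -/
theorem exists_measurable_uncurry {U : ℝ → L2 d} (hU : AEStronglyMeasurable U timeMeasure) :
    ∃ u : ℝ × E d → ℝ, Measurable u ∧
      ∀ᵐ t ∂timeMeasure, (fun x => u (t, x)) =ᵐ[volume] U t := by
  obtain ⟨V, hVm, hVe⟩ := hU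
  have hloc : ∀ t, LocallyIntegrable (V t) := fun t => (Lp.memLp (V t)).locallyIntegrable one_le_two
  have hm : ∀ n, Measurable fun p : ℝ × E d => mollify n (V p.1) p.2 := by
    intro n
    have hsm : ∀ x : E d, StronglyMeasurable fun t => mollify n (V t) x := by
      intro x
      have hk : MemLp (fun y => mollifier d n (x - y)) 2 volume := by
        refine Continuous.memLp_of_hasCompactSupport
          ((contDiff_mollifier n).continuous.comp (by fun_prop)) ?_
        exact (hasCompactSupport_mollifier n).comp_homeomorph (Homeomorph.subLeft x)
      simp_rw [mollify, integral_mul_eq_inner_toLp _ hk]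
      exact stronglyMeasurable_const.inner hVm
    have h1 : StronglyMeasurable (Function.uncurry fun (x : E d) (t : ℝ) => mollify n (V t) x) :=
      stronglyMeasurable_uncurry_of_continuous_of_stronglyMeasurable
        (fun t => continuous_mollify n (hloc t)) hsm
    have h2 := h1.measurable.comp (measurable_swap (α := ℝ) (β := E d))
    simp only [Function.comp_def, Function.uncurry, Prod.fst_swap, Prod.snd_swap] at h2
    exact h2
  refine ⟨fun p => Filter.limsup (fun n => mollify n (V p.1) p.2) Filter.atTop,
    Measurable.limsup hm, ?_⟩
  filter_upwards [hVe] with t ht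
  rw [ht]
  filter_upwards [ae_tendsto_mollify (hloc t)] with x hx
  exact hx.limsup_eq

/-- Mollifiers centred at `x` have unit `L¹` norm, so every mollification of `g` is bounded by `C`,
and so is its limit. -/
theorem eLpNorm_top_le_of_forall_test {g : E d → ℝ} (hg : LocallyIntegrable g) {C : ℝ≥0∞}
    (h : ∀ φ : E d → ℝ, ContDiff ℝ ∞ φ → HasCompactSupport φ →
      ‖∫ x, φ x * g x‖ₑ ≤ C * eLpNorm φ 1 volume) : eLpNorm g ⊤ volume ≤ C := by
  rw [eLpNorm_exponent_top]
  refine essSup_le_of_ae_le C ?_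
  filter_upwards [ae_tendsto_mollify hg] with x hx
  refine le_of_tendsto hx.enorm (Filter.Eventually.of_forall fun n => ?_)
  have h1 : ContDiff ℝ ∞ fun y => mollifier d n (x - y) :=
    (contDiff_mollifier n).comp (contDiff_const.sub contDiff_id)
  refine (h _ h1 ((hasCompactSupport_mollifier n).comp_homeomorph (Homeomorph.subLeft x))).trans ?_
  have h2 : eLpNorm (fun y => mollifier d n (x - y)) 1 volume = eLpNorm (mollifier d n) 1 volume :=
    eLpNorm_comp_measurePreserving (contDiff_mollifier n).continuous.aestronglyMeasurable
      (Measure.measurePreserving_sub_left volume x)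
  rw [h2, eLpNorm_one_mollifier, mul_one]

end Mollifier

/-! ### The embedding of `H¹(ℝ)` in `L^∞(ℝ)`. -/

section Sobolev

/-- The weak gradient `H¹(ℝ^d) → L²(ℝ^d; ℝ^d)`. -/
def H1.grad {d : ℕ} (F : H1 d) : L2Vec d := F.1.snd

theorem H1.norm_toL2_le {d : ℕ} (F : H1 d) : ‖H1.toL2 d F‖ ≤ ‖F‖ := WithLp.norm_fst_le _ F.1

theorem H1.norm_grad_le {d : ℕ} (F : H1 d) : ‖F.grad‖ ≤ ‖F‖ := WithLp.norm_snd_le _ F.1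

theorem H1.integral_toL2_mul_fderiv {d : ℕ} (F : H1 d) {φ : E d → ℝ} (hφ : ContDiff ℝ ∞ φ)
    (hc : HasCompactSupport φ) (v : E d) :
    ∫ x, H1.toL2 d F x * fderiv ℝ φ x v = - ∫ x, φ x * inner ℝ v (F.grad x) := by
  have h1 : ∫ x, H1.toL2 d F x • gradient φ x = - ∫ x, φ x • F.grad x := F.2 φ hφ hc
  have h2 := congrArg (fun y => inner ℝ v y) h1
  simp only [inner_neg_right] at h2
  rw [← integral_inner (integrable_smul_gradient _ hφ hc),
    ← integral_inner (integrable_test_smul _ hφ hc)] at h2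
  simp only [real_inner_smul_right] at h2
  rw [← h2]
  refine integral_congr_ae (Filter.Eventually.of_forall fun x => ?_)
  simp only
  rw [real_inner_comm, gradient, InnerProductSpace.toDual_symm_apply]

/-- The unit vector of the line. -/
def lineDir : E 1 := EuclideanSpace.single 0 1

theorem measurePreserving_smul_lineDir : MeasurePreserving (fun s : ℝ => s • lineDir) := by
  have h := (PiLp.volume_preserving_toLp (Fin 1)).comp
    (volume_preserving_funUnique (Fin 1) ℝ).symm
  have hfun : (fun s : ℝ => s • lineDir) =
      WithLp.toLp 2 ∘ (MeasurableEquiv.funUnique (Fin 1) ℝ).symm := by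
    ext s i
    rw [Subsingleton.elim i 0]
    simp [lineDir]
  rw [hfun]
  exact h

variable {a : ℝ → ℝ} {φ : E 1 → ℝ}

/-- An average of `φ` over a unit segment, with weight `a`. -/
abbrev lineAverage (a : ℝ → ℝ) (φ : E 1 → ℝ) : E 1 → ℝ :=
  potential (volume.restrict (Ioo (0 : ℝ) 1)) a (fun s => s • lineDir) φ

theorem integrableOn_weight (ha : Continuous a) :
    Integrable a (volume.restrict (Ioo (0 : ℝ) 1)) :=
  (ha.integrableOn_Icc (a := 0) (b := 1)).mono_set Ioo_subset_Icc_self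

theorem measurable_smul_lineDir : Measurable fun s : ℝ => s • lineDir := by fun_prop

theorem contDiff_lineAverage (ha : Continuous a) (hφ : ContDiff ℝ ∞ φ)
    (hc : HasCompactSupport φ) : ContDiff ℝ ∞ (lineAverage a φ) :=
  contDiff_potential (integrableOn_weight ha) measurable_smul_lineDir hφ hc

theorem hasCompactSupport_lineAverage (hc : HasCompactSupport φ) :
    HasCompactSupport (lineAverage a φ) := by
  have hK : IsCompact ((fun s : ℝ => s • lineDir) '' Icc (0 : ℝ) 1) :=
    isCompact_Icc.image (by fun_prop)
  refine HasCompactSupport.intro (hc.isCompact.add hK) fun x hx => ?_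
  unfold lineAverage potential
  refine setIntegral_eq_zero_of_forall_eq_zero fun s hs => ?_
  have : φ (x - s • lineDir) = 0 := by
    by_contra hne
    refine hx ?_
    rw [← sub_add_cancel x (s • lineDir)]
    exact add_mem_add (subset_tsupport _ hne) ⟨s, Ioo_subset_Icc_self hs, rfl⟩
  simp only [this, smul_zero]

/-- The sup norm and the `L¹` norm of the average are both at most `‖φ‖₁`, the former because a
segment is part of the line, the latter because it has unit length; interpolate. -/
theorem eLpNorm_two_lineAverage_le (ha : Continuous a) (ha1 : ∀ s ∈ Ioo (0 : ℝ) 1, |a s| ≤ 1)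
    (hφ : ContDiff ℝ ∞ φ) (hc : HasCompactSupport φ) :
    eLpNorm (lineAverage a φ) 2 volume ≤ eLpNorm φ 1 volume := by
  have hpt : ∀ x, ‖lineAverage a φ x‖ₑ ≤
      ∫⁻ s in Ioo (0 : ℝ) 1, ‖φ (x - s • lineDir)‖ₑ := by
    intro x
    refine (enorm_integral_le_lintegral_enorm _).trans ?_
    refine setLIntegral_mono' measurableSet_Ioo fun s hs => ?_
    rw [enorm_smul]
    refine mul_le_of_le_one_left' ?_
    rw [← ofReal_norm, Real.norm_eq_abs]
    exact ENNReal.ofReal_le_one.2 (ha1 s hs)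
  have hcont := (contDiff_lineAverage ha hφ hc).continuous
  have hφm := hφ.continuous.measurable
  have h1 : eLpNorm (lineAverage a φ) ⊤ volume ≤ eLpNorm φ 1 volume := by
    rw [eLpNorm_exponent_top]
    refine essSup_le_of_ae_le _ (Filter.Eventually.of_forall fun x => (hpt x).trans ?_)
    refine (setLIntegral_le_lintegral _ _).trans (le_of_eq ?_)
    have hm : Measurable fun y : E 1 => ‖φ (x - y)‖ₑ := (hφm.comp (by fun_prop)).enorm
    rw [measurePreserving_smul_lineDir.lintegral_comp hm,
      lintegral_sub_left_eq_self (fun y => ‖φ y‖ₑ) x, eLpNorm_one_eq_lintegral_enorm]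
  have h2 : eLpNorm (lineAverage a φ) 1 volume ≤ eLpNorm φ 1 volume := by
    rw [eLpNorm_one_eq_lintegral_enorm]
    refine (lintegral_mono hpt).trans ?_
    have hm : Measurable fun y : E 1 × ℝ => ‖φ (y.1 - y.2 • lineDir)‖ₑ :=
      (hφm.comp (by fun_prop)).enorm
    rw [lintegral_lintegral_swap hm.aemeasurable]
    have h3 : ∀ s : ℝ, ∫⁻ x, ‖φ (x - s • lineDir)‖ₑ = eLpNorm φ 1 volume := fun s => by
      rw [lintegral_sub_right_eq_self (fun x => ‖φ x‖ₑ), eLpNorm_one_eq_lintegral_enorm]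
    simp_rw [h3]
    simp
  have h3 := eLpNorm_le_rpow_mul_rpow (μ := volume) hcont.aestronglyMeasurable (p := 2) one_le_two
  rw [ENNReal.ofReal_ofNat] at h3
  calc _ ≤ _ := h3
    _ ≤ eLpNorm φ 1 volume ^ (((2 : ℝ) - 1) / 2) * eLpNorm φ 1 volume ^ ((1 : ℝ) / 2) :=
        mul_le_mul' (ENNReal.rpow_le_rpow h1 (by norm_num)) (ENNReal.rpow_le_rpow h2 (by norm_num))
    _ = _ := by
        rw [← ENNReal.rpow_add_of_nonneg _ _ (by norm_num) (by norm_num)]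
        norm_num

/-- Integration by parts along the segment: the weight `1 - s` equals one at `s = 0` and zero at `s
= 1`, so `φ x` is the only boundary term. This writes `φ` as the derivative of one average plus
another average. -/
theorem fderiv_lineAverage_one_sub (hφ : ContDiff ℝ ∞ φ) (hc : HasCompactSupport φ) (x : E 1) :
    fderiv ℝ (lineAverage (fun s => 1 - s) φ) x lineDir = φ x - lineAverage (fun _ => 1) φ x := by
  have hac : Continuous fun s : ℝ => 1 - s := by fun_prop
  rw [fderiv_potential_apply (integrableOn_weight hac) measurable_smul_lineDir hφ hc]
  have hd : ∀ s : ℝ, HasDerivAt (fun s : ℝ => φ (x - s • lineDir))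
      (- fderiv ℝ φ (x - s • lineDir) lineDir) s := fun s => by
    have h1 : HasDerivAt (fun s : ℝ => x - s • lineDir) (-lineDir) s := by
      have := ((hasDerivAt_id s).smul_const lineDir).const_sub x
      simpa using this
    have h2 := ((hφ.differentiable (by simp)) (x - s • lineDir)).hasFDerivAt.comp_hasDerivAt s h1
    rwa [map_neg] at h2
  have hd2 : ∀ s : ℝ, HasDerivAt (fun s : ℝ => (1 - s) * φ (x - s • lineDir))
      (-1 * φ (x - s • lineDir) + (1 - s) * (- fderiv ℝ φ (x - s • lineDir) lineDir)) s := fun s =>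
    ((hasDerivAt_id s).const_sub 1).mul (hd s)
  have hc1 : Continuous fun s : ℝ => φ (x - s • lineDir) := hφ.continuous.comp (by fun_prop)
  have hc2 : Continuous fun s : ℝ => fderiv ℝ φ (x - s • lineDir) lineDir :=
    (contDiff_fderiv_apply hφ lineDir).continuous.comp (by fun_prop)
  have hF := intervalIntegral.integral_eq_sub_of_hasDerivAt (fun s _ => hd2 s)
    ((by fun_prop : Continuous _).intervalIntegrable 0 1)
  rw [intervalIntegral.integral_add ((by fun_prop : Continuous _).intervalIntegrable 0 1)
    ((by fun_prop : Continuous _).intervalIntegrable 0 1)] at hF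
  simp only [mul_neg, neg_mul, one_mul, intervalIntegral.integral_neg, sub_self, zero_mul, sub_zero,
    zero_smul, zero_sub] at hF
  simp only [lineAverage, potential, smul_eq_mul, one_mul]
  rw [intervalIntegral.integral_of_le zero_le_one, intervalIntegral.integral_of_le zero_le_one,
    integral_Ioc_eq_integral_Ioo, integral_Ioc_eq_integral_Ioo] at hF
  linarith

theorem enorm_integral_mul_le_eLpNorm_two {d : ℕ} {f g : E d → ℝ} (hf : AEStronglyMeasurable f)
    (hg : AEStronglyMeasurable g) :
    ‖∫ x, f x * g x‖ₑ ≤ eLpNorm f 2 volume * eLpNorm g 2 volume := by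
  have : ENNReal.HolderConjugate 2 2 := ⟨by rw [ENNReal.inv_two_add_inv_two, inv_one]⟩
  refine (enorm_integral_le_lintegral_enorm _).trans ?_
  simp_rw [enorm_mul]
  refine (lintegral_mul_le_eLpNorm_mul_eLpNorm 2 2 hf.enorm hg.enorm).trans ?_
  rw [eLpNorm_enorm, eLpNorm_enorm]

/-- The embedding `H¹(ℝ) → L^∞(ℝ)`. -/
theorem H1.eLpNorm_top_toL2_le (F : H1 1) : eLpNorm (H1.toL2 1 F) ⊤ volume ≤ 2 * ‖F‖ₑ := by
  have hf := Lp.memLp (H1.toL2 1 F)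
  have hg : MemLp (fun x => inner ℝ lineDir (F.grad x)) 2 volume :=
    (Lp.memLp F.grad).const_inner lineDir
  refine eLpNorm_top_le_of_forall_test (hf.locallyIntegrable one_le_two) fun φ hφ hc => ?_
  -- Duality with `L¹`: of the two parts of `φ`, the derivative is moved onto the weak gradient of
  -- `F` and the average is paired with `F`. Each pairing is at most `‖F‖ ‖φ‖₁`, whence the factor
  -- `2`.
  have hac : Continuous fun s : ℝ => 1 - s := by fun_prop
  have hΨ := contDiff_lineAverage hac hφ hc
  have hΨc := hasCompactSupport_lineAverage (a := fun s => 1 - s) hc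
  have hS := contDiff_lineAverage (a := fun _ => 1) continuous_const hφ hc
  have hSc := hasCompactSupport_lineAverage (a := fun _ => 1) hc
  have h1 := F.integral_toL2_mul_fderiv hΨ hΨc lineDir
  simp_rw [fderiv_lineAverage_one_sub hφ hc, mul_sub] at h1
  have hloc := hf.locallyIntegrable one_le_two
  have hi1 : Integrable fun x => H1.toL2 1 F x * φ x :=
    hloc.integrable_smul_right_of_hasCompactSupport hφ.continuous hc
  have hi2 : Integrable fun x => H1.toL2 1 F x * lineAverage (fun _ => 1) φ x :=
    hloc.integrable_smul_right_of_hasCompactSupport hS.continuous hSc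
  rw [integral_sub hi1 hi2, sub_eq_iff_eq_add] at h1
  have hn2 : eLpNorm (H1.toL2 1 F) 2 volume ≤ ‖F‖ₑ := by
    rw [← Lp.enorm_def, enorm_le_iff_norm_le]
    exact F.norm_toL2_le
  have hn3 : eLpNorm (fun x => inner ℝ lineDir (F.grad x)) 2 volume ≤ ‖F‖ₑ := by
    refine (eLpNorm_mono fun x => ?_).trans (b := eLpNorm F.grad 2 volume) ?_
    · refine (norm_inner_le_norm _ _).trans (le_of_eq ?_)
      simp [lineDir]
    · rw [← Lp.enorm_def, enorm_le_iff_norm_le]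
      exact F.norm_grad_le
  have e1 : ∫ x, φ x * H1.toL2 1 F x = ∫ x, H1.toL2 1 F x * φ x := by simp_rw [mul_comm]
  rw [e1, h1]
  refine (enorm_add_le _ _).trans ?_
  rw [enorm_neg, two_mul, add_mul]
  refine add_le_add ?_ ?_
  · refine (enorm_integral_mul_le_eLpNorm_two hΨ.continuous.aestronglyMeasurable
      hg.aestronglyMeasurable).trans ?_
    rw [mul_comm]
    refine mul_le_mul' hn3 (eLpNorm_two_lineAverage_le hac (fun s hs => ?_) hφ hc)
    rw [abs_of_nonneg (by linarith [hs.2])]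
    linarith [hs.1]
  · refine (enorm_integral_mul_le_eLpNorm_two hf.aestronglyMeasurable
      hS.continuous.aestronglyMeasurable).trans ?_
    refine mul_le_mul' hn2 (eLpNorm_two_lineAverage_le continuous_const (fun s hs => ?_) hφ hc)
    simp

end Sobolev

/-! ### Measurable representatives and integrability of the drift and the solution. -/

section Data

variable {d : ℕ}

theorem ae_timeMeasure_mem_Ioc : ∀ᵐ t ∂timeMeasure, t ∈ Ioc (0 : ℝ) 1 := by
  have h1 : ∀ᵐ t : ℝ, t ≠ 0 := by simp [ae_iff]
  filter_upwards [ae_restrict_mem measurableSet_Icc, ae_restrict_of_ae h1] with t ht h0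
  exact ⟨lt_of_le_of_ne ht.1 (Ne.symm h0), ht.2⟩

/-- The drift is cut off outside `(0, 1]`, at the cost of the null time `0`, so that all time
integrals may run over the whole line. -/
theorem exists_isDrift {b : ℝ → E d → E d} {r q M : ℝ≥0∞} (hr0 : r ≠ 0) (hr : r ≠ ⊤)
    (hb : FieldMeasurable b) (hM : mixedNorm r q b ≤ M) :
    ∃ b' : ℝ × E d → E d, IsDrift b' q r.toReal M ∧
      ∀ᵐ t ∂timeMeasure, (fun x => b' (t, x)) =ᵐ[volume] b t := by
  obtain ⟨f, hfm, hf⟩ := hb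
  set b' : ℝ × E d → E d := (Ioc (0 : ℝ) 1 ×ˢ univ).indicator f with hb'
  have hae : ∀ᵐ t ∂timeMeasure, (fun x => b' (t, x)) =ᵐ[volume] b t := by
    filter_upwards [Measure.ae_ae_of_ae_prod hf, ae_timeMeasure_mem_Ioc] with t h1 h2
    filter_upwards [h1] with x hx
    have hmem : (t, x) ∈ Ioc (0 : ℝ) 1 ×ˢ (univ : Set (E d)) := ⟨h2, mem_univ _⟩
    rw [hb', indicator_of_mem hmem, ← hx]
  have hz : ∀ p : ℝ × E d, p.1 ∉ Ioc (0 : ℝ) 1 → b' p = 0 := fun p hp =>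
    indicator_of_notMem (fun h => hp h.1) _
  refine ⟨b', ⟨hfm.measurable.indicator (measurableSet_Ioc.prod MeasurableSet.univ), hz, ?_⟩, hae⟩
  refine le_trans ?_ hM
  rw [mixedNorm, eLpNorm_eq_lintegral_rpow_enorm_toReal hr0 hr]
  refine ENNReal.rpow_le_rpow ?_ (by positivity)
  have hrp := ENNReal.toReal_pos hr0 hr
  have h1 : ∫⁻ s, eLpNorm (fun x => ‖b' (s, x)‖ₑ) q volume ^ r.toReal =
      ∫⁻ s in Icc (0 : ℝ) 1, eLpNorm (fun x => ‖b' (s, x)‖ₑ) q volume ^ r.toReal := by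
    refine (setLIntegral_eq_of_support_subset ?_).symm
    intro s hs
    by_contra hn
    refine hs ?_
    have : (fun x => ‖b' (s, x)‖ₑ) = 0 := by
      ext1 x
      rw [hz (s, x) fun h => hn (Ioc_subset_Icc_self h), enorm_zero, Pi.zero_apply]
    simp only [this, eLpNorm_zero]
    exact ENNReal.zero_rpow_of_pos hrp
  rw [h1]
  refine lintegral_mono_ae ?_
  filter_upwards [hae] with t ht
  rw [eLpNorm_enorm (fun x => b' (t, x)), eLpNorm_congr_ae ht, enorm_eq_self]

theorem integrable_exp_neg_norm : Integrable fun x : E d => Real.exp (-‖x‖) := by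
  have h1 := (integrable_one_add_norm (E := E d) (μ := volume) (r := (d + 1 : ℕ)) (by
    rw [finrank_euclideanSpace_fin]; exact_mod_cast Nat.lt_succ_self d)).const_mul
      (((d + 1).factorial : ℝ) * Real.exp 1)
  refine h1.mono' (by fun_prop) (Filter.Eventually.of_forall fun x => ?_)
  have h2 := Real.pow_div_factorial_le_exp (1 + ‖x‖) (by positivity) (d + 1)
  have hf : (0 : ℝ) < (d + 1).factorial := by exact_mod_cast Nat.factorial_pos _
  rw [div_le_iff₀ hf, Real.exp_add] at h2
  have hp : (0 : ℝ) < (1 + ‖x‖) ^ (d + 1) := by positivity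
  rw [Real.norm_of_nonneg (Real.exp_pos _).le, Real.rpow_neg (by positivity), Real.rpow_natCast,
    ← div_eq_mul_inv, le_div_iff₀ hp, Real.exp_neg, ← div_eq_inv_mul,
    div_le_iff₀ (Real.exp_pos _)]
  linarith

theorem eLpNorm_exp_neg_norm_lt_top {s : ℝ≥0∞} (hs : 1 ≤ s) :
    eLpNorm (fun x : E d => Real.exp (-‖x‖)) s volume < ⊤ := by
  have htop : eLpNorm (fun x : E d => Real.exp (-‖x‖)) ⊤ volume < ⊤ := by
    refine (eLpNorm_exponent_top (μ := volume)).trans_lt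
      (lt_of_le_of_lt (essSup_le_of_ae_le 1 (Filter.Eventually.of_forall fun x => ?_))
        ENNReal.one_lt_top)
    beta_reduce
    rw [Real.enorm_of_nonneg (Real.exp_pos _).le]
    simp
  have hone : eLpNorm (fun x : E d => Real.exp (-‖x‖)) 1 volume < ⊤ :=
    (memLp_one_iff_integrable.2 integrable_exp_neg_norm).2
  rcases eq_or_ne s ⊤ with rfl | hst
  · exact htop
  have hs1 : 1 ≤ s.toReal := by
    rw [← ENNReal.toReal_one]; exact ENNReal.toReal_mono hst hs
  rw [← ENNReal.ofReal_toReal hst]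
  refine (eLpNorm_le_rpow_mul_rpow (by fun_prop) hs1).trans_lt (ENNReal.mul_lt_top ?_ ?_)
  · exact ENNReal.rpow_lt_top_of_nonneg (div_nonneg (by linarith) (by linarith)) htop.ne
  · exact ENNReal.rpow_lt_top_of_nonneg (by positivity) hone.ne

theorem rpow_le_one_add_sq {x : ℝ≥0∞} {ρ : ℝ} (h0 : 0 ≤ ρ) (h2 : ρ ≤ 2) :
    x ^ ρ ≤ 1 + x ^ (2 : ℝ) := by
  rcases le_total x 1 with h | h
  · exact (ENNReal.rpow_le_one h h0).trans le_self_add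
  · exact (ENNReal.rpow_le_rpow_of_exponent_le h h2).trans le_add_self

/-- On a bounded time interval `L²` is contained in `L^ρ`; for the conjugate exponent `ρ` of `r` the
condition `ρ ≤ 2` means `r ≥ 2`. -/
theorem lintegral_slice_rpow_lt_top {u : ℝ × E d → ℝ} {p₀ : ℝ≥0∞}
    (hV : ∫⁻ t in Ioc (0 : ℝ) 1, eLpNorm (fun x => u (t, x)) p₀ volume ^ (2 : ℝ) < ⊤) {ρ : ℝ}
    (h0 : 0 ≤ ρ) (h2 : ρ ≤ 2) :
    ∫⁻ t in Ioc (0 : ℝ) 1, eLpNorm (fun x => u (t, x)) p₀ volume ^ ρ < ⊤ := by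
  refine (lintegral_mono fun t => rpow_le_one_add_sq h0 h2).trans_lt ?_
  rw [lintegral_add_left measurable_const]
  refine ENNReal.add_lt_top.2 ⟨?_, hV⟩
  simp

theorem integrable_mul_exp_of_slice {u : ℝ × E d → ℝ} (hu : Measurable u) (p₀ p₁ : ℝ≥0∞)
    [ENNReal.HolderConjugate p₀ p₁]
    (hV : ∫⁻ t in Ioc (0 : ℝ) 1, eLpNorm (fun x => u (t, x)) p₀ volume ^ (2 : ℝ) < ⊤) :
    Integrable (fun p : ℝ × E d => u p * Real.exp (-‖p.2‖)) (timeMeasure.prod volume) := by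
  have hm : Measurable fun p : ℝ × E d => u p * Real.exp (-‖p.2‖) := hu.mul (by fun_prop)
  refine ⟨hm.aestronglyMeasurable, ?_⟩
  rw [hasFiniteIntegral_iff_enorm, lintegral_prod _ hm.enorm.aemeasurable]
  set W := eLpNorm (fun x : E d => Real.exp (-‖x‖)) p₁ volume with hW
  have hWt : W < ⊤ := eLpNorm_exp_neg_norm_lt_top (ENNReal.HolderConjugate.one_le p₁ p₀)
  have h1 : ∀ t : ℝ, ∫⁻ x, ‖u (t, x) * Real.exp (-‖x‖)‖ₑ ≤
      eLpNorm (fun x => u (t, x)) p₀ volume * W := by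
    intro t
    simp_rw [enorm_mul]
    refine (lintegral_mul_le_eLpNorm_mul_eLpNorm p₀ p₁ (measurable_slice hu t).enorm.aemeasurable
      (by fun_prop)).trans ?_
    rw [eLpNorm_enorm, eLpNorm_enorm]
  refine (lintegral_mono h1).trans_lt ?_
  rw [lintegral_mul_const _ (measurable_eLpNorm_right hu.stronglyMeasurable p₀)]
  refine ENNReal.mul_lt_top ?_ hWt
  rw [timeMeasure, ← restrict_Ioc_eq_restrict_Icc]
  have h2 := lintegral_slice_rpow_lt_top hV zero_le_one one_le_two
  simpa only [ENNReal.rpow_one] using h2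

/-- Hölder in space with three factors, `u` in `L^{p₀}`, the drift in `L^q` and the exponential in
`L^s`, where `1/p₀ + 1/q + 1/s = 1`; Hölder in time with `ρ` and `r`. -/
theorem IsDrift.lintegral_mul_exp_lt_top {b : ℝ × E d → E d} {q M : ℝ≥0∞} {r ρ : ℝ}
    (hr : ρ.HolderConjugate r) (hρ : ρ ≤ 2) (hM : M ≠ ⊤) (hb : IsDrift b q r M)
    {u : ℝ × E d → ℝ} (hu : Measurable u) (p₀ p₁ s : ℝ≥0∞) [ENNReal.HolderConjugate p₀ p₁]
    [ENNReal.HolderTriple s q p₁] (hs : 1 ≤ s)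
    (hV : ∫⁻ t in Ioc (0 : ℝ) 1, eLpNorm (fun x => u (t, x)) p₀ volume ^ (2 : ℝ) < ⊤) :
    ∫⁻ p : ℝ × E d, ‖b p‖ₑ * ‖u p‖ₑ * ENNReal.ofReal (Real.exp (-‖p.2‖)) < ⊤ := by
  have hm : Measurable fun p : ℝ × E d => ‖b p‖ₑ * ‖u p‖ₑ * ENNReal.ofReal (Real.exp (-‖p.2‖)) :=
    (hb.measurable.enorm.mul hu.enorm).mul (by fun_prop)
  rw [Measure.volume_eq_prod, lintegral_prod _ hm.aemeasurable]
  set W := eLpNorm (fun x : E d => Real.exp (-‖x‖)) s volume with hW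
  have hWt : W < ⊤ := eLpNorm_exp_neg_norm_lt_top hs
  set β : ℝ → ℝ≥0∞ := fun t => eLpNorm (fun x => ‖b (t, x)‖ₑ) q volume with hβ
  set V : ℝ → ℝ≥0∞ := fun t => eLpNorm (fun x => u (t, x)) p₀ volume with hVd
  have hVm : Measurable V := measurable_eLpNorm_right hu.stronglyMeasurable p₀
  have h1 : ∀ t : ℝ, ∫⁻ x, ‖b (t, x)‖ₑ * ‖u (t, x)‖ₑ * ENNReal.ofReal (Real.exp (-‖x‖)) ≤
      W * ((Ioc (0 : ℝ) 1).indicator V t * β t) := by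
    intro t
    by_cases ht : t ∈ Ioc (0 : ℝ) 1
    · rw [indicator_of_mem ht]
      have h2 : ∀ x, ‖b (t, x)‖ₑ * ‖u (t, x)‖ₑ * ENNReal.ofReal (Real.exp (-‖x‖)) =
          ‖u (t, x)‖ₑ * ‖Real.exp (-‖x‖) • b (t, x)‖ₑ := fun x => by
        rw [enorm_smul, Real.enorm_of_nonneg (Real.exp_pos _).le]
        ring
      simp_rw [h2]
      have hbm := measurable_slice hb.measurable t
      have hem : Measurable fun x : E d => Real.exp (-‖x‖) := by fun_prop
      refine (lintegral_mul_le_eLpNorm_mul_eLpNorm p₀ p₁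
        (measurable_slice hu t).enorm.aemeasurable (hem.smul hbm).enorm.aemeasurable).trans ?_
      rw [eLpNorm_enorm, eLpNorm_enorm]
      have h3 := eLpNorm_smul_le_mul_eLpNorm (p := s) (q := q) (r := p₁) (μ := volume)
        hbm.aestronglyMeasurable hem.aestronglyMeasurable
      calc _ ≤ V t * (W * eLpNorm (fun x => b (t, x)) q volume) := mul_le_mul_right h3 _
        _ = _ := by rw [hβ]; simp only; rw [eLpNorm_enorm]; ring
    · have h2 : ∀ x, b (t, x) = 0 := fun x => hb.eq_zero (t, x) ht
      simp [h2]
  refine (lintegral_mono h1).trans_lt ?_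
  have hVi : Measurable ((Ioc (0 : ℝ) 1).indicator V) := hVm.indicator measurableSet_Ioc
  have hβm : Measurable β := hb.measurable_norm
  have hVβ : Measurable fun t => (Ioc (0 : ℝ) 1).indicator V t * β t := hVi.mul hβm
  rw [lintegral_const_mul _ hVβ]
  refine ENNReal.mul_lt_top hWt (lt_of_le_of_lt (ENNReal.lintegral_mul_le_Lp_mul_Lq volume hr
    hVi.aemeasurable hβm.aemeasurable) (ENNReal.mul_lt_top ?_ ?_))
  · refine ENNReal.rpow_lt_top_of_nonneg (one_div_nonneg.2 hr.nonneg) (ne_of_lt ?_)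
    refine lt_of_eq_of_lt ?_ (lintegral_slice_rpow_lt_top hV hr.nonneg hρ)
    rw [← lintegral_indicator measurableSet_Ioc]
    refine lintegral_congr fun t => ?_
    by_cases ht : t ∈ Ioc (0 : ℝ) 1
    · rw [indicator_of_mem ht, indicator_of_mem ht]
    · rw [indicator_of_notMem ht, indicator_of_notMem ht, ENNReal.zero_rpow_of_pos hr.pos]
  · exact hb.norm_le.trans_lt (lt_top_iff_ne_top.2 hM)

theorem integral_mul_backwardHeat_add_eq_zero {b : ℝ → E d → E d} {u₀ : E d → ℝ} {U : ℝ → H1 d}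
    (hsol : IsDistribSolution b u₀ U) {b' : ℝ × E d → E d} {u : ℝ × E d → ℝ}
    (hb : Measurable b') (hu : Measurable u)
    (hbb : ∀ᵐ t ∂timeMeasure, (fun x => b' (t, x)) =ᵐ[volume] b t)
    (huU : ∀ᵐ t ∂timeMeasure, (fun x => u (t, x)) =ᵐ[volume] H1.toL2 d (U t))
    (hI1 : Integrable (fun p : ℝ × E d => u p * Real.exp (-‖p.2‖)) (timeMeasure.prod volume))
    (hI2 : ∫⁻ p : ℝ × E d, ‖b' p‖ₑ * ‖u p‖ₑ * ENNReal.ofReal (Real.exp (-‖p.2‖)) < ⊤)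
    {φ : ℝ × E d → ℝ} (hφ : ContDiff ℝ ∞ φ) (hc : HasCompactSupport φ)
    (hs : tsupport φ ⊆ Iio 1 ×ˢ univ) :
    ∫ p, u p * (backwardHeat φ p + fderiv ℝ φ p (0, b' p)) ∂(timeMeasure.prod volume) +
      ∫ x, u₀ x * φ (0, x) = 0 := by
  refine Eq.trans (congrArg (fun y => y + ∫ x, u₀ x * φ (0, x)) ?_) (hsol φ hφ hc hs)
  have hBc := (contDiff_backwardHeat hφ).continuous
  obtain ⟨C, h0, hC⟩ := exists_norm_le_mul_exp (hφ.continuous_fderiv (by simp))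
    (hc.fderiv (𝕜 := ℝ))
  have hi1 : Integrable (fun p => u p * backwardHeat φ p) (timeMeasure.prod volume) :=
    (integrable_mul_of_integrable_exp hBc (hasCompactSupport_backwardHeat hc) hI1).congr
      (Filter.Eventually.of_forall fun p => mul_comm _ _)
  have hi2 : Integrable (fun p => u p * fderiv ℝ φ p (0, b' p)) (timeMeasure.prod volume) := by
    have h1 : Continuous fun y : (ℝ × E d) × E d => fderiv ℝ φ y.1 (0, y.2) :=
      ((hφ.continuous_fderiv (by simp)).comp continuous_fst).clm_apply
        (continuous_const.prodMk continuous_snd)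
    have hm : Measurable fun p => u p * fderiv ℝ φ p (0, b' p) :=
      hu.mul (h1.measurable.comp (measurable_id.prodMk hb))
    rw [timeMeasure_prod_volume]
    refine Integrable.restrict ⟨hm.aestronglyMeasurable, ?_⟩
    rw [hasFiniteIntegral_iff_enorm]
    have hme : Measurable fun p : ℝ × E d =>
        ‖b' p‖ₑ * ‖u p‖ₑ * ENNReal.ofReal (Real.exp (-‖p.2‖)) :=
      (hb.enorm.mul hu.enorm).mul (by fun_prop)
    have hfin := ENNReal.mul_lt_top (ENNReal.ofReal_lt_top (r := C)) hI2
    rw [← lintegral_const_mul _ hme] at hfin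
    refine lt_of_le_of_lt (lintegral_mono fun p => ?_) hfin
    have h2 := ENNReal.ofReal_le_ofReal (norm_fderiv_apply_le_mul_exp hC (b' p) p)
    rw [ofReal_norm, ENNReal.ofReal_mul (mul_nonneg h0 (norm_nonneg _)), ENNReal.ofReal_mul h0,
      ofReal_norm] at h2
    rw [enorm_mul]
    calc _ ≤ ‖u p‖ₑ * (ENNReal.ofReal C * ‖b' p‖ₑ * ENNReal.ofReal (Real.exp (-‖p.2‖))) :=
          mul_le_mul_right h2 _
      _ = _ := by ring
  have hi : Integrable (fun p => u p * (backwardHeat φ p + fderiv ℝ φ p (0, b' p)))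
      (timeMeasure.prod volume) :=
    (hi1.add hi2).congr (Filter.Eventually.of_forall fun p => (mul_add _ _ _).symm)
  rw [integral_prod _ hi]
  refine integral_congr_ae ?_
  filter_upwards [hbb, huU] with t h1 h2
  refine integral_congr_ae ?_
  filter_upwards [h1, h2] with x hx1 hx2
  rw [deriv_slice hφ, inner_gradient_slice hφ, laplacian_slice hφ, ← hx1, ← hx2, backwardHeat]
  ring

end Data

/-! ### Parabolic solutions are mild solutions. -/

section Existence

variable {d : ℕ}

theorem IsParabolicSolution.exists_isMildSolution {b : ℝ → E d → E d} {u₀ : E d → ℝ}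
    {U : ℝ → H1 d} (hU : IsParabolicSolution b u₀ U) (hu₀ : Measurable u₀) (hui : Integrable u₀)
    {q M : ℝ≥0∞} {r ρ : ℝ} (hr : ρ.HolderConjugate r) (hρ : ρ ≤ 2) (hM : M ≠ ⊤)
    {b' : ℝ × E d → E d} (hb : IsDrift b' q r M)
    (hbb : ∀ᵐ t ∂timeMeasure, (fun x => b' (t, x)) =ᵐ[volume] b t) (p₀ p₁ s : ℝ≥0∞)
    [ENNReal.HolderConjugate p₀ p₁] [ENNReal.HolderTriple s q p₁] (hs : 1 ≤ s)
    (hemb : ∃ C : ℝ≥0∞, C ≠ ⊤ ∧ ∀ F : H1 d, eLpNorm (H1.toL2 d F) p₀ volume ≤ C * ‖F‖ₑ) :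
    ∃ u : ℝ × E d → ℝ, IsMildSolution b' u₀ p₀ ρ u ∧
      ∀ᵐ t ∂timeMeasure, (fun x => u (t, x)) =ᵐ[volume] H1.toL2 d (U t) := by
  obtain ⟨C, hC, hemb⟩ := hemb
  have hU2 : MemLp U 2 timeMeasure := hU.1.1
  obtain ⟨u, hu, huU⟩ := exists_measurable_uncurry
    ((H1.toL2 d).continuous.comp_aestronglyMeasurable hU2.1)
  have hV : ∫⁻ t in Ioc (0 : ℝ) 1, eLpNorm (fun x => u (t, x)) p₀ volume ^ (2 : ℝ) < ⊤ := by
    rw [restrict_Ioc_eq_restrict_Icc]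
    have h1 : ∀ᵐ t ∂timeMeasure, eLpNorm (fun x => u (t, x)) p₀ volume ^ (2 : ℝ) ≤
        C ^ (2 : ℝ) * ‖U t‖ₑ ^ (2 : ℝ) := by
      filter_upwards [huU] with t ht
      rw [eLpNorm_congr_ae ht, ← ENNReal.mul_rpow_of_nonneg _ _ zero_le_two]
      exact ENNReal.rpow_le_rpow (hemb _) zero_le_two
    refine (lintegral_mono_ae h1).trans_lt ?_
    rw [lintegral_const_mul' _ _ (ENNReal.rpow_ne_top_of_nonneg zero_le_two hC)]
    refine ENNReal.mul_lt_top (ENNReal.rpow_lt_top_of_nonneg zero_le_two hC) ?_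
    have h2 := (eLpNorm_lt_top_iff_lintegral_rpow_enorm_lt_top two_ne_zero
      ENNReal.ofNat_ne_top).1 hU2.2
    simpa using h2
  have hI1 := integrable_mul_exp_of_slice hu p₀ p₁ hV
  have hI2 := hb.lintegral_mul_exp_lt_top hr hρ hM hu p₀ p₁ s hs hV
  refine ⟨u, ⟨hu, lintegral_slice_rpow_lt_top hV hr.nonneg hρ, hI2, ?_⟩, huU⟩
  exact eq_heatFlow_add_duhamel hb.measurable hu hu₀ hui hb.eq_zero hI1 hI2 fun φ hφ hc hs =>
    integral_mul_backwardHeat_add_eq_zero hU.2 hb.measurable hu hbb huU hI1 hI2 hφ hc hs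

end Existence

/-! ### Arithmetic of the exponents. -/

section Exponents

variable {d : ℕ} {r q : ℝ≥0∞}

theorem conjExponent_ne_top (hq : 1 < q) : q.conjExponent ≠ ⊤ :=
  ENNReal.add_ne_top.2 ⟨ENNReal.one_ne_top, ENNReal.inv_ne_top.2 (tsub_pos_of_lt hq).ne'⟩

/-- Half of the hypothesis reads `1/r + d/(2q) < 1/2`, that is `1/2 + d/(2q) < 1 - 1/r = 1/ρ`. -/
theorem exists_time_exponent (hr2 : 2 ≤ r) (hr : r ≠ ⊤) (hrq : 2 / r + (d : ℝ≥0∞) / q < 1) :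
    ∃ ρ : ℝ, ρ.HolderConjugate r.toReal ∧ ρ ≤ 2 ∧ (1 / 2 + halfExp d q) * ρ < 1 := by
  have hr2' : 2 ≤ r.toReal := by
    have := ENNReal.toReal_mono hr hr2
    simpa using this
  have hconj := (Real.HolderConjugate.conjExponent (by linarith : 1 < r.toReal)).symm
  have hsum := hconj.inv_add_inv_eq_one
  have hinv : (r.toReal)⁻¹ ≤ 2⁻¹ := inv_anti₀ two_pos hr2'
  refine ⟨_, hconj, ?_, ?_⟩
  · have h1 : 2⁻¹ ≤ (Real.conjExponent r.toReal)⁻¹ := by linarith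
    exact (inv_le_inv₀ two_pos hconj.pos).1 h1
  · have h1 : (2 / r + (d : ℝ≥0∞) / q).toReal < 1 := by
      rw [← ENNReal.toReal_one]
      exact (ENNReal.toReal_lt_toReal hrq.ne_top ENNReal.one_ne_top).2 hrq
    have h2 := ENNReal.add_ne_top.1 hrq.ne_top
    rw [ENNReal.toReal_add h2.1 h2.2, ENNReal.div_eq_inv_mul, ENNReal.div_eq_inv_mul,
      ENNReal.toReal_mul, ENNReal.toReal_mul, ENNReal.toReal_inv] at h1
    simp only [ENNReal.toReal_ofNat, ENNReal.toReal_natCast] at h1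
    have h3 : 1 / 2 + halfExp d q < (Real.conjExponent r.toReal)⁻¹ := by
      unfold halfExp
      linarith
    calc _ < (Real.conjExponent r.toReal)⁻¹ * Real.conjExponent r.toReal :=
          mul_lt_mul_of_pos_right h3 hconj.pos
      _ = 1 := inv_mul_cancel₀ hconj.pos.ne'

end Exponents

/-! ### The Lebesgue space in which the solution is identified. -/

section Solution

variable {d : ℕ} {b : ℝ → E d → E d} {u₀ : E d → ℝ} {U : ℝ → H1 d}

theorem IsParabolicSolution.congr_initial (hU : IsParabolicSolution b u₀ U) {v₀ : E d → ℝ}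
    (h : u₀ =ᵐ[volume] v₀) : IsParabolicSolution b v₀ U := by
  refine ⟨hU.1, fun φ hφ hc hs => ?_⟩
  have h1 : ∫ x, v₀ x * φ (0, x) = ∫ x, u₀ x * φ (0, x) := by
    refine integral_congr_ae ?_
    filter_upwards [h] with x hx
    rw [hx]
  rw [h1]
  exact hU.2 φ hφ hc hs

/-- The contraction needs `u` in some `L^{p₀}` with `p₀ ≥ q'`. For `q ≥ 2` one has `q' ≤ 2` and `L²`
is enough. For `q < 2` the condition `d < q` forces `d = 1`, and `H¹(ℝ)` embeds in `L^∞`. -/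
theorem IsParabolicSolution.exists_isMildSolution_of_lt (hU : IsParabolicSolution b u₀ U)
    (hd : 1 ≤ d) {q M : ℝ≥0∞} (hq : (d : ℝ≥0∞) < q) (hq1 : 1 < q) (hu₀ : Measurable u₀)
    (hui : Integrable u₀) {r ρ : ℝ} (hr : ρ.HolderConjugate r) (hρ : ρ ≤ 2) (hM : M ≠ ⊤)
    {b' : ℝ × E d → E d} (hb : IsDrift b' q r M)
    (hbb : ∀ᵐ t ∂timeMeasure, (fun x => b' (t, x)) =ᵐ[volume] b t) :
    ∃ p₀, q.conjExponent ≤ p₀ ∧ ∃ u : ℝ × E d → ℝ, IsMildSolution b' u₀ p₀ ρ u ∧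
      ∀ᵐ t ∂timeMeasure, (fun x => u (t, x)) =ᵐ[volume] H1.toL2 d (U t) := by
  have hconj : ENNReal.HolderConjugate q.conjExponent q :=
    (ENNReal.HolderConjugate.conjExponent hq1.le).symm
  rcases le_or_gt 2 q with h2 | h2
  · have hinv : q⁻¹ ≤ 2⁻¹ := ENNReal.inv_le_inv.2 h2
    have : ENNReal.HolderConjugate 2 2 := ⟨by rw [ENNReal.inv_two_add_inv_two, inv_one]⟩
    -- The exponent left for the exponential weight; it is `⊤` when `q = 2`.
    have : ENNReal.HolderTriple (2⁻¹ - q⁻¹)⁻¹ q 2 :=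
      ⟨by rw [inv_inv, tsub_add_cancel_of_le hinv]⟩
    refine ⟨2, ?_, hU.exists_isMildSolution hu₀ hui hr hρ hM hb hbb 2 2 (2⁻¹ - q⁻¹)⁻¹ ?_
      ⟨1, ENNReal.one_ne_top, fun F => ?_⟩⟩
    · by_contra! hlt
      have h3 := ENNReal.HolderConjugate.inv_add_inv_eq_one q.conjExponent q
      have h4 : q.conjExponent⁻¹ + q⁻¹ < 2⁻¹ + 2⁻¹ :=
        ENNReal.add_lt_add_of_lt_of_le (ne_top_of_le_ne_top (by simp) hinv)
          (ENNReal.inv_lt_inv.2 hlt) hinv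
      rw [h3, ENNReal.inv_two_add_inv_two] at h4
      exact lt_irrefl _ h4
    · rw [ENNReal.one_le_inv]
      exact tsub_le_self.trans (by simp)
    · rw [one_mul, ← Lp.enorm_def, enorm_le_iff_norm_le]
      exact F.norm_toL2_le
  · have hd1 : d = 1 := by
      have h3 : (d : ℝ≥0∞) < (2 : ℕ) := by exact_mod_cast hq.trans h2
      have h4 : d < 2 := by exact_mod_cast h3
      omega
    subst hd1
    have : ENNReal.HolderConjugate ⊤ 1 := ENNReal.HolderConjugate.top_one
    exact ⟨⊤, le_top, hU.exists_isMildSolution hu₀ hui hr hρ hM hb hbb ⊤ 1 q.conjExponent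
      (ENNReal.HolderConjugate.one_le _ q) ⟨2, ENNReal.ofNat_ne_top, H1.eLpNorm_top_toL2_le⟩⟩

end Solution

end AdvDiff

end

/-! ### Assembly of the estimates. -/

theorem theorem3p1 (d : ℕ) (hd : 1 ≤ d) (r q : ℝ≥0∞)
    (hr2 : 2 ≤ r) (hr : r < ⊤) (hq : (d : ℝ≥0∞) < q)
    (hrq : 2 / r + (d : ℝ≥0∞) / q < 1) (M : ℝ≥0) :
    ∃ (C : ℝ → ℝ≥0) (C' : ℝ≥0),
      ∀ (b : ℝ → AdvDiff.E d → AdvDiff.E d) (u₀ : AdvDiff.E d → ℝ) (u : ℝ → AdvDiff.H1 d),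
        AdvDiff.FieldMeasurable b → AdvDiff.mixedNorm r q b ≤ M →
        MemLp u₀ 1 volume → MemLp u₀ ⊤ volume →
        AdvDiff.IsParabolicSolution b u₀ u →
        ∃ w : ℝ → AdvDiff.L2 d, AdvDiff.IsContRep u w ∧
          ∀ t ∈ Icc (0 : ℝ) 1,
            (∀ p : ℝ, 1 ≤ p →
              eLpNorm (w t) (ENNReal.ofReal p) volume ≤
                C p * eLpNorm u₀ ⊤ volume ^ ((p - 1) / p) * eLpNorm u₀ 1 volume ^ (1 / p)) ∧
            eLpNorm (w t) ⊤ volume ≤ C' * eLpNorm u₀ ⊤ volume := by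
  have hq1 : 1 < q := lt_of_le_of_lt (by exact_mod_cast hd) hq
  have hconj : ENNReal.HolderConjugate q.conjExponent q :=
    (ENNReal.HolderConjugate.conjExponent hq1.le).symm
  have hq' := AdvDiff.conjExponent_ne_top hq1
  obtain ⟨ρ, hρ, hρ2, hα⟩ := AdvDiff.exists_time_exponent hr2 hr.ne hrq
  have hρ' : 1 / 2 * ρ < 1 := by
    refine lt_of_le_of_lt (mul_le_mul_of_nonneg_right ?_ hρ.nonneg) hα
    linarith [AdvDiff.halfExp_nonneg d q]
  obtain ⟨C₁, C₂, hC⟩ := AdvDiff.exists_eLpNorm_mildRhs_le (d := d) hq' hρ hα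
    (ENNReal.coe_ne_top (r := M))
  -- The constants interpolate the two endpoint constants, which were fixed before the drift and the
  -- datum were introduced.
  refine ⟨fun p => C₂ ^ ((p - 1) / p) * C₁ ^ (1 / p), C₂, fun b u₀ u hb hbM hu1 hutop hu => ?_⟩
  -- The datum is replaced by a measurable representative; neither its norms nor the weak equation
  -- notice.
  obtain ⟨v₀, hv₀, hae⟩ := hu1.1
  rw [eLpNorm_congr_ae hae, eLpNorm_congr_ae hae]
  have hv1 : MemLp v₀ 1 volume := (memLp_congr_ae hae).1 hu1
  have hvtop : MemLp v₀ ⊤ volume := (memLp_congr_ae hae).1 hutop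
  obtain ⟨b', hb', hbb⟩ := AdvDiff.exists_isDrift (by positivity) hr.ne hb hbM
  obtain ⟨p₀, hp₀, v, hv, hvu⟩ := (hu.congr_initial hae).exists_isMildSolution_of_lt hd hq hq1
    hv₀.measurable (memLp_one_iff_integrable.1 hv1) hρ hρ2 ENNReal.coe_ne_top hb' hbb
  have hbd := hC b' v₀ p₀ v hb' hv₀.measurable hp₀ hv
  obtain ⟨w, hwc, hw⟩ := hv.exists_continuous_rep hq' hρ hρ' ENNReal.coe_ne_top hb' hv₀.measurable
    (memLp_one_iff_integrable.1 hv1) (ENNReal.mul_ne_top ENNReal.coe_ne_top hv1.2.ne)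
    (ENNReal.mul_ne_top ENNReal.coe_ne_top hvtop.2.ne) (fun t ht => (hbd t ht).1)
    (fun t ht => (hbd t ht).2)
  refine ⟨w, ⟨hwc, ?_⟩, fun t ht => ⟨fun p hp => ?_, ?_⟩⟩
  · filter_upwards [hvu, ae_restrict_of_ae hv.ae_eq_mildRhs, AdvDiff.ae_timeMeasure_mem_Ioc]
      with t h1 h2 h3
    exact Lp.ext ((hw t (Ioc_subset_Icc_self h3)).trans ((h2 h3).symm.trans h1))
  · refine (AdvDiff.eLpNorm_le_rpow_mul_rpow (Lp.aestronglyMeasurable (w t)) hp).trans ?_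
    rw [eLpNorm_congr_ae (hw t ht), eLpNorm_congr_ae (hw t ht)]
    have h1 : 0 ≤ (p - 1) / p := div_nonneg (by linarith) (by linarith)
    have h2 : 0 ≤ 1 / p := by positivity
    calc _ ≤ (C₂ * eLpNorm v₀ ⊤ volume) ^ ((p - 1) / p) *
          (C₁ * eLpNorm v₀ 1 volume) ^ (1 / p) :=
          mul_le_mul' (ENNReal.rpow_le_rpow (hbd t ht).2 h1) (ENNReal.rpow_le_rpow (hbd t ht).1 h2)
      _ = _ := by
          rw [ENNReal.mul_rpow_of_nonneg _ _ h1, ENNReal.mul_rpow_of_nonneg _ _ h2,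
            ENNReal.coe_mul, ENNReal.coe_rpow_of_nonneg _ h1, ENNReal.coe_rpow_of_nonneg _ h2]
          ring
  · rw [eLpNorm_congr_ae (hw t ht)]
    exact (hbd t ht).2
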